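/- Let $k$ be a field and $Q$ a finite quiver; paths are composed from right to left. Let $W=\sum_c a(c)\,c$ be a finite potential on $Q$ (a finite linear combination of cycles of length at least $3$, taken up to cyclic permutation) whose cyclic derivatives generate an admissible ideal of $kQ$. Let $\Lambda=\mathcal P(Q,W)=\widehat{kQ}/\overline{\langle \partial_\alpha W\mid\alpha\in Q_1\rangle}$. Let $G=\langle g\rangle$ be a cyclic group of order $n$ acting faithfully on $kQ$ by algebra automorphisms such that: - (A1) $k$ contains a primitive $n$-th root of unity $\zeta$; - (A2) $g$ permutes the vertices and maps every arrow to a multiple of an arrow; write $g*\alpha$ for the arrow of which $g(\alpha)$ is a multiple, and $g*v=g(v)$ for vertices; - (A3) every vertex not fixed by $G$ has a $G$-orbit of cardinality $n$; - (A4) $g(W)=W$ up to cyclic permutation of cycles; - (A5) $g(\alpha)=\zeta^{b(\alpha)}\alpha$ with $b(\alpha)\in\mathbb Z/n$ for every arrow $\alpha$ between fixed vertices; - (A6) arrows with at least one non-fixed end are sent to arrows; - (A7) every cycle appearing in $W$ goes (counting with multiplicity) through (i) no fixed vertex, or (ii) exactly one fixed vertex, or (iii) exactly one non-fixed vertex,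 or (iv) only fixed vertices. Choose a set $\mathcal E=\mathcal E'\sqcup\mathcal E''$ of representatives of the $G$-orbits of vertices, where $\mathcal E'$ consists of non-fixed and $\mathcal E''$ of fixed vertices. The quiver $Q_G$ has vertices $\eta^\varepsilon$ ($\varepsilon\in\mathcal E'$) and $\eta^\varepsilon_\mu$ ($\varepsilon\in\mathcal E''$, $\mu\in\mathbb Z/n$), and the following arrows, for $\varepsilon,\varepsilon'\in\mathcal E$ and $\mu\in\mathbb Z/n$: 1. $\tilde\alpha:\eta^\varepsilon\to\eta^{\varepsilon'}$ for each arrow $\alpha:g^t\varepsilon\to\varepsilon'$ with $\varepsilon,\varepsilon'\in\mathcal E'$; 2. $\tilde\alpha^\mu:\eta^\varepsilon\to\eta^{\varepsilon'}_\mu$ for each $\alpha:\varepsilon\to\varepsilon'$ with $\varepsilon\in\mathcal E'$, $\varepsilon'\in\mathcal E''$; 3. $\tilde\alpha^\mu:\eta^\varepsilon_\mu\to\eta^{\varepsilon'}$ for each $\alpha:\varepsilon\to\varepsilon'$ with $\varepsilon\in\mathcal E''$, $\varepsilon'\in\mathcal E'$; 4. $\tilde\alpha^\mu:\eta^\varepsilon_\mu\to\eta^{\varepsilon'}_{\mu-b(\alpha)}$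 for each $\alpha:\varepsilon\to\varepsilon'$ with $\varepsilon,\varepsilon'\in\mathcal E''$. Each arrow $\beta$ of $Q$ is $g^r*\alpha$ for exactly one of these arrows $\alpha$; put $\tilde\beta=\tilde\alpha$ or $\tilde\beta^\mu=\tilde\alpha^\mu$ accordingly. Choose one cycle $\hat c=\alpha_1\cdots\alpha_l$ in each $*$-orbit of cycles appearing in $W$, written so that $\alpha_1$ ends in $\mathcal E'$ in type (i); $\alpha_1$ starts in the fixed vertex and ends in $\mathcal E'$ in type (ii); $\alpha_1$ starts in the non-fixed vertex, and this vertex lies in $\mathcal E'$, in type (iii). Let $|G\hat c|$ be the cardinality of the $*$-orbit of $\hat c$. In type (ii), let $p(\hat c)\in\mathbb Z/n$ be such that $g^{-p(\hat c)}*\alpha_2$ starts in $\mathcal E'$. In types (iii) and (iv) put $b_i=b(\alpha_i)+\dots+b(\alpha_l)$, for $i\ge 3$ and for all $i$ respectively. Define $$W_G=\sum_{\hat c}a(\hat c)\,w(\hat c),$$ where - (i) $w(\hat c)=\frac{|G\hat c|}{n}\,\tilde\alpha_1\cdots\tilde\alpha_l$; - (ii) $w(\hat c)=\sum_{\mu}\zeta^{-p(\hat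 c)\mu}\,\tilde\alpha_1^\mu\tilde\alpha_2^\mu\tilde\alpha_3\cdots\tilde\alpha_l$; - (iii) $w(\hat c)=\sum_\mu\tilde\alpha_1^\mu\tilde\alpha_2^{\mu-b_3}\tilde\alpha_3^{\mu-b_4}\cdots\tilde\alpha_{l-1}^{\mu-b_l}\tilde\alpha_l^\mu$; - (iv) $w(\hat c)=\frac1n\sum_\mu\tilde\alpha_1^{\mu-b_2}\tilde\alpha_2^{\mu-b_3}\cdots\tilde\alpha_{l-1}^{\mu-b_l}\tilde\alpha_l^{\mu}$. Suppose that $\Lambda$ is self-injective and that $G=\langle\varphi\rangle$ for a Nakayama automorphism $\varphi$ of $\Lambda$; that is, some generator of $G$ induces on $\Lambda$ an automorphism $\varphi$ such that $(a,b)=(b,\varphi(a))$ for some nondegenerate bilinear form on $\Lambda$ with $(a,bc)=(ab,c)$. Then $\mathcal P(Q_G,W_G)$ is a symmetric algebra: it is finite-dimensional and has a nondegenerate symmetric bilinear form with $(a,bc)=(ab,c)$. -/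

import Mathlib

open scoped Classical

noncomputable section

/-! ### Quivers, paths, and the (completed) path algebra -/

/-- A quiver with vertex set `V`, arrow set `A`, and source and target maps. -/
structure ArrowQuiver (V A : Type*) where
  src : A → V
  tgt : A → V

namespace ArrowQuiver

variable {V A : Type*}

/-- The vertices of `Q`, carrying the arrows of `Q` as a Mathlib quiver structure. -/
def Vert (_ : ArrowQuiver V A) : Type _ := V

instance (Q : ArrowQuiver V A) : Quiver Q.Vert where
  Hom u v := {a : A // Q.src a = u ∧ Q.tgt a = v}

/-- The word of arrows of a path `α₁ α₂ ⋯ αₗ`, composed from right to left: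
the arrow travelled last is written first. -/
def word (Q : ArrowQuiver V A) {u : Q.Vert} : ∀ {v : Q.Vert}, Quiver.Path u v → List A
  | _, .nil => []
  | _, .cons p e => e.1 :: Q.word p

/-- A cyclic word of arrows `α₁ ⋯ αₗ` with `s(αᵢ) = t(αᵢ₊₁)` for all `i` modulo `l`. -/
def IsCycle (Q : ArrowQuiver V A) (c : Cycle A) : Prop :=
  c ≠ Cycle.nil ∧ c.Chain fun a b => Q.src a = Q.tgt b

end ArrowQuiver

/-- The completed path algebra of a quiver (with finitely many vertices and arrows): formal,
possibly infinite, linear combinations of paths, i.e. functions from paths to `k`. -/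
def CompletedPathAlgebra (k : Type*) {V A : Type*} (Q : ArrowQuiver V A) : Type _ :=
  ∀ u v : Q.Vert, Quiver.Path u v → k

namespace CompletedPathAlgebra

variable {k V A : Type*} [Field k] {Q : ArrowQuiver V A}

instance : AddCommGroup (CompletedPathAlgebra k Q) :=
  inferInstanceAs (AddCommGroup (∀ u v : Q.Vert, Quiver.Path u v → k))

instance : Module k (CompletedPathAlgebra k Q) :=
  inferInstanceAs (Module k (∀ u v : Q.Vert, Quiver.Path u v → k))

/-- `conv F G r` is the sum of `F p * G q` over all factorisations of the path `r` as
`r = p q` (first travel `q`, then `p`). -/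
def conv {u : Q.Vert} : ∀ {w : Q.Vert}, (∀ v, Quiver.Path v w → k) →
    (∀ v, Quiver.Path u v → k) → Quiver.Path u w → k
  | _, F, G, .nil => F u .nil * G u .nil
  | w, F, G, .cons r e => conv (fun v p => F v (p.cons e)) G r + F w .nil * G w (r.cons e)

instance : Mul (CompletedPathAlgebra k Q) where
  mul f g := fun u w r => conv (fun v p => f v w p) (fun v q => g u v q) r

instance : One (CompletedPathAlgebra k Q) where
  one := fun _ _ r => if r.length = 0 then 1 else 0

theorem mul_apply (f g : CompletedPathAlgebra k Q) (u w : Q.Vert) (r : Quiver.Path u w) :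
    (f * g) u w r = conv (fun v p => f v w p) (fun v q => g u v q) r := rfl

theorem one_apply (u w : Q.Vert) (r : Quiver.Path u w) :
    (1 : CompletedPathAlgebra k Q) u w r = if r.length = 0 then 1 else 0 := rfl

theorem conv_add_left {u w : Q.Vert} (F F' : ∀ v, Quiver.Path v w → k)
    (G : ∀ v, Quiver.Path u v → k) (r : Quiver.Path u w) :
    conv (fun v p => F v p + F' v p) G r = conv F G r + conv F' G r := by
  induction r with
  | nil => simp [conv, add_mul]
  | cons r e ih =>
    have := ih (fun v p => F v (p.cons e)) (fun v p => F' v (p.cons e))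
    simp only [conv, this]; ring

theorem conv_add_right {u w : Q.Vert} (F : ∀ v, Quiver.Path v w → k)
    (G G' : ∀ v, Quiver.Path u v → k) (r : Quiver.Path u w) :
    conv F (fun v p => G v p + G' v p) r = conv F G r + conv F G' r := by
  induction r with
  | nil => simp [conv, mul_add]
  | cons r e ih =>
    have := ih (fun v p => F v (p.cons e))
    simp only [conv, this]; ring

theorem conv_smul_left (a : k) {u w : Q.Vert} (F : ∀ v, Quiver.Path v w → k)
    (G : ∀ v, Quiver.Path u v → k) (r : Quiver.Path u w) :
    conv (fun v p => a * F v p) G r = a * conv F G r := by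
  induction r with
  | nil => simp [conv, mul_assoc]
  | cons r e ih =>
    have := ih (fun v p => F v (p.cons e))
    simp only [conv, this]; ring

theorem conv_smul_right (a : k) {u w : Q.Vert} (F : ∀ v, Quiver.Path v w → k)
    (G : ∀ v, Quiver.Path u v → k) (r : Quiver.Path u w) :
    conv F (fun v p => a * G v p) r = a * conv F G r := by
  induction r with
  | nil => simp only [conv]; ring
  | cons r e ih =>
    have := ih (fun v p => F v (p.cons e))
    simp only [conv, this]; ring

theorem conv_one_left {u w : Q.Vert} (G : ∀ v, Quiver.Path u v → k) (r : Quiver.Path u w) :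
    conv (fun _ p => if p.length = 0 then 1 else 0) G r = G w r := by
  cases r with
  | nil => simp [conv]
  | cons r e =>
    have h := conv_smul_left (0 : k) (fun _ _ => (0 : k)) G r
    simp only [zero_mul] at h
    simp [conv, h]

theorem conv_one_right {u w : Q.Vert} (F : ∀ v, Quiver.Path v w → k) (r : Quiver.Path u w) :
    conv F (fun _ p => if p.length = 0 then 1 else 0) r = F u r := by
  induction r with
  | nil => simp [conv]
  | cons r e ih =>
    have := ih (fun v p => F v (p.cons e))
    simp [conv, this]

theorem conv_assoc {u w : Q.Vert} (F : ∀ v, Quiver.Path v w → k)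
    (G : ∀ v v', Quiver.Path v v' → k) (H : ∀ v, Quiver.Path u v → k) (r : Quiver.Path u w) :
    conv (fun v p => conv F (fun v' q => G v v' q) p) H r =
      conv F (fun v p => conv (fun v' q => G v' v q) H p) r := by
  induction r with
  | nil => simp [conv, mul_assoc]
  | cons r e ih =>
    have h := ih (fun v p => F v (p.cons e))
    simp only [conv]
    rw [conv_add_left, h, conv_smul_left]
    ring

instance : Ring (CompletedPathAlgebra k Q) where
  __ := (inferInstance : AddCommGroup (CompletedPathAlgebra k Q))
  mul_assoc f g h := by
    funext u w r
    exact conv_assoc (fun v p => f v w p) g (fun v q => h u v q) r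
  one_mul f := by
    funext u w r
    exact conv_one_left (fun v q => f u v q) r
  mul_one f := by
    funext u w r
    exact conv_one_right (fun v p => f v w p) r
  left_distrib f g h := by
    funext u w r
    exact conv_add_right (fun v p => f v w p) (fun v q => g u v q) (fun v q => h u v q) r
  right_distrib f g h := by
    funext u w r
    exact conv_add_left (fun v p => f v w p) (fun v p => g v w p) (fun v q => h u v q) r
  zero_mul f := by
    funext u w r
    have h := conv_smul_left (0 : k) (fun _ _ => (0 : k)) (fun v q => f u v q) r
    simp only [zero_mul] at h
    exact h
  mul_zero f := by
    funext u w r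
    have h := conv_smul_right (0 : k) (fun v p => f v w p) (fun _ _ => (0 : k)) r
    simp only [zero_mul] at h
    exact h

instance : Algebra k (CompletedPathAlgebra k Q) :=
  Algebra.ofModule
    (fun a f g => by
      funext u w r
      exact conv_smul_left a (fun v p => f v w p) (fun v q => g u v q) r)
    (fun a f g => by
      funext u w r
      exact conv_smul_right a (fun v p => f v w p) (fun v q => g u v q) r)

/-- The trivial path at the vertex `v`. -/
def vert (k : Type*) [Field k] (Q : ArrowQuiver V A) (v : V) : CompletedPathAlgebra k Q :=
  fun u _ r => if r.length = 0 ∧ u = v then 1 else 0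

/-- The arrow `a`, as a path of length one. -/
def arrow (k : Type*) [Field k] (Q : ArrowQuiver V A) (a : A) : CompletedPathAlgebra k Q :=
  fun _ _ r => if Q.word r = [a] then 1 else 0

theorem conv_zero_left {u w : Q.Vert} (G : ∀ v, Quiver.Path u v → k) (r : Quiver.Path u w) :
    conv (fun _ _ => 0) G r = 0 := by
  have h := conv_smul_left (0 : k) (fun _ _ => (0 : k)) G r
  simpa only [zero_mul] using h

theorem vert_mul (v : V) (f : CompletedPathAlgebra k Q) (u w : Q.Vert) (r : Quiver.Path u w) :
    (vert k Q v * f) u w r = if w = v then f u w r else 0 := by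
  rw [mul_apply]
  cases r with
  | nil => simp [conv, vert]
  | cons r e => simp [conv, vert, conv_zero_left]

theorem mul_vert (v : V) (f : CompletedPathAlgebra k Q) (u w : Q.Vert) (r : Quiver.Path u w) :
    (f * vert k Q v) u w r = if u = v then f u w r else 0 := by
  rw [mul_apply]
  have h := conv_smul_right (if u = v then (1 : k) else 0) (fun v p => f v w p)
    (fun _ p => if p.length = 0 then 1 else 0) r
  rw [conv_one_right] at h
  have hG : (fun v' q => vert k Q v u v' q) =
      fun _ q => (if u = v then (1 : k) else 0) * if q.length = 0 then 1 else 0 := by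
    funext v' q
    by_cases hu : u = v <;> by_cases hq : q.length = 0 <;> simp only [vert, hu, hq] <;> simp
  rw [hG, h]
  split_ifs <;> simp

theorem vert_mul_arrow (v : V) (a : A) :
    vert k Q v * arrow k Q a = if Q.tgt a = v then arrow k Q a else 0 := by
  funext u w r
  rw [vert_mul]
  have key : Q.word r = [a] → w = Q.tgt a := by
    cases r with
    | nil => simp [ArrowQuiver.word]
    | cons r e =>
      intro h
      simp only [ArrowQuiver.word, List.cons.injEq] at h
      rw [← h.1]; exact e.2.2.symm
  by_cases hr : Q.word r = [a]
  · have := key hr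
    subst this
    split_ifs <;> simp_all
    rfl
  · have h0 : arrow k Q a u w r = 0 := by simp [arrow, hr]
    split_ifs <;> first | exact h0 | exact h0.symm | rfl

theorem arrow_mul_vert (v : V) (a : A) :
    arrow k Q a * vert k Q v = if Q.src a = v then arrow k Q a else 0 := by
  funext u w r
  rw [mul_vert]
  have key : Q.word r = [a] → u = Q.src a := by
    cases r with
    | nil => simp [ArrowQuiver.word]
    | cons r e =>
      intro h
      simp only [ArrowQuiver.word, List.cons.injEq] at h
      cases r with
      | nil => rw [← h.1]; exact e.2.1.symm
      | cons r e' => simp [ArrowQuiver.word] at h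
  by_cases hr : Q.word r = [a]
  · have := key hr
    subst this
    split_ifs <;> simp_all
    rfl
  · have h0 : arrow k Q a u w r = 0 := by simp [arrow, hr]
    split_ifs <;> first | exact h0 | exact h0.symm | rfl

theorem arrow_ne_zero (a : A) : arrow k Q a ≠ 0 := by
  intro h
  let e : (show Q.Vert from Q.src a) ⟶ (show Q.Vert from Q.tgt a) := ⟨a, rfl, rfl⟩
  have h1 := congrFun (congrFun (congrFun h (Q.src a)) (Q.tgt a)) (Quiver.Path.nil.cons e)
  have h2 : arrow k Q a (Q.src a) (Q.tgt a) (Quiver.Path.nil.cons e) = 1 := by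
    simp [arrow, ArrowQuiver.word, e]
  rw [h2] at h1
  exact one_ne_zero h1

end CompletedPathAlgebra

open CompletedPathAlgebra

/-- The path algebra `kQ`: the subalgebra of the completed path algebra generated by the trivial
paths and the arrows, i.e. the finite linear combinations of paths. -/
def pathAlgebra (k : Type*) [Field k] {V A : Type*} (Q : ArrowQuiver V A) :
    Subalgebra k (CompletedPathAlgebra k Q) :=
  Algebra.adjoin k (Set.range (vert k Q) ∪ Set.range (arrow k Q))

/-- The trivial path at `v`, as an element of `kQ`. -/
def pathVert (k : Type*) [Field k] {V A : Type*} (Q : ArrowQuiver V A) (v : V) :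
    pathAlgebra k Q :=
  ⟨vert k Q v, Algebra.subset_adjoin (Or.inl ⟨v, rfl⟩)⟩

/-- The arrow `a`, as an element of `kQ`. -/
def pathArrow (k : Type*) [Field k] {V A : Type*} (Q : ArrowQuiver V A) (a : A) :
    pathAlgebra k Q :=
  ⟨arrow k Q a, Algebra.subset_adjoin (Or.inr ⟨a, rfl⟩)⟩

/-! ### Potentials and Jacobian algebras -/

section Jacobian

variable {k V A R : Type*} [Field k] [Ring R] [Algebra k R]

/-- A finite potential `W = ∑ a(c) c` on `Q`, given by its coefficients `a(c)`: a finite linear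
combination of cycles of length at least `3`, considered up to cyclic permutation. -/
def IsPotential (Q : ArrowQuiver V A) (W : Cycle A →₀ k) : Prop :=
  ∀ c ∈ W.support, Q.IsCycle c ∧ 3 ≤ c.length

/-- The cyclic derivative `∂_a W`, computed in an algebra `R` in which the arrows are represented
by `x : A → R`. A cycle `α₁ ⋯ αₗ` contributes the sum, over all `m` with `αₘ = a`, of
`αₘ₊₁ ⋯ αₗ α₁ ⋯ αₘ₋₁`; the multiset `c.lists` consists of the `l` rotations of the cycle `c`. -/
def cyclicDerivative (x : A → R) (a : A) (W : Cycle A →₀ k) : R :=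
  W.sum fun c r =>
    r • (c.lists.map fun l => if l.head? = some a then (l.tail.map x).prod else 0).sum

/-- The two-sided ideal generated by the cyclic derivatives of `W`. -/
def derivativeIdeal (x : A → R) (W : Cycle A →₀ k) : TwoSidedIdeal R :=
  TwoSidedIdeal.span (Set.range fun a => cyclicDerivative x a W)

/-- The `m`-th power of the arrow ideal: the two-sided ideal generated by all products of `m`
arrows. -/
def arrowIdealPow (x : A → R) (m : ℕ) : TwoSidedIdeal R :=
  TwoSidedIdeal.span {f | ∃ l : List A, l.length = m ∧ f = (l.map x).prod}

/-- The closure of a two-sided ideal in the topology given by the powers of the arrow ideal. -/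
def adicClosure (x : A → R) (I : TwoSidedIdeal R) : TwoSidedIdeal R :=
  ⨅ m : ℕ, I ⊔ arrowIdealPow x m

/-- An admissible ideal `I`, i.e. `⟨Q₁⟩^N ⊆ I ⊆ ⟨Q₁⟩²` for some `N ≥ 2`. -/
def IsAdmissible (x : A → R) (I : TwoSidedIdeal R) : Prop :=
  ∃ N : ℕ, 2 ≤ N ∧ arrowIdealPow x N ≤ I ∧ I ≤ arrowIdealPow x 2

/-- The Jacobian algebra `P(Q, W)`: the completed path algebra modulo the closure of the
two-sided ideal generated by the cyclic derivatives of `W`. -/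
abbrev JacobianAlgebra (Q : ArrowQuiver V A) (W : Cycle A →₀ k) : Type _ :=
  (adicClosure (arrow k Q) (derivativeIdeal (arrow k Q) W)).ringCon.Quotient

/-- The canonical map `kQ → P(Q, W)`. -/
def toJacobian (Q : ArrowQuiver V A) (W : Cycle A →₀ k) (f : pathAlgebra k Q) :
    JacobianAlgebra Q W :=
  (adicClosure (arrow k Q) (derivativeIdeal (arrow k Q) W)).ringCon.mk' (f : CompletedPathAlgebra k Q)

end Jacobian

/-! ### Self-injective and symmetric algebras, Nakayama automorphisms -/

section Frobenius

variable (k Λ : Type*) [Field k] [Ring Λ] [Algebra k Λ]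

/-- `Λ` is injective as a right module over itself. -/
def IsSelfInjective (Λ : Type*) [Ring Λ] : Prop := Module.Injective Λᵐᵒᵖ Λ

variable {k Λ}

/-- A Frobenius form: a nondegenerate bilinear form with `(a, bc) = (ab, c)`. -/
def IsFrobeniusForm (B : Λ →ₗ[k] Λ →ₗ[k] k) : Prop :=
  B.Nondegenerate ∧ ∀ a b c, B a (b * c) = B (a * b) c

/-- `φ` is a Nakayama automorphism of `Λ`: `(a, b) = (b, φ(a))` for some Frobenius form. -/
def IsNakayamaAutomorphism (φ : Λ ≃ₐ[k] Λ) : Prop :=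
  ∃ B : Λ →ₗ[k] Λ →ₗ[k] k, IsFrobeniusForm B ∧ ∀ a b, B a b = B b (φ a)

variable (k Λ)

/-- A (finite-dimensional) symmetric algebra. -/
def IsSymmAlgebra : Prop :=
  Module.Finite k Λ ∧ ∃ B : Λ →ₗ[k] Λ →ₗ[k] k, IsFrobeniusForm B ∧ ∀ a b, B a b = B b a

end Frobenius

/-! ### Quivers with potential with a cyclic group action -/

/-- A quiver with finite potential `(Q, W)` whose cyclic derivatives generate an admissible ideal
of `kQ`, with an action on `kQ` of a cyclic group `G` of order `n` with generator `g`,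
satisfying the standing assumptions below. -/
structure CyclicQP (k V A : Type*) [Field k] where
  Q : ArrowQuiver V A
  W : Cycle A →₀ k
  isPotential : IsPotential Q W
  admissible : IsAdmissible (pathArrow k Q) (derivativeIdeal (pathArrow k Q) W)
  /-- the order of `G` -/
  n : ℕ
  n_pos : 0 < n
  /-- the generator of `G` -/
  g : pathAlgebra k Q ≃ₐ[k] pathAlgebra k Q
  orderOf_g : orderOf g = n
  /-- a primitive `n`-th root of unity in `k` -/
  ζ : k
  isPrimitiveRoot : IsPrimitiveRoot ζ n
  /-- `g` permutes the vertices by `σ` and maps each arrow `a` to the multiple `coef a` of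
  the arrow `τ a`. Thus `σ` and `τ` describe the forgetful action `*` of `g` on `Q`. -/
  σ : Equiv.Perm V
  τ : Equiv.Perm A
  coef : A → k
  g_vert : ∀ v, g (pathVert k Q v) = pathVert k Q (σ v)
  g_arrow : ∀ a, g (pathArrow k Q a) = coef a • pathArrow k Q (τ a)
  /-- every vertex which is not fixed by `G` has an orbit of cardinality `n` -/
  orbit_card : ∀ v, σ v ≠ v → {w | σ.SameCycle v w}.ncard = n
  /-- `g(W) = W`, where `g` maps the cycle `α₁ ⋯ αₗ` to the cycle
  `τ(α₁) ⋯ τ(αₗ)` times the product of the `coef αᵢ`. -/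
  g_potential :
    (W.sum fun c r => Finsupp.single (c.map τ) (r * (c.toMultiset.map coef).prod)) = W
  /-- an arrow `a` between two fixed vertices satisfies `g(a) = ζ^b a` for some `b` -/
  fixed_arrow : ∀ a, σ (Q.src a) = Q.src a → σ (Q.tgt a) = Q.tgt a →
    τ a = a ∧ ∃ b : ZMod n, coef a = ζ ^ b.val
  /-- arrows with at least one end which is not fixed are sent to arrows -/
  nonfixed_arrow : ∀ a, (σ (Q.src a) ≠ Q.src a ∨ σ (Q.tgt a) ≠ Q.tgt a) → coef a = 1
  /-- the number of fixed vertices on a cycle of `W`, counted with multiplicity, is `0`, `1`, the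
  length minus `1`, or the length: these are the cycles of type (i), (ii), (iii), (iv) -/
  cycle_type : ∀ c ∈ W.support,
    c.toMultiset.countP (fun a => σ (Q.tgt a) = Q.tgt a) = 0 ∨
    c.toMultiset.countP (fun a => σ (Q.tgt a) = Q.tgt a) = 1 ∨
    c.toMultiset.countP (fun a => σ (Q.tgt a) = Q.tgt a) + 1 = c.length ∨
    c.toMultiset.countP (fun a => σ (Q.tgt a) = Q.tgt a) = c.length

namespace CyclicQP

variable {k V A : Type*} [Field k] (S : CyclicQP k V A)

theorem coef_ne_zero (a : A) : S.coef a ≠ 0 := by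
  intro h
  have h1 := S.g_arrow a
  rw [h, zero_smul] at h1
  have h2 : pathArrow k S.Q a = 0 := by simpa using h1
  exact arrow_ne_zero a (congrArg Subtype.val h2)

theorem tgt_τ (a : A) : S.Q.tgt (S.τ a) = S.σ (S.Q.tgt a) := by
  have h0 : pathVert k S.Q (S.Q.tgt a) * pathArrow k S.Q a = pathArrow k S.Q a :=
    Subtype.ext ((vert_mul_arrow (k := k) (Q := S.Q) (S.Q.tgt a) a).trans (if_pos rfl))
  have h1 := congrArg S.g h0
  rw [map_mul, S.g_vert, S.g_arrow, mul_smul_comm] at h1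
  have h2 := congrArg Subtype.val (smul_right_injective _ (S.coef_ne_zero a) h1)
  have h3 : vert k S.Q (S.σ (S.Q.tgt a)) * arrow k S.Q (S.τ a) = arrow k S.Q (S.τ a) := h2
  rw [vert_mul_arrow] at h3
  by_contra hne
  rw [if_neg hne] at h3
  exact arrow_ne_zero _ h3.symm

theorem src_τ (a : A) : S.Q.src (S.τ a) = S.σ (S.Q.src a) := by
  have h0 : pathArrow k S.Q a * pathVert k S.Q (S.Q.src a) = pathArrow k S.Q a :=
    Subtype.ext ((arrow_mul_vert (k := k) (Q := S.Q) (S.Q.src a) a).trans (if_pos rfl))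
  have h1 := congrArg S.g h0
  rw [map_mul, S.g_vert, S.g_arrow, smul_mul_assoc] at h1
  have h2 := congrArg Subtype.val (smul_right_injective _ (S.coef_ne_zero a) h1)
  have h3 : arrow k S.Q (S.τ a) * vert k S.Q (S.σ (S.Q.src a)) = arrow k S.Q (S.τ a) := h2
  rw [arrow_mul_vert] at h3
  by_contra hne
  rw [if_neg hne] at h3
  exact arrow_ne_zero _ h3.symm

theorem tgt_τ_zpow (r : ℤ) (a : A) : S.Q.tgt ((S.τ ^ r) a) = (S.σ ^ r) (S.Q.tgt a) := by
  have hinv : ∀ a, S.Q.tgt (S.τ⁻¹ a) = S.σ⁻¹ (S.Q.tgt a) := fun a => by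
    rw [Equiv.Perm.eq_inv_iff_eq, ← S.tgt_τ]; simp
  induction r generalizing a with
  | zero => simp
  | succ i ih => rw [zpow_add_one, zpow_add_one, Equiv.Perm.mul_apply, ih, S.tgt_τ]; rfl
  | pred i ih => rw [zpow_sub_one, zpow_sub_one, Equiv.Perm.mul_apply, ih, hinv]; rfl

theorem src_τ_zpow (r : ℤ) (a : A) : S.Q.src ((S.τ ^ r) a) = (S.σ ^ r) (S.Q.src a) := by
  have hinv : ∀ a, S.Q.src (S.τ⁻¹ a) = S.σ⁻¹ (S.Q.src a) := fun a => by
    rw [Equiv.Perm.eq_inv_iff_eq, ← S.src_τ]; simp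
  induction r generalizing a with
  | zero => simp
  | succ i ih => rw [zpow_add_one, zpow_add_one, Equiv.Perm.mul_apply, ih, S.src_τ]; rfl
  | pred i ih => rw [zpow_sub_one, zpow_sub_one, Equiv.Perm.mul_apply, ih, hinv]; rfl

instance : NeZero S.n := ⟨S.n_pos.ne'⟩

/-- The vertex `v` is fixed by `G`. -/
def Fixed (v : V) : Prop := S.σ v = v

/-- The integer `b(α)`, modulo `n`, with `g(α) = ζ^{b(α)} α` for an arrow `α` between fixed
vertices; by convention `b(α) = 0` for all other arrows. -/
def b (a : A) : ZMod S.n :=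
  if h : S.Fixed (S.Q.src a) ∧ S.Fixed (S.Q.tgt a) then
    (S.fixed_arrow a h.1 h.2).2.choose else 0

/-- A set `𝓔` of representatives of the vertices under the action of `G`. -/
structure Representatives where
  carrier : Set V
  existsUnique : ∀ v, ∃! w, w ∈ carrier ∧ S.σ.SameCycle v w

variable {S}

namespace Representatives

variable (E : S.Representatives)

/-- The arrows `α : v → w` of one of the following types:
(1) `v`, `w` are not fixed and `w ∈ 𝓔`; (2) `v ∈ 𝓔` is not fixed and `w` is fixed;
(3) `v` is fixed and `w ∈ 𝓔` is not fixed; (4) `v`, `w` are fixed. Note that all fixed vertices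
belong to `𝓔`. -/
def IsTyped (a : A) : Prop :=
  S.Q.tgt a ∈ E.carrier ∧ (S.Fixed (S.Q.tgt a) → S.Q.src a ∈ E.carrier)

/-- The arrows of type (1): those of the above arrows with no fixed end. -/
def IsTypeOne (a : A) : Prop :=
  E.IsTyped a ∧ ¬ S.Fixed (S.Q.src a) ∧ ¬ S.Fixed (S.Q.tgt a)

/-- The vertices of `Q_G`: `η^ε` for `ε ∈ 𝓔` not fixed, and `η^ε_μ` for `ε ∈ 𝓔` fixed and
`μ ∈ ℤ/n`. -/
abbrev VertG : Type _ :=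
  {v : V // v ∈ E.carrier ∧ ¬ S.Fixed v} ⊕ {v : V // v ∈ E.carrier ∧ S.Fixed v} × ZMod S.n

/-- The arrows of `Q_G`: `α̃` for `α` of type (1), and `α̃^μ` for `α` of type (2), (3), (4) and
`μ ∈ ℤ/n`. -/
abbrev ArrowG : Type _ :=
  {a : A // E.IsTypeOne a} ⊕ {a : A // E.IsTyped a ∧ ¬ E.IsTypeOne a} × ZMod S.n

/-- The representative in `𝓔` of the vertex `v`. -/
def vertRep (v : V) : V := (E.existsUnique v).choose

theorem vertRep_mem (v : V) : E.vertRep v ∈ E.carrier := (E.existsUnique v).choose_spec.1.1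

/-- The vertex of `Q_G` given by the representative of `v`: `η^ε`, or `η^ε_μ`, according to
whether `v` is not fixed or fixed. -/
def vertG (v : V) (μ : ZMod S.n) : E.VertG :=
  if h : S.Fixed (E.vertRep v) then Sum.inr (⟨E.vertRep v, E.vertRep_mem v, h⟩, μ)
  else Sum.inl ⟨E.vertRep v, E.vertRep_mem v, h⟩

/-- The quiver `Q_G`. Here `α̃ : η^ε → η^{ε'}` for `α : g^t(ε) → ε'` of type (1), and for
`α : ε → ε'` the arrow `α̃^μ` is of the form `η^ε → η^{ε'}_μ` if `α` is of type (2),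
`η^ε_μ → η^{ε'}` if `α` is of type (3), and `η^ε_μ → η^{ε'}_{μ - b(α)}` if `α` is of
type (4). -/
def quiverG : ArrowQuiver E.VertG E.ArrowG where
  src := Sum.elim (fun a => E.vertG (S.Q.src a) 0) fun p => E.vertG (S.Q.src p.1) p.2
  tgt := Sum.elim (fun a => E.vertG (S.Q.tgt a) 0) fun p =>
    E.vertG (S.Q.tgt p.1) (p.2 - S.b p.1)

/-- Every arrow is of the form `g^r * α` with `α` of type (1), (2), (3) or (4). -/
theorem exists_isTyped (a : A) : ∃ r : ℤ, E.IsTyped ((S.τ ^ (-r)) a) := by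
  have hmem : ∀ v, S.Fixed v → v ∈ E.carrier := fun v hv => by
    obtain ⟨w, ⟨hw, i, hi⟩, -⟩ := E.existsUnique v
    rw [Equiv.Perm.zpow_apply_eq_self_of_apply_eq_self hv] at hi
    rwa [hi]
  have hfix : ∀ (r : ℤ) v, S.Fixed v → (S.σ ^ r) v = v := fun r v hv =>
    Equiv.Perm.zpow_apply_eq_self_of_apply_eq_self hv r
  by_cases ht : S.Fixed (S.Q.tgt a)
  · obtain ⟨w, ⟨hw, i, hi⟩, -⟩ := E.existsUnique (S.Q.src a)
    refine ⟨-i, ?_, fun _ => ?_⟩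
    · rw [S.tgt_τ_zpow, hfix _ _ ht]; exact hmem _ ht
    · rw [S.src_τ_zpow, neg_neg, hi]; exact hw
  · obtain ⟨w, ⟨hw, i, hi⟩, -⟩ := E.existsUnique (S.Q.tgt a)
    have h : S.Q.tgt ((S.τ ^ (-(-i))) a) = w := by rw [S.tgt_τ_zpow, neg_neg, hi]
    refine ⟨-i, by rw [h]; exact hw, fun hf => absurd ?_ ht⟩
    rw [h] at hf
    have h2 : S.Q.tgt a = w := by
      rw [← hfix (-i) w hf, ← hi, ← Equiv.Perm.mul_apply, ← zpow_add]; simp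
    rwa [h2]

/-- An integer `r` such that the given arrow is `g^r * α` with `α` of type (1), (2), (3) or (4).
It is unique modulo `n` unless the arrow is of type (4). -/
def shift (a : A) : ℤ := (E.exists_isTyped a).choose

/-- The arrow of type (1), (2), (3) or (4) in the `G`-orbit of the given arrow. -/
def arrowRep (a : A) : A := (S.τ ^ (-E.shift a)) a

theorem arrowRep_isTyped (a : A) : E.IsTyped (E.arrowRep a) := (E.exists_isTyped a).choose_spec

/-- The arrow `α̃` or `α̃^μ` of `Q_G`, where `α` is the representative of the given arrow, of
type (1) or of type (2), (3), (4) respectively. -/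
def tilde (a : A) (μ : ZMod S.n) : E.ArrowG :=
  if h : E.IsTypeOne (E.arrowRep a) then Sum.inl ⟨E.arrowRep a, h⟩
  else Sum.inr (⟨E.arrowRep a, E.arrowRep_isTyped a, h⟩, μ)

/-- The word `α̃₁^{μ - b₂} α̃₂^{μ - b₃} ⋯ α̃ₗ^μ`, where `bᵢ = b(αᵢ) + ⋯ + b(αₗ)`; the upper index is
dropped at the arrows of type (1). -/
def liftWord (μ : ZMod S.n) : List A → List E.ArrowG
  | [] => []
  | a :: l => E.tilde a (μ - (l.map S.b).sum) :: liftWord μ l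

end Representatives

/-- The number of fixed vertices (with multiplicity) on a cyclic path `α₁ ⋯ αₗ`. -/
def fixedCount (S : CyclicQP k V A) (l : List A) : ℕ := l.countP fun a => S.Fixed (S.Q.tgt a)

/-- A choice of cycles `ĉ`, one in each `G`-orbit (for the action `*`) of the cycles appearing
in `W`, written as words `α₁ ⋯ αₗ` with the following normalisations: in type (i), `α₁` ends in
`𝓔`; in type (ii), `α₁` starts in the fixed vertex and ends in `𝓔`; in type (iii), `α₁` starts
in the non-fixed vertex, and this vertex is in `𝓔`. -/
structure CrossSection (E : S.Representatives) where
  words : Finset (List A)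
  mem_support : ∀ l ∈ words, (l : Cycle A) ∈ S.W.support
  existsUnique : ∀ c ∈ S.W.support,
    ∃! l, l ∈ words ∧ ∃ r : ℤ, c = (l : Cycle A).map (S.τ ^ r)
  type_one : ∀ l ∈ words, S.fixedCount l = 0 → ∀ a ∈ l.head?, S.Q.tgt a ∈ E.carrier
  type_two : ∀ l ∈ words, S.fixedCount l = 1 →
    ∀ a ∈ l.head?, S.Fixed (S.Q.src a) ∧ S.Q.tgt a ∈ E.carrier
  type_three : ∀ l ∈ words, S.fixedCount l + 1 = l.length →
    ∀ a ∈ l.head?, ¬ S.Fixed (S.Q.src a) ∧ S.Q.src a ∈ E.carrier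

/-- The number of cycles in the `G`-orbit of `c`, for the action `*`. -/
def orbitCard (S : CyclicQP k V A) (c : Cycle A) : ℕ :=
  {d | ∃ r : ℤ, d = c.map (S.τ ^ r)}.ncard

namespace Representatives

variable (E : S.Representatives)

/-- The exponent `p(c)` for a word `α₁ α₂ ⋯ αₗ` of type (ii): `α₂ = g^{p(c)} * α` with `α` of
type (2). -/
def p : List A → ZMod S.n
  | _ :: a :: _ => (E.shift a : ZMod S.n)
  | _ => 0

/-- The word `α̃₁^μ α̃₂^{μ - b₃} α̃₃^{μ - b₄} ⋯ α̃ₗ^μ`, for a word `α₁ ⋯ αₗ` of type (iii). -/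
def liftWordThree (μ : ZMod S.n) : List A → List E.ArrowG
  | [] => []
  | a :: l => E.tilde a μ :: E.liftWord μ l

/-- The sum of the cycles of `Q_G` obtained from the word `ĉ`, with their coefficients:
* type (i): `(|Gĉ| / n) c̃`;
* type (ii): `∑_μ ζ^{-p(c) μ} c̃^μ`;
* type (iii): `∑_μ c̃^μ`;
* type (iv): `(1 / n) ∑_μ c̃^μ`. -/
def cycleG (l : List A) : Cycle E.ArrowG →₀ k :=
  if S.fixedCount l = 0 then
    Finsupp.single (E.liftWord 0 l : Cycle E.ArrowG) ((S.orbitCard l : k) / (S.n : k))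
  else if S.fixedCount l = 1 then
    ∑ μ : ZMod S.n, Finsupp.single (E.liftWord μ l : Cycle E.ArrowG) (S.ζ ^ (-(E.p l * μ)).val)
  else if S.fixedCount l + 1 = l.length then
    ∑ μ : ZMod S.n, Finsupp.single (E.liftWordThree μ l : Cycle E.ArrowG) 1
  else
    ∑ μ : ZMod S.n, Finsupp.single (E.liftWord μ l : Cycle E.ArrowG) (1 / (S.n : k))

end Representatives

/-- The potential `W_G = ∑_ĉ a(ĉ) (⋯)` on `Q_G`. -/
def CrossSection.potentialG {E : S.Representatives} (C : CrossSection E) :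
    Cycle E.ArrowG →₀ k :=
  ∑ l ∈ C.words, S.W l • E.cycleG l

end CyclicQP

end

/-! Write `ΛG` for the skew group algebra of `G` over `Λ = P(Q, W)`. If the Nakayama automorphism
acts as an element `q` of `G`, then `ΛG` is symmetric: with `f = (1, ·)` the Frobenius linear form,
`T(∑ a_g g) = f(a_q)` is a nondegenerate trace, because `f(ab) = f(b · q a)` and `f` is
`G`-invariant (`coeffForm_mul_comm`, `eq_zero_of_coeffForm_mul`). Symmetry passes to corners, so it
remains to recognise `P(Q_G, W_G)` as the corner of `ΛG` at the idempotents `idemG`: the non-fixed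
vertices in `𝓔`, and the products of a fixed vertex with the character idempotents `e μ` of `kG`.

The comparison rests on linear substitutions. Elements `y` indexed by the arrows of `Q_G` give
matrices `E.mat y a` for the arrows `a` of `Q`, indexed by the pairs `(v, μ)` of `Idx`; each entry
is a multiple of a single `y β`, with scalars making the family `G`-equivariant (`scal_τ`,
`gauge_mat`). Conversely, the decomposition `1 = ∑ incl i * proj i` in `ΛG` turns the arrows of `Q`
into such matrices (`mat_arrG`). Orbit by orbit, `W_G` is `1/n` times the trace of `W` at these
matrices (`CrossSection.smul_cycleG`). The chain rule `cyclicDerivative_traceLift` then writes `n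
∂_β W_G` as a combination of entries of the matrices `∂_a W`. The entries carrying the letter `β`
form one `G`-orbit, on which the summands agree, and the size of the orbit is invertible in `k`. So
the relations of `W` and of `W_G` imply each other (`cyclicDerivative_mat_eq_zero`,
`cyclicDerivative_repG`).

This produces a homomorphism `Φ` from `P(Q_G, W_G)` to `ΛG`, and a homomorphism `skewHom` from `ΛG`
to matrices over `P(Q_G, W_G)`. By `skewHom_prod` the entries of `skewHom (Φ x)` are the Peirce
components of `x`, so `Φ` is injective, and `idemG_mul_mul_idemG_mem` shows that its image contains
the whole corner.

Admissibility enters through `exists_prod_eq_zero`: in every representation of `Q` satisfying the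
relations of `W`, long products of arrows vanish. This is transferred to `Q_G` through `ΛG`; it
makes power series of paths evaluable and gives finite dimension. The idempotents of a corner do not
add up to `1`, so representations and homomorphisms are non-unital throughout. -/

open CompletedPathAlgebra

/-! ### Representations of quivers and homogeneous parts of series of paths. -/

noncomputable section

/-- A representation of the quiver `Q` in a ring `R`: orthogonal idempotents `E v` and elements
`X a` with `E (t a) X a = X a = X a E (s a)`. The idempotents need not add up to `1`. -/
structure ArrowQuiver.Rep {V A : Type*} (Q : ArrowQuiver V A) (R : Type*) [Ring R] where
  E : V → R
  X : A → R
  E_mul : ∀ v w, E v * E w = if v = w then E v else 0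
  E_tgt : ∀ a, E (Q.tgt a) * X a = X a
  E_src : ∀ a, X a * E (Q.src a) = X a

namespace ArrowQuiver.Rep

variable {V A R : Type*} [Ring R] {Q : ArrowQuiver V A} (M : Q.Rep R)

theorem E_mul_X (v : V) (a : A) : M.E v * M.X a = if v = Q.tgt a then M.X a else 0 := by
  rw [← M.E_tgt a, ← mul_assoc, M.E_mul]
  split_ifs with h
  · rw [h]
  · rw [zero_mul]

theorem X_mul_E (v : V) (a : A) : M.X a * M.E v = if Q.src a = v then M.X a else 0 := by
  rw [← M.E_src a, mul_assoc, M.E_mul]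
  split_ifs with h
  · rfl
  · rw [mul_zero]

end ArrowQuiver.Rep

/-- The homomorphisms in use need not preserve `1`, so the empty product has to be excluded. The
lower bounds on lengths of words and cycles below come from here. -/
theorem List.map_prod_map_of_ne_nil {A R S F : Type*} [MonoidWithZero R] [MonoidWithZero S]
    [FunLike F R S] [MulHomClass F R S] (f : F) (x : A → R) {l : List A} (hl : l ≠ []) :
    f (l.map x).prod = (l.map fun a => f (x a)).prod := by
  induction l with
  | nil => exact absurd rfl hl
  | cons a l ih =>
    by_cases h : l = []
    · simp [h]
    · simp [ih h]

namespace CompletedPathAlgebra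

variable {k V A : Type*} [Field k] {Q : ArrowQuiver V A}

/-- The vertex `v`, as an object of the quiver of paths. -/
def _root_.ArrowQuiver.toVert (Q : ArrowQuiver V A) (v : V) : Q.Vert := v

/-- The arrow `a`, as a morphism of the quiver of paths. -/
def _root_.ArrowQuiver.toHom (Q : ArrowQuiver V A) (a : A) {v : Q.Vert}
    (h : Q.toVert (Q.src a) = v) : v ⟶ Q.toVert (Q.tgt a) :=
  ⟨a, h, rfl⟩

/-- The coefficient of the trivial path at `v`. -/
def coeffNil (v : V) : CompletedPathAlgebra k Q →ₗ[k] k where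
  toFun f := f (Q.toVert v) (Q.toVert v) Quiver.Path.nil
  map_add' _ _ := rfl
  map_smul' _ _ := rfl

theorem add_apply (f g : CompletedPathAlgebra k Q) (u v : Q.Vert) (r : Quiver.Path u v) :
    (f + g) u v r = f u v r + g u v r := rfl

theorem smul_apply (c : k) (f : CompletedPathAlgebra k Q) (u v : Q.Vert) (r : Quiver.Path u v) :
    (c • f) u v r = c * f u v r := rfl

/-- The part of `f` consisting of the paths whose last arrow is `a`, with that arrow removed. -/
def stripFun (a : A) (f : CompletedPathAlgebra k Q) : CompletedPathAlgebra k Q := fun u v r =>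
  if h : Q.toVert (Q.src a) = v then f u (Q.toVert (Q.tgt a)) (r.cons (Q.toHom a h)) else 0

theorem stripFun_of_eq {a : A} (f : CompletedPathAlgebra k Q) {u v : Q.Vert}
    (h : Q.toVert (Q.src a) = v) (r : Quiver.Path u v) :
    stripFun a f u v r = f u (Q.toVert (Q.tgt a)) (r.cons (Q.toHom a h)) := dif_pos h

theorem stripFun_of_ne {a : A} (f : CompletedPathAlgebra k Q) {u v : Q.Vert}
    (h : Q.toVert (Q.src a) ≠ v) (r : Quiver.Path u v) : stripFun a f u v r = 0 := dif_neg h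

/-- `stripFun` as a linear map. -/
def stripArrow (a : A) : CompletedPathAlgebra k Q →ₗ[k] CompletedPathAlgebra k Q where
  toFun := stripFun a
  map_add' f g := by
    funext u v r
    by_cases h : Q.toVert (Q.src a) = v
    · simp only [add_apply, stripFun_of_eq _ h]
    · simp only [add_apply, stripFun_of_ne _ h, add_zero]
  map_smul' c f := by
    funext u v r
    by_cases h : Q.toVert (Q.src a) = v
    · simp only [smul_apply, stripFun_of_eq _ h, RingHom.id_apply]
    · simp only [smul_apply, stripFun_of_ne _ h, RingHom.id_apply, mul_zero]

theorem stripArrow_apply_of_eq {a : A} (f : CompletedPathAlgebra k Q) {u v : Q.Vert}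
    (h : Q.toVert (Q.src a) = v) (r : Quiver.Path u v) :
    stripArrow a f u v r = f u (Q.toVert (Q.tgt a)) (r.cons (Q.toHom a h)) := dif_pos h

theorem stripArrow_apply_of_ne {a : A} (f : CompletedPathAlgebra k Q) {u v : Q.Vert}
    (h : Q.toVert (Q.src a) ≠ v) (r : Quiver.Path u v) : stripArrow a f u v r = 0 := dif_neg h

theorem coeffNil_mul (v : V) (f g : CompletedPathAlgebra k Q) :
    coeffNil v (f * g) = coeffNil v f * coeffNil v g := rfl

/-- The last arrow of a product of paths lies in the left factor, unless that factor is a trivial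
path, necessarily at the target of `a`. -/
theorem stripArrow_mul (a : A) (f g : CompletedPathAlgebra k Q) :
    stripArrow a (f * g) = stripArrow a f * g + coeffNil (Q.tgt a) f • stripArrow a g := by
  funext u v r
  change _ = (stripArrow a f * g) u v r + coeffNil (Q.tgt a) f * stripArrow a g u v r
  rw [mul_apply]
  by_cases h : Q.toVert (Q.src a) = v
  · rw [stripArrow_apply_of_eq _ h, stripArrow_apply_of_eq _ h, mul_apply]
    simp only [conv]
    congr 2
    funext v' p
    rw [stripArrow_apply_of_eq _ h]
  · rw [stripArrow_apply_of_ne _ h, stripArrow_apply_of_ne _ h]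
    have : (fun v' p => stripArrow a f v' v p) = fun _ _ => (0 : k) := by
      funext v' p
      rw [stripArrow_apply_of_ne _ h]
    rw [this, conv_zero_left, mul_zero, add_zero]

theorem coeffNil_vert (v w : V) :
    coeffNil v (vert k Q w) = if v = w then 1 else 0 := by
  by_cases h : v = w
  · rw [if_pos h]; exact if_pos ⟨rfl, h⟩
  · rw [if_neg h]; exact if_neg fun hh => h hh.2

theorem stripArrow_vert (a : A) (w : V) : stripArrow a (vert k Q w) = 0 := by
  funext u v r
  by_cases h : Q.toVert (Q.src a) = v
  · rw [stripArrow_apply_of_eq _ h]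
    exact if_neg fun hh => by simp at hh
  · exact stripArrow_apply_of_ne _ h r

theorem coeffNil_arrow (v : V) (a : A) : coeffNil v (arrow k Q a) = 0 :=
  if_neg (c := [] = [a]) (t := (1 : k)) (List.cons_ne_nil a []).symm

theorem stripArrow_arrow (a b : A) :
    stripArrow a (arrow k Q b) = if a = b then vert k Q (Q.src a) else 0 := by
  funext u v r
  by_cases h : Q.toVert (Q.src a) = v
  · rw [stripArrow_apply_of_eq _ h]
    subst h
    by_cases hab : a = b
    · subst hab
      rw [if_pos rfl]
      cases r with
      | nil => exact (if_pos rfl).trans (if_pos ⟨rfl, rfl⟩).symm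
      | cons r e =>
        exact (if_neg fun hh => by simp [ArrowQuiver.word] at hh).trans
          (if_neg fun hh => by simp at hh).symm
    · rw [if_neg hab]
      exact if_neg fun hh => hab (List.cons.inj hh).1
  · rw [stripArrow_apply_of_ne _ h]
    split_ifs with hab
    · refine (if_neg ?_).symm
      rintro ⟨hr, hu⟩
      cases r with
      | nil => exact h hu.symm
      | cons r e => simp at hr
    · rfl

/-- Every element is the sum of its constant part and of its parts ending with a given arrow. -/
theorem eq_sum_vert_add_sum_arrow [Fintype V] [Fintype A] (f : CompletedPathAlgebra k Q) :
    f = ∑ v, coeffNil v f • vert k Q v + ∑ a, arrow k Q a * stripArrow a f := by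
  -- A path is trivial or has a last arrow, so these coordinates determine an element.
  have ext' : ∀ x y : CompletedPathAlgebra k Q, (∀ v, coeffNil v x = coeffNil v y) →
      (∀ a, stripArrow a x = stripArrow a y) → x = y := by
    intro x y h1 h2
    funext u v r
    cases r with
    | nil => exact h1 u
    | cons r e =>
      obtain ⟨a, h, rfl⟩ := e
      have := congrFun (congrFun (congrFun (h2 a) u) _) r
      rwa [stripArrow_apply_of_eq _ h, stripArrow_apply_of_eq _ h] at this
  apply ext'
  · intro v
    simp [coeffNil_vert, coeffNil_mul, coeffNil_arrow]
  · intro a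
    simp only [map_add, map_sum, map_smul, stripArrow_vert, smul_zero, Finset.sum_const_zero,
      zero_add, stripArrow_mul, coeffNil_arrow, zero_smul, add_zero, stripArrow_arrow]
    rw [Finset.sum_eq_single a (fun b _ hb => by rw [if_neg hb.symm, zero_mul])
      (fun h => absurd (Finset.mem_univ a) h), if_pos rfl]
    funext u v r
    rw [vert_mul]
    split_ifs with h
    · rfl
    · exact stripArrow_apply_of_ne _ (fun hh => h hh.symm) r

end CompletedPathAlgebra

namespace ArrowQuiver.Rep

variable {k V A R : Type*} [Field k] [Ring R] [Algebra k R] [Fintype V] [Fintype A]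
  {Q : ArrowQuiver V A} (M : Q.Rep R)

variable (k) in
/-- The value of the homogeneous part of degree `d` of an element of the completed path algebra
in a representation. -/
def evalDeg : ℕ → CompletedPathAlgebra k Q →ₗ[k] R
  | 0 => ∑ v, (coeffNil v).smulRight (M.E v)
  | d + 1 => ∑ a, LinearMap.mulLeft k (M.X a) ∘ₗ evalDeg d ∘ₗ stripArrow a

theorem evalDeg_zero (f : CompletedPathAlgebra k Q) :
    M.evalDeg k 0 f = ∑ v, coeffNil v f • M.E v := by
  simp [evalDeg]

theorem evalDeg_succ (d : ℕ) (f : CompletedPathAlgebra k Q) :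
    M.evalDeg k (d + 1) f = ∑ a, M.X a * M.evalDeg k d (stripArrow a f) := by
  simp [evalDeg]

theorem evalDeg_zero_mul_X (f : CompletedPathAlgebra k Q) (a : A) :
    M.evalDeg k 0 f * M.X a = coeffNil (Q.tgt a) f • M.X a := by
  simp [evalDeg_zero, Finset.sum_mul, M.E_mul_X]

/-- Iteration of `stripArrow_mul`: its first term yields the splittings of the degree with positive
left part, its second term the splitting with left part zero. -/
theorem evalDeg_mul (d : ℕ) (f g : CompletedPathAlgebra k Q) :
    M.evalDeg k d (f * g) =
      ∑ p ∈ Finset.HasAntidiagonal.antidiagonal d, M.evalDeg k p.1 f * M.evalDeg k p.2 g := by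
  induction d generalizing f g with
  | zero =>
    simp [evalDeg_zero, coeffNil_mul, Finset.sum_mul, Finset.mul_sum, M.E_mul, mul_smul]
    exact Finset.sum_congr rfl fun v _ => smul_comm _ _ _
  | succ d ih =>
    rw [Finset.Nat.antidiagonal_succ, Finset.sum_cons, Finset.sum_map, evalDeg_succ]
    simp only [stripArrow_mul, map_add, map_smul, ih, mul_add, Finset.sum_add_distrib]
    rw [add_comm]
    congr 1
    · rw [evalDeg_succ, Finset.mul_sum]
      refine Finset.sum_congr rfl fun a _ => ?_
      rw [← mul_assoc, evalDeg_zero_mul_X, mul_smul_comm, smul_mul_assoc]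
    · simp only [Finset.mul_sum]
      rw [Finset.sum_comm]
      refine Finset.sum_congr rfl fun p _ => ?_
      simp [evalDeg_succ, Finset.sum_mul, mul_assoc]

theorem evalDeg_vert (v : V) (d : ℕ) :
    M.evalDeg k d (vert k Q v) = if d = 0 then M.E v else 0 := by
  cases d with
  | zero => simp [evalDeg_zero, coeffNil_vert]
  | succ d => simp [evalDeg_succ, stripArrow_vert]

theorem evalDeg_arrow (a : A) (d : ℕ) :
    M.evalDeg k d (arrow k Q a) = if d = 1 then M.X a else 0 := by
  cases d with
  | zero => simp [evalDeg_zero, coeffNil_arrow]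
  | succ d =>
    simp only [evalDeg_succ, stripArrow_arrow, apply_ite (M.evalDeg k d), map_zero, mul_ite,
      mul_zero, evalDeg_vert]
    cases d <;> simp [M.E_src]

end ArrowQuiver.Rep
end

/-! ### Evaluation of series of paths and homomorphisms out of the Jacobian algebra. -/

noncomputable section

namespace ArrowQuiver.Rep

variable {k V A R : Type*} [Field k] [Ring R] [Algebra k R] [Fintype V] [Fintype A]
  {Q : ArrowQuiver V A} (M : Q.Rep R)

/-- The homogeneous parts of `f` of large degree vanish in the representation `M`. -/
def Bounded (f : CompletedPathAlgebra k Q) : Prop :=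
  ∃ p : Polynomial R, ∀ d, p.coeff d = M.evalDeg k d f

/-- The value of `f` in the representation `M`, if its parts of large degree vanish. -/
def eval (f : CompletedPathAlgebra k Q) : R :=
  if h : M.Bounded f then h.choose.eval 1 else 0

variable {M}

/-- The homogeneous parts are stored as coefficients of a polynomial, which they determine; its
value at `1` is their sum. Products of series thus become products of polynomials. -/
theorem eval_eq {f : CompletedPathAlgebra k Q} (p : Polynomial R)
    (hp : ∀ d, p.coeff d = M.evalDeg k d f) : M.eval f = p.eval 1 := by
  have h : M.Bounded f := ⟨p, hp⟩
  rw [eval, dif_pos h]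
  congr 1
  ext d
  rw [h.choose_spec, hp]

theorem Bounded.of_le {f : CompletedPathAlgebra k Q} (D : ℕ)
    (hD : ∀ d, D ≤ d → M.evalDeg k d f = 0) : M.Bounded f := by
  refine ⟨∑ d ∈ Finset.range D, Polynomial.monomial d (M.evalDeg k d f), fun d => ?_⟩
  simp only [Polynomial.finsetSum_coeff, Polynomial.coeff_monomial]
  by_cases h : d < D
  · simp [h]
  · simp [h, hD d (not_lt.1 h)]

theorem Bounded.add {f g : CompletedPathAlgebra k Q} (hf : M.Bounded f) (hg : M.Bounded g) :
    M.Bounded (f + g) := by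
  obtain ⟨p, hp⟩ := hf
  obtain ⟨q, hq⟩ := hg
  exact ⟨p + q, fun d => by simp [hp, hq]⟩

theorem eval_add {f g : CompletedPathAlgebra k Q} (hf : M.Bounded f) (hg : M.Bounded g) :
    M.eval (f + g) = M.eval f + M.eval g := by
  obtain ⟨p, hp⟩ := hf
  obtain ⟨q, hq⟩ := hg
  rw [eval_eq p hp, eval_eq q hq, eval_eq (p + q) fun d => by simp [hp, hq],
    Polynomial.eval_add]

theorem Bounded.smul {f : CompletedPathAlgebra k Q} (c : k) (hf : M.Bounded f) :
    M.Bounded (c • f) := by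
  obtain ⟨p, hp⟩ := hf
  exact ⟨c • p, fun d => by simp [hp]⟩

theorem eval_smul {f : CompletedPathAlgebra k Q} (c : k) (hf : M.Bounded f) :
    M.eval (c • f) = c • M.eval f := by
  obtain ⟨p, hp⟩ := hf
  rw [eval_eq p hp, eval_eq (c • p) fun d => by simp [hp], Polynomial.eval_smul]

theorem Bounded.mul {f g : CompletedPathAlgebra k Q} (hf : M.Bounded f) (hg : M.Bounded g) :
    M.Bounded (f * g) := by
  obtain ⟨p, hp⟩ := hf
  obtain ⟨q, hq⟩ := hg
  exact ⟨p * q, fun d => by simp only [Polynomial.coeff_mul, hp, hq, evalDeg_mul]⟩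

theorem eval_mul {f g : CompletedPathAlgebra k Q} (hf : M.Bounded f) (hg : M.Bounded g) :
    M.eval (f * g) = M.eval f * M.eval g := by
  obtain ⟨p, hp⟩ := hf
  obtain ⟨q, hq⟩ := hg
  rw [eval_eq p hp, eval_eq q hq, eval_eq (p * q) fun d => by
    simp only [Polynomial.coeff_mul, hp, hq, evalDeg_mul]]
  -- Evaluation at the central element `1` is multiplicative even though `R` is not commutative.
  exact Polynomial.eval₂_mul_noncomm _ _ fun _ => Commute.one_right _

variable (M)

theorem bounded_vert (v : V) : M.Bounded (vert k Q v) :=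
  .of_le 1 fun d hd => by rw [evalDeg_vert, if_neg (by omega)]

theorem bounded_arrow (a : A) : M.Bounded (arrow k Q a) :=
  .of_le 2 fun d hd => by rw [evalDeg_arrow, if_neg (by omega)]

theorem eval_vert (v : V) : M.eval (vert k Q v) = M.E v := by
  rw [eval_eq (Polynomial.C (M.E v)) fun d => by rw [evalDeg_vert, Polynomial.coeff_C],
    Polynomial.eval_C]

theorem eval_arrow (a : A) : M.eval (arrow k Q a) = M.X a := by
  rw [eval_eq (Polynomial.monomial 1 (M.X a)) fun d => by
    rw [evalDeg_arrow, Polynomial.coeff_monomial]; simp only [eq_comm]]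
  simp

theorem _root_.CompletedPathAlgebra.sum_vert : ∑ v, vert k Q v = 1 := by
  have h := eq_sum_vert_add_sum_arrow (1 : CompletedPathAlgebra k Q)
  have h1 : ∀ v, coeffNil v (1 : CompletedPathAlgebra k Q) = 1 := fun v =>
    if_pos (c := (Quiver.Path.nil : Quiver.Path (Q.toVert v) (Q.toVert v)).length = 0)
      (t := (1 : k)) (e := 0) rfl
  have h2 : ∀ a, stripArrow a (1 : CompletedPathAlgebra k Q) = 0 := fun a => by
    funext u v r
    by_cases h : Q.toVert (Q.src a) = v
    · rw [stripArrow_apply_of_eq _ h]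
      exact if_neg fun hh => by simp at hh
    · exact stripArrow_apply_of_ne _ h r
  simpa [h1, h2] using h.symm

theorem bounded_of_mem {f : CompletedPathAlgebra k Q} (hf : f ∈ pathAlgebra k Q) :
    M.Bounded f := by
  induction hf using Algebra.adjoin_induction with
  | mem x hx =>
    rcases hx with ⟨v, rfl⟩ | ⟨a, rfl⟩
    · exact M.bounded_vert v
    · exact M.bounded_arrow a
  | algebraMap r =>
    rw [Algebra.algebraMap_eq_smul_one]
    refine Bounded.smul r ?_
    -- The unit is a finite sum of trivial paths; its value `∑ v, M.E v` may differ from `1`.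
    rw [← sum_vert]
    exact Finset.sum_induction _ _ (fun _ _ => Bounded.add) ⟨0, by simp⟩
      fun v _ => M.bounded_vert v
  | add x y _ _ hx hy => exact hx.add hy
  | mul x y _ _ hx hy => exact hx.mul hy

variable (k) in
/-- The homomorphism from the path algebra given by a representation. -/
def lift : pathAlgebra k Q →ₙₐ[k] R where
  toFun f := M.eval (f : CompletedPathAlgebra k Q)
  map_smul' c f := eval_smul c (M.bounded_of_mem f.2)
  map_zero' := by
    have := eval_smul (0 : k) (M.bounded_of_mem (0 : pathAlgebra k Q).2)
    simpa using this
  map_add' f g := eval_add (M.bounded_of_mem f.2) (M.bounded_of_mem g.2)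
  map_mul' f g := eval_mul (M.bounded_of_mem f.2) (M.bounded_of_mem g.2)

theorem lift_pathArrow (a : A) : M.lift k (pathArrow k Q a) = M.X a := M.eval_arrow a

variable {M}

/-- The part of degree `d` is built from products of `d` arrows, so only the degrees below `N`
contribute. Hence the whole completed path algebra can be evaluated, not just `pathAlgebra`. -/
theorem bounded_of_prod_eq_zero {N : ℕ}
    (hN : ∀ l : List A, l.length = N → (l.map M.X).prod = 0) (f : CompletedPathAlgebra k Q) :
    M.Bounded f := by
  -- The word `l` collects the arrows already split off; once it has length `N` its product is zero.
  have key : ∀ (d : ℕ) (l : List A) (f : CompletedPathAlgebra k Q), l.length + d = N →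
      (l.map M.X).prod * M.evalDeg k d f = 0 := by
    intro d
    induction d with
    | zero => intro l f hl; rw [hN l hl, zero_mul]
    | succ d ih =>
      intro l f hl
      rw [evalDeg_succ, Finset.mul_sum]
      refine Finset.sum_eq_zero fun a _ => ?_
      have := ih (l ++ [a]) (stripArrow a f) (by simp; omega)
      simpa [mul_assoc] using this
  refine .of_le N fun d hd => ?_
  induction d, hd using Nat.le_induction generalizing f with
  | base => simpa using key N [] f (by simp)
  | succ d _ ih => simp [evalDeg_succ, ih]

/-- The homomorphism from the completed path algebra given by a representation in which all
products of `N` arrows vanish. -/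
def liftCompleted {N : ℕ} (hN : ∀ l : List A, l.length = N → (l.map M.X).prod = 0) :
    CompletedPathAlgebra k Q →ₙₐ[k] R where
  toFun f := M.eval f
  map_smul' c f := eval_smul c (bounded_of_prod_eq_zero hN f)
  map_zero' := by
    have := eval_smul (0 : k) (bounded_of_prod_eq_zero hN 0)
    simpa using this
  map_add' f g := eval_add (bounded_of_prod_eq_zero hN f) (bounded_of_prod_eq_zero hN g)
  map_mul' f g := eval_mul (bounded_of_prod_eq_zero hN f) (bounded_of_prod_eq_zero hN g)

end ArrowQuiver.Rep

/-- The contribution of a cycle to the cyclic derivative. -/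
def cycleDerivative {A R : Type*} [Ring R] (x : A → R) (a : A) (c : Cycle A) : R :=
  (c.lists.map fun l => if l.head? = some a then (l.tail.map x).prod else 0).sum

theorem cyclicDerivative_eq {k A R : Type*} [Field k] [Ring R] [Algebra k R] (x : A → R) (a : A)
    (W : Cycle A →₀ k) :
    cyclicDerivative x a W = ∑ c ∈ W.support, W c • cycleDerivative x a c := rfl

/-- Removing one arrow from a cycle of length at least `2` leaves a nonempty word, whose product a
non-unital homomorphism preserves. -/
theorem map_cycleDerivative {A R T F : Type*} [Ring R] [Ring T] [FunLike F R T]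
    [NonUnitalRingHomClass F R T] (f : F) (x : A → R) (a : A) {c : Cycle A} (hc : 2 ≤ c.length) :
    f (cycleDerivative x a c) = cycleDerivative (fun b => f (x b)) a c := by
  rw [cycleDerivative, cycleDerivative, map_multiset_sum, Multiset.map_map]
  congr 1
  refine Multiset.map_congr rfl fun l hl => ?_
  have hlen : l.length = c.length := by
    induction c using Quotient.inductionOn' with
    | h l' =>
      have : l ∈ l'.cyclicPermutations := hl
      rw [List.mem_cyclicPermutations_iff] at this
      exact this.perm.length_eq
  simp only [Function.comp]
  split_ifs with h
  · refine List.map_prod_map_of_ne_nil f x ?_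
    intro h0
    have := congrArg List.length h0
    simp at this
    omega
  · exact map_zero f

theorem map_cyclicDerivative {k A R T F : Type*} [Field k] [Ring R] [Algebra k R] [Ring T]
    [Algebra k T] [FunLike F R T] [NonUnitalRingHomClass F R T] [MulActionHomClass F k R T]
    (f : F) (x : A → R) (a : A) {W : Cycle A →₀ k} (hW : ∀ c ∈ W.support, 2 ≤ c.length) :
    f (cyclicDerivative x a W) = cyclicDerivative (fun b => f (x b)) a W := by
  rw [cyclicDerivative_eq, cyclicDerivative_eq, map_sum]
  refine Finset.sum_congr rfl fun c hc => ?_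
  rw [map_smul, map_cycleDerivative f x a (hW c hc)]

namespace ArrowQuiver.Rep

variable {k V A R : Type*} [Field k] [Ring R] [Algebra k R] [Fintype V] [Fintype A]
  {Q : ArrowQuiver V A} {M : Q.Rep R} {W : Cycle A →₀ k}

/-- If the cyclic derivatives generate an admissible ideal, then in every representation in which
they vanish all long products of arrows vanish. -/
theorem exists_prod_eq_zero (hW : ∀ c ∈ W.support, 2 ≤ c.length)
    (hadm : IsAdmissible (pathArrow k Q) (derivativeIdeal (pathArrow k Q) W))
    (hM : ∀ a, cyclicDerivative M.X a W = 0) :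
    ∃ N, ∀ l : List A, l.length = N → (l.map M.X).prod = 0 := by
  obtain ⟨N, hN2, hN, -⟩ := hadm
  refine ⟨N, fun l hl => ?_⟩
  -- Admissibility concerns ideals of `pathAlgebra`, where `M` can be evaluated without any
  -- nilpotency; nilpotency is then read off from the kernel.
  have hle : derivativeIdeal (pathArrow k Q) W ≤ TwoSidedIdeal.ker (M.lift k) := by
    refine TwoSidedIdeal.span_le.2 ?_
    rintro _ ⟨a, rfl⟩
    change _ ∈ TwoSidedIdeal.ker (M.lift k)
    rw [TwoSidedIdeal.mem_ker, map_cyclicDerivative _ _ _ hW]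
    simp only [lift_pathArrow]
    exact hM a
  have hmem : (l.map (pathArrow k Q)).prod ∈ TwoSidedIdeal.ker (M.lift k) :=
    hle (hN (TwoSidedIdeal.subset_span ⟨l, hl, rfl⟩))
  rw [TwoSidedIdeal.mem_ker, List.map_prod_map_of_ne_nil _ _
    (by rintro rfl; simp at hl; omega)] at hmem
  simpa only [lift_pathArrow] using hmem

end ArrowQuiver.Rep

/-! ### The tautological representation in the Jacobian algebra and its finite dimension. -/

section Jacobian

variable {k V A : Type*} [Field k] {Q : ArrowQuiver V A} {W : Cycle A →₀ k}

/-- The canonical map from the completed path algebra to the Jacobian algebra. -/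
def jacobianMk (Q : ArrowQuiver V A) (W : Cycle A →₀ k) :
    CompletedPathAlgebra k Q →ₐ[k] JacobianAlgebra Q W :=
  { (adicClosure (arrow k Q) (derivativeIdeal (arrow k Q) W)).ringCon.mk' with
    commutes' := fun _ => rfl }

theorem jacobianMk_surjective : Function.Surjective (jacobianMk Q W) :=
  RingCon.mk'_surjective _

theorem jacobianMk_eq_zero_iff (f : CompletedPathAlgebra k Q) : jacobianMk Q W f = 0 ↔
    f ∈ adicClosure (arrow k Q) (derivativeIdeal (arrow k Q) W) := by
  rw [TwoSidedIdeal.mem_iff]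
  exact (RingCon.eq _)

/-- The tautological representation of `Q` in the Jacobian algebra. -/
def jacobianRep (Q : ArrowQuiver V A) (W : Cycle A →₀ k) : Q.Rep (JacobianAlgebra Q W) where
  E v := jacobianMk Q W (vert k Q v)
  X a := jacobianMk Q W (arrow k Q a)
  E_mul v w := by
    rw [← map_mul]
    split_ifs with h
    · subst h
      congr 1
      funext u w r
      rw [vert_mul]
      split_ifs with h
      · rfl
      · refine (if_neg ?_).symm
        rintro ⟨hr, hu⟩
        cases r with
        | nil => exact h hu
        | cons r e => simp at hr
    · rw [← map_zero (jacobianMk Q W)]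
      congr 1
      funext u w' r
      rw [vert_mul]
      split_ifs with h'
      · refine if_neg ?_
        rintro ⟨hr, hu⟩
        cases r with
        | nil => exact h (h'.symm.trans hu)
        | cons r e => simp at hr
      · rfl
  E_tgt a := by rw [← map_mul, vert_mul_arrow, if_pos rfl]
  E_src a := by rw [← map_mul, arrow_mul_vert, if_pos rfl]

theorem cyclicDerivative_jacobianRep (a : A) :
    cyclicDerivative (jacobianRep Q W).X a W = 0 := by
  have h : cyclicDerivative (jacobianRep Q W).X a W =
      jacobianMk Q W (cyclicDerivative (arrow k Q) a W) := by
    rw [cyclicDerivative_eq, cyclicDerivative_eq, map_sum]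
    refine Finset.sum_congr rfl fun c _ => ?_
    rw [map_smul, cycleDerivative, cycleDerivative, map_multiset_sum, Multiset.map_map]
    congr 3
    funext l
    simp only [Function.comp]
    split_ifs
    · rw [map_list_prod, List.map_map]; rfl
    · exact (map_zero _).symm
  rw [h, jacobianMk_eq_zero_iff, adicClosure, TwoSidedIdeal.mem_iInf]
  exact fun m => le_sup_left (a := derivativeIdeal (arrow k Q) W)
    (TwoSidedIdeal.subset_span ⟨a, rfl⟩)

variable [Fintype V] [Fintype A]

theorem sum_jacobianRep_E : ∑ v, (jacobianRep Q W).E v = 1 := by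
  rw [← map_one (jacobianMk Q W), ← sum_vert, map_sum]
  rfl

/-- If all products of `N` arrows vanish in the Jacobian algebra, it is spanned by the paths of
length at most `N`. -/
theorem span_jacobian {N : ℕ}
    (hN : ∀ l : List A, l.length = N → (l.map (jacobianRep Q W).X).prod = 0) :
    Submodule.span k {x | ∃ (l : List A) (v : V), l.length ≤ N ∧
      x = (l.map (jacobianRep Q W).X).prod * (jacobianRep Q W).E v} = ⊤ := by
  rw [Submodule.eq_top_iff']
  intro x
  obtain ⟨f, rfl⟩ := jacobianMk_surjective x
  -- Each expansion of `f` by its last arrows moves one arrow into the prefix `l`, and a prefix of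
  -- length `N` vanishes.
  suffices h : ∀ (d : ℕ) (l : List A) (f : CompletedPathAlgebra k Q), l.length + d = N →
      (l.map (jacobianRep Q W).X).prod * jacobianMk Q W f ∈ Submodule.span k
        {x | ∃ (l : List A) (v : V), l.length ≤ N ∧
          x = (l.map (jacobianRep Q W).X).prod * (jacobianRep Q W).E v} by
    simpa using h N [] f (by simp)
  intro d
  induction d with
  | zero => intro l f hl; rw [hN l hl, zero_mul]; exact zero_mem _
  | succ d ih =>
    intro l f hl
    rw [eq_sum_vert_add_sum_arrow f, map_add, mul_add, map_sum, map_sum, Finset.mul_sum,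
      Finset.mul_sum]
    refine add_mem (sum_mem fun v _ => ?_) (sum_mem fun a _ => ?_)
    · rw [map_smul, mul_smul_comm]
      exact Submodule.smul_mem _ _ (Submodule.subset_span ⟨l, v, by omega, rfl⟩)
    · have := ih (l ++ [a]) (stripArrow a f) (by simp; omega)
      rw [List.map_append, List.prod_append, List.map_singleton, List.prod_singleton,
        mul_assoc] at this
      rw [map_mul]
      exact this

theorem finite_jacobian {N : ℕ}
    (hN : ∀ l : List A, l.length = N → (l.map (jacobianRep Q W).X).prod = 0) :
    Module.Finite k (JacobianAlgebra Q W) := by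
  rw [Module.finite_def, Submodule.fg_def]
  refine ⟨_, ?_, span_jacobian hN⟩
  · have h1 : (Set.univ.image2 (fun (v : V) (l : List A) =>
        (l.map (jacobianRep Q W).X).prod * (jacobianRep Q W).E v)
          {l : List A | l.length ≤ N}).Finite :=
      Set.Finite.image2 _ Set.finite_univ (List.finite_length_le A N)
    refine h1.subset ?_
    rintro _ ⟨l, v, hl, rfl⟩
    exact ⟨v, trivial, l, hl, rfl⟩

end Jacobian

namespace ArrowQuiver.Rep

variable {k V A R : Type*} [Field k] [Ring R] [Algebra k R] [Fintype V] [Fintype A]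
  {Q : ArrowQuiver V A} {M : Q.Rep R} {W : Cycle A →₀ k} {N : ℕ}

/-- The closure lies in the derivative ideal enlarged by any one power of the arrow ideal; a
sufficiently high power is killed by `M`. -/
theorem adicClosure_le_ker (hW : ∀ c ∈ W.support, 2 ≤ c.length)
    (hM : ∀ a, cyclicDerivative M.X a W = 0)
    (hN : ∀ l : List A, l.length = N → (l.map M.X).prod = 0) :
    adicClosure (arrow k Q) (derivativeIdeal (arrow k Q) W) ≤
      TwoSidedIdeal.ker (liftCompleted (k := k) hN) := by
  -- The exponent is `N + 1` and not `N`, so that the words are nonempty even if `N = 0`.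
  refine (iInf_le _ (N + 1)).trans (sup_le (TwoSidedIdeal.span_le.2 ?_)
    (TwoSidedIdeal.span_le.2 ?_))
  · rintro _ ⟨a, rfl⟩
    change _ ∈ TwoSidedIdeal.ker _
    rw [TwoSidedIdeal.mem_ker, map_cyclicDerivative _ _ _ hW]
    rw [← hM a]
    congr 1
    funext b
    exact M.eval_arrow b
  · rintro _ ⟨l, hl, rfl⟩
    change _ ∈ TwoSidedIdeal.ker _
    have hl0 : l ≠ [] := by rintro rfl; simp at hl
    rw [TwoSidedIdeal.mem_ker, List.map_prod_map_of_ne_nil _ _ hl0]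
    have hx : (fun a => liftCompleted (k := k) hN (arrow k Q a)) = M.X :=
      funext fun b => M.eval_arrow b
    rw [hx]
    obtain ⟨a, l, rfl⟩ := List.exists_cons_of_ne_nil hl0
    rw [List.map_cons, List.prod_cons, hN l (by simpa using hl), mul_zero]

/-- The homomorphism from the Jacobian algebra given by a representation in which the cyclic
derivatives and all products of `N` arrows vanish. -/
def liftJacobian (hW : ∀ c ∈ W.support, 2 ≤ c.length)
    (hM : ∀ a, cyclicDerivative M.X a W = 0)
    (hN : ∀ l : List A, l.length = N → (l.map M.X).prod = 0) :
    JacobianAlgebra Q W →ₙₐ[k] R where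
  toFun := Quotient.lift (liftCompleted (k := k) hN) fun f g hfg => by
    have h : f - g ∈ adicClosure (arrow k Q) (derivativeIdeal (arrow k Q) W) :=
      (TwoSidedIdeal.rel_iff _ _ _).1 hfg
    have h2 := adicClosure_le_ker hW hM hN h
    rwa [TwoSidedIdeal.mem_ker, map_sub, sub_eq_zero] at h2
  map_smul' c x := by
    obtain ⟨f, rfl⟩ := jacobianMk_surjective x
    exact map_smul (liftCompleted (k := k) hN) c f
  map_zero' := map_zero (liftCompleted (k := k) hN)
  map_add' x y := by
    obtain ⟨f, rfl⟩ := jacobianMk_surjective x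
    obtain ⟨g, rfl⟩ := jacobianMk_surjective y
    exact map_add (liftCompleted (k := k) hN) f g
  map_mul' x y := by
    obtain ⟨f, rfl⟩ := jacobianMk_surjective x
    obtain ⟨g, rfl⟩ := jacobianMk_surjective y
    exact map_mul (liftCompleted (k := k) hN) f g

variable (hW : ∀ c ∈ W.support, 2 ≤ c.length) (hM : ∀ a, cyclicDerivative M.X a W = 0)
    (hN : ∀ l : List A, l.length = N → (l.map M.X).prod = 0)

theorem liftJacobian_E (v : V) : liftJacobian hW hM hN ((jacobianRep Q W).E v) = M.E v :=
  M.eval_vert v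

theorem liftJacobian_X (a : A) : liftJacobian hW hM hN ((jacobianRep Q W).X a) = M.X a :=
  M.eval_arrow a

end ArrowQuiver.Rep
end

/-! ### The chain rule for cyclic derivatives under matrix substitutions. -/

noncomputable section

section ChainRule

variable (k : Type*) {A B R I : Type*} [Field k] [Ring R] [Algebra k R]

/-- The sum of `v z u` over all factorisations `l = u a v` of the word `l`. -/
def wordDerivative (x : A → R) (a : A) : List A → R →ₗ[k] R
  | [] => 0
  | b :: l => (if b = a then LinearMap.mulLeft k (l.map x).prod else 0) +
      wordDerivative x a l ∘ₗ LinearMap.mulRight k (x b)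

variable {k}

theorem wordDerivative_nil (x : A → R) (a : A) (z : R) : wordDerivative k x a [] z = 0 := rfl

theorem wordDerivative_cons (x : A → R) (a b : A) (l : List A) (z : R) :
    wordDerivative k x a (b :: l) z =
      (if b = a then (l.map x).prod * z else 0) + wordDerivative k x a l (z * x b) := by
  simp only [wordDerivative, LinearMap.add_apply, LinearMap.comp_apply, LinearMap.mulRight_apply]
  split_ifs <;> simp

theorem wordDerivative_eq_sum (x : A → R) (a : A) (l : List A) (z : R) :
    wordDerivative k x a l z = ∑ i ∈ Finset.range l.length,
      if l[i]? = some a then ((l.drop (i + 1)).map x).prod * z * ((l.take i).map x).prod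
      else 0 := by
  induction l generalizing z with
  | nil => rfl
  | cons b l ih =>
    rw [wordDerivative_cons, ih, List.length_cons, Finset.sum_range_succ', add_comm]
    congr 1
    · refine Finset.sum_congr rfl fun i _ => ?_
      simp [mul_assoc]
    · simp

/-- The rotation of `l` that brings position `i` to the front has as its tail the letters after `i`
followed by those before it. The recursive side, with its accumulator `z`, is the one suited to
induction on words. -/
theorem cycleDerivative_coe (x : A → R) (a : A) (l : List A) :
    cycleDerivative x a (l : Cycle A) = wordDerivative k x a l 1 := by
  by_cases hl : l = []
  · subst hl
    simp [cycleDerivative, wordDerivative_nil]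
  have hperm : l.cyclicPermutations = (List.range l.length).map l.rotate := by
    refine List.ext_getElem (by simp [hl]) fun i _ _ => ?_
    rw [List.getElem_cyclicPermutations]
    simp
  have hsum : ∀ f : ℕ → R, ∑ i ∈ Finset.range l.length, f i =
      ((List.range l.length).map f).sum := fun f => rfl
  rw [wordDerivative_eq_sum, cycleDerivative, Cycle.lists_coe, Multiset.map_coe,
    Multiset.sum_coe, hperm, List.map_map, hsum]
  congr 1
  refine List.map_congr_left fun i hi => ?_
  have hi : i < l.length := List.mem_range.1 hi
  simp only [Function.comp, List.rotate_eq_drop_append_take hi.le, List.drop_eq_getElem_cons hi,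
    List.getElem?_eq_getElem hi, List.cons_append, List.head?_cons, List.tail_cons,
    List.map_append, List.prod_append, mul_one]

variable (t : A → I → I → k) (L : A → I → I → B)

/-- The matrix obtained by substituting `y` for the letters in the matrix whose entries are
the multiples `t a i j` of the letters `L a i j`. -/
def letterMatrix (y : B → R) (a : A) : Matrix I I R := Matrix.of fun i j => t a i j • y (L a i j)

theorem letterMatrix_apply (y : B → R) (a : A) (i j : I) :
    letterMatrix t L y a i j = t a i j • y (L a i j) := rfl

variable [Fintype I]

/-- The entries of the formal product of letter matrices along the word `l`. -/
def wordLift : List A → I → I → List B →₀ k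
  | [], i, j => if i = j then Finsupp.single [] 1 else 0
  | a :: l, i, j => ∑ m, t a i m • (wordLift l m j).mapDomain (L a i m :: ·)

theorem linearCombination_wordLift (y : B → R) (l : List A) (i j : I) :
    Finsupp.linearCombination k (fun w : List B => (w.map y).prod) (wordLift t L l i j) =
      (l.map (letterMatrix t L y)).prod i j := by
  induction l generalizing i with
  | nil =>
    simp only [wordLift, List.map_nil, List.prod_nil, Matrix.one_apply]
    split_ifs <;> simp
  | cons a l ih =>
    simp only [wordLift, map_sum, map_smul, Finsupp.linearCombination_mapDomain, List.map_cons,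
      List.prod_cons, Matrix.mul_apply, letterMatrix_apply]
    refine Finset.sum_congr rfl fun m _ => ?_
    rw [← ih, smul_mul_assoc]
    congr 1
    have : ((fun w : List B => (w.map y).prod) ∘ fun x => L a i m :: x) =
        LinearMap.mulLeft k (y (L a i m)) ∘ fun w : List B => (w.map y).prod := by
      funext w; simp
    rw [this, ← Finsupp.apply_linearCombination]
    rfl

variable [Fintype A]

/-- The chain rule for a single entry of the formal product. Removing the letter at `(i', j')`
leaves a prefix from `i` to `i'` and a suffix from `j'` to `j`; the matrix unit `single j i z` glues
the suffix to the prefix with `z` in between. -/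
theorem linearCombination_wordDerivative (y : B → R) (β : B) (l : List A) (i j : I) (z : R) :
    Finsupp.linearCombination k (fun w : List B => wordDerivative k y β w z)
      (wordLift t L l i j) =
      ∑ a, ∑ i', ∑ j', (if L a i' j' = β then t a i' j' else 0) •
        (wordDerivative k (letterMatrix t L y) a l (Matrix.single j i z)) j' i' := by
  induction l generalizing i z with
  | nil =>
    simp only [wordLift, wordDerivative_nil, Matrix.zero_apply, smul_zero, Finset.sum_const_zero]
    split_ifs <;> simp [wordDerivative_nil]
  | cons a l ih =>
    -- When the accumulator absorbs a letter matrix, its row `j` is kept and its column `i` is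
    -- spread over all intermediate indices `m`; the induction is applied to each of these matrix
    -- units.
    have hsingle : Matrix.single j i z * letterMatrix t L y a =
        ∑ m, t a i m • Matrix.single j m (z * y (L a i m)) := by
      ext p q
      by_cases hp : p = j
      · subst hp
        rw [Matrix.single_mul_apply_same, Matrix.sum_apply, Finset.sum_eq_single q]
        · simp [letterMatrix_apply]
        · intro m _ hm; simp [hm]
        · simp
      · rw [Matrix.single_mul_apply_of_ne _ _ _ _ _ hp, Matrix.sum_apply]
        exact (Finset.sum_eq_zero fun m _ => by simp [Ne.symm hp]).symm
    have hfun : ∀ m, ((fun w : List B => wordDerivative k y β w z) ∘ fun x => L a i m :: x) =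
        (fun w => (if L a i m = β then LinearMap.mulRight k z else 0) (w.map y).prod) +
          fun w => wordDerivative k y β w (z * y (L a i m)) := by
      intro m
      funext w
      simp only [Function.comp, wordDerivative_cons, Pi.add_apply]
      split_ifs <;> simp
    simp only [wordLift, map_sum, map_smul, Finsupp.linearCombination_mapDomain, hfun]
    have hadd : ∀ (f g : List B → R) (v : List B →₀ k), Finsupp.linearCombination k (f + g) v =
        Finsupp.linearCombination k f v + Finsupp.linearCombination k g v := by
      intro f g v
      simp [Finsupp.linearCombination_apply, Finsupp.sum, Finset.sum_add_distrib]
    simp only [hadd, ih, smul_add, Finset.sum_add_distrib]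
    simp only [wordDerivative_cons, hsingle, map_sum, map_smul, Matrix.add_apply, smul_add,
      Finset.sum_add_distrib]
    congr 1
    · refine Eq.trans ?_ (Finset.sum_eq_single a (fun b _ hb => ?_) (by simp)).symm
      · refine Eq.trans ?_ (Finset.sum_eq_single i (fun i' _ hi' => ?_) (by simp)).symm
        · refine Finset.sum_congr rfl fun m _ => ?_
          rw [if_pos rfl, Matrix.mul_single_apply_same, ← linearCombination_wordLift]
          split_ifs with h
          · congr 1
            exact (Finsupp.apply_linearCombination k (LinearMap.mulRight k z) _ _).symm
          · simp [Finsupp.linearCombination_apply]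
        · refine Finset.sum_eq_zero fun m _ => ?_
          rw [if_pos rfl, Matrix.mul_single_apply_of_ne _ _ _ _ _ hi', smul_zero]
      · simp [Ne.symm hb]
    · simp only [Finset.smul_sum, Matrix.sum_apply, Matrix.smul_apply]
      rw [Finset.sum_comm]
      refine Finset.sum_congr rfl fun b _ => ?_
      rw [Finset.sum_comm]
      refine Finset.sum_congr rfl fun i' _ => ?_
      rw [Finset.sum_comm]
      refine Finset.sum_congr rfl fun j' _ => ?_
      refine Finset.sum_congr rfl fun m _ => ?_
      rw [smul_comm]

/-- The trace of the formal product of letter matrices along the word `l`, as a linear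
combination of cycles. -/
def traceLift (l : List A) : Cycle B →₀ k :=
  ∑ i, (wordLift t L l i i).mapDomain ((↑) : List B → Cycle B)

/-- The chain rule for cyclic derivatives and linear substitutions of matrices. -/
theorem cyclicDerivative_traceLift (y : B → R) (β : B) (l : List A) :
    cyclicDerivative y β (traceLift t L l) =
      ∑ a, ∑ i, ∑ j, (if L a i j = β then t a i j else 0) •
        (cycleDerivative (letterMatrix t L y) a (l : Cycle A)) j i := by
  have h : cyclicDerivative y β (traceLift t L l) =
      Finsupp.linearCombination k (cycleDerivative y β) (traceLift t L l) := rfl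
  have h2 : (cycleDerivative y β ∘ ((↑) : List B → Cycle B)) =
      fun w : List B => wordDerivative k y β w 1 := by
    funext w
    exact cycleDerivative_coe y β w
  rw [h, traceLift, map_sum]
  simp only [Finsupp.linearCombination_mapDomain, h2, linearCombination_wordDerivative,
    cycleDerivative_coe (k := k)]
  rw [Finset.sum_comm]
  refine Finset.sum_congr rfl fun a _ => ?_
  rw [Finset.sum_comm]
  refine Finset.sum_congr rfl fun i _ => ?_
  rw [Finset.sum_comm]
  refine Finset.sum_congr rfl fun j _ => ?_
  -- The diagonal matrix units add up to the identity, so the accumulator becomes `1` and the cyclic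
  -- derivative reappears.
  rw [← Finset.smul_sum, ← Matrix.sum_apply, ← map_sum]
  rw [Matrix.sum_single_one]

end ChainRule
end

/-! ### Characters, orbits of vertices and arrows, and the scalars of the matrix substitution. -/

noncomputable section

namespace CyclicQP

variable {k V A : Type*} [Field k] (S : CyclicQP k V A)

/-- A primitive `n`-th root of unity prevents the characteristic from dividing `n`; averages over
`G` therefore make sense. -/
theorem n_ne_zero : (S.n : k) ≠ 0 :=
  haveI := S.isPrimitiveRoot.neZero'
  NeZero.ne _

/-- The character `x ↦ ζ ^ x` of `ℤ/n`. -/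
def χ : AddChar (ZMod S.n) k := AddChar.zmodChar S.n S.isPrimitiveRoot.pow_eq_one

theorem χ_apply (x : ZMod S.n) : S.χ x = S.ζ ^ x.val := rfl

theorem χ_eq_one_iff (x : ZMod S.n) : S.χ x = 1 ↔ x = 0 := by
  constructor
  · intro h
    have h2 := (S.isPrimitiveRoot.pow_eq_one_iff_dvd _).1 h
    rw [← ZMod.val_eq_zero]
    exact Nat.eq_zero_of_dvd_of_lt h2 (ZMod.val_lt x)
  · rintro rfl
    exact AddChar.map_zero_eq_one _

theorem χ_ne_zero (x : ZMod S.n) : S.χ x ≠ 0 := by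
  rw [χ_apply]
  exact pow_ne_zero _ (S.isPrimitiveRoot.ne_zero S.n_pos.ne')

theorem sum_χ_mul (μ : ZMod S.n) : ∑ r, S.χ (r * μ) = if μ = 0 then (S.n : k) else 0 := by
  have h := AddChar.sum_mulShift μ (ψ := S.χ) (AddChar.zmodChar_primitive_of_primitive_root S.n S.isPrimitiveRoot)
  simpa [ZMod.card] using h

theorem fixed_zpow_iff (r : ℤ) (v : V) : S.Fixed ((S.σ ^ r) v) ↔ S.Fixed v := by
  unfold Fixed
  rw [← Equiv.Perm.mul_apply, (Commute.zpow_right rfl r : Commute S.σ (S.σ ^ r)).eq,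
    Equiv.Perm.mul_apply]
  exact (S.σ ^ r).injective.eq_iff

theorem fixed_σ_iff (v : V) : S.Fixed (S.σ v) ↔ S.Fixed v := S.fixed_zpow_iff 1 v

theorem Fixed.zpow_apply {S : CyclicQP k V A} {v : V} (h : S.Fixed v) (r : ℤ) :
    (S.σ ^ r) v = v :=
  Equiv.Perm.zpow_apply_eq_self_of_apply_eq_self h r

/-- The condition on orbit cardinalities says that `ℤ/n` acts freely on the non-fixed vertices,
since the minimal period equals the size of the orbit. -/
theorem zpow_apply_eq_self_iff {v : V} (hv : ¬ S.Fixed v) (r : ℤ) :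
    (S.σ ^ r) v = v ↔ (S.n : ℤ) ∣ r := by
  have h1 : Function.minimalPeriod (S.σ • ·) v = S.n := by
    rw [← S.orbit_card v hv]
    have h2 : {w | S.σ.SameCycle v w} = MulAction.orbit (Subgroup.zpowers S.σ) v := by
      ext w
      constructor
      · rintro ⟨i, hi⟩
        exact ⟨⟨S.σ ^ i, i, rfl⟩, hi⟩
      · rintro ⟨⟨_, i, rfl⟩, hi⟩
        exact ⟨i, hi⟩
    rw [h2, ← Nat.card_coe_set_eq]
    have hfin : (MulAction.orbit (Subgroup.zpowers S.σ) v).Finite := by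
      rw [← h2]
      exact Set.finite_of_ncard_pos (by rw [S.orbit_card v hv]; exact S.n_pos)
    haveI := hfin.fintype
    rw [Nat.card_eq_fintype_card]
    exact MulAction.minimalPeriod_eq_card (a := S.σ) (b := v)
  rw [← h1]
  exact MulAction.zpow_smul_eq_iff_minimalPeriod_dvd (a := S.σ) (b := v)

theorem zpow_apply_eq_zpow_apply_iff {v : V} (hv : ¬ S.Fixed v) (r s : ℤ) :
    (S.σ ^ r) v = (S.σ ^ s) v ↔ (r : ZMod S.n) = s := by
  rw [ZMod.intCast_eq_intCast_iff_dvd_sub, ← S.zpow_apply_eq_self_iff hv,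
    show s - r = -r + s by ring, zpow_add, Equiv.Perm.mul_apply, zpow_neg,
    Equiv.Perm.inv_eq_iff_eq, eq_comm]

theorem arrow_smul_inj {a b : A} {c : k} (h : pathArrow k S.Q a = c • pathArrow k S.Q b) :
    a = b := by
  have h1 : arrow k S.Q a = c • arrow k S.Q b := congrArg Subtype.val h
  by_contra hab
  have h2 := congrArg (stripArrow a) h1
  rw [map_smul, stripArrow_arrow, stripArrow_arrow, if_pos rfl, if_neg hab, smul_zero] at h2
  have h3 := congrArg (coeffNil (S.Q.src a)) h2
  rw [coeffNil_vert, if_pos rfl, map_zero] at h3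
  exact one_ne_zero h3

theorem exists_g_pow (m : ℕ) (a : A) :
    ∃ c : k, (S.g ^ m) (pathArrow k S.Q a) = c • pathArrow k S.Q ((S.τ ^ m) a) := by
  induction m generalizing a with
  | zero => exact ⟨1, by simp⟩
  | succ m ih =>
    obtain ⟨c, hc⟩ := ih (S.τ a)
    refine ⟨S.coef a * c, ?_⟩
    rw [pow_succ, pow_succ, AlgEquiv.mul_apply, S.g_arrow, map_smul, hc, smul_smul]
    rfl

theorem τ_pow_n : S.τ ^ S.n = 1 := by
  ext a
  obtain ⟨c, hc⟩ := S.exists_g_pow S.n a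
  have hg : S.g ^ S.n = 1 := by rw [← S.orderOf_g]; exact pow_orderOf_eq_one S.g
  rw [hg] at hc
  exact (S.arrow_smul_inj hc).symm

theorem σ_pow_n : S.σ ^ S.n = 1 := by
  ext v
  by_cases hv : S.Fixed v
  · simpa using hv.zpow_apply (S.n : ℤ)
  · simpa using (S.zpow_apply_eq_self_iff hv (S.n : ℤ)).2 dvd_rfl

theorem τ_zpow_of_eq {r s : ℤ} (h : (r : ZMod S.n) = s) : S.τ ^ r = S.τ ^ s := by
  obtain ⟨m, hm⟩ := (ZMod.intCast_eq_intCast_iff_dvd_sub _ _ _).1 h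
  have : s = r + S.n * m := by omega
  rw [this, zpow_add, zpow_mul, zpow_natCast, S.τ_pow_n]
  simp

theorem σ_zpow_of_eq {r s : ℤ} (h : (r : ZMod S.n) = s) : S.σ ^ r = S.σ ^ s := by
  obtain ⟨m, hm⟩ := (ZMod.intCast_eq_intCast_iff_dvd_sub _ _ _).1 h
  have : s = r + S.n * m := by omega
  rw [this, zpow_add, zpow_mul, zpow_natCast, S.σ_pow_n]
  simp

theorem τ_apply_of_fixed {a : A} (hs : S.Fixed (S.Q.src a)) (ht : S.Fixed (S.Q.tgt a)) :
    S.τ a = a := (S.fixed_arrow a hs ht).1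

theorem coef_of_fixed {a : A} (hs : S.Fixed (S.Q.src a)) (ht : S.Fixed (S.Q.tgt a)) :
    S.coef a = S.χ (S.b a) := by
  rw [b, dif_pos ⟨hs, ht⟩]
  exact (S.fixed_arrow a hs ht).2.choose_spec

theorem coef_of_not_fixed {a : A} (h : ¬ (S.Fixed (S.Q.src a) ∧ S.Fixed (S.Q.tgt a))) :
    S.coef a = 1 := S.nonfixed_arrow a (not_and_or.1 h)

theorem b_of_not_fixed {a : A} (h : ¬ (S.Fixed (S.Q.src a) ∧ S.Fixed (S.Q.tgt a))) :
    S.b a = 0 := dif_neg h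

theorem coef_eq_χ (a : A) : S.coef a = S.χ (S.b a) := by
  by_cases h : S.Fixed (S.Q.src a) ∧ S.Fixed (S.Q.tgt a)
  · exact S.coef_of_fixed h.1 h.2
  · rw [S.coef_of_not_fixed h, S.b_of_not_fixed h, AddChar.map_zero_eq_one]

theorem b_τ (a : A) : S.b (S.τ a) = S.b a := by
  by_cases h : S.Fixed (S.Q.src a) ∧ S.Fixed (S.Q.tgt a)
  · rw [S.τ_apply_of_fixed h.1 h.2]
  · rw [S.b_of_not_fixed h, S.b_of_not_fixed]
    rwa [S.src_τ, S.tgt_τ, S.fixed_σ_iff, S.fixed_σ_iff]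

theorem b_τ_zpow (r : ℤ) (a : A) : S.b ((S.τ ^ r) a) = S.b a := by
  induction r generalizing a with
  | zero => simp
  | succ i ih => rw [zpow_add_one, Equiv.Perm.mul_apply, ih, b_τ]
  | pred i ih =>
    rw [zpow_sub_one, Equiv.Perm.mul_apply, ih]
    conv_rhs => rw [← S.τ.apply_symm_apply a, b_τ]
    rfl

/-- The indices `(v, μ)`, where `μ = 0` if `v` is not fixed. They are the vertices of a covering
of the quiver `Q_G`. -/
abbrev Idx : Type _ := {p : V × ZMod S.n // S.Fixed p.1 ∨ p.2 = 0}

/-- The action of `g` on the indices. -/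
def ρ : Equiv.Perm S.Idx where
  toFun p := ⟨(S.σ p.1.1, p.1.2), p.2.imp_left (S.fixed_σ_iff _).2⟩
  invFun p := ⟨(S.σ.symm p.1.1, p.1.2), p.2.imp_left fun h => by
    rwa [← S.fixed_σ_iff, Equiv.apply_symm_apply]⟩
  left_inv p := by simp
  right_inv p := by simp

theorem ρ_fst (i : S.Idx) : (S.ρ i).1.1 = S.σ i.1.1 := rfl
theorem ρ_snd (i : S.Idx) : (S.ρ i).1.2 = i.1.2 := rfl

theorem ρ_zpow (r : ℤ) (i : S.Idx) :
    ((S.ρ ^ r) i).1.1 = (S.σ ^ r) i.1.1 ∧ ((S.ρ ^ r) i).1.2 = i.1.2 := by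
  have hinv : ∀ i, (S.ρ⁻¹ i).1.1 = S.σ⁻¹ i.1.1 ∧ (S.ρ⁻¹ i).1.2 = i.1.2 := fun i => ⟨rfl, rfl⟩
  induction r generalizing i with
  | zero => simp
  | succ m ih =>
    rw [zpow_add_one, zpow_add_one, Equiv.Perm.mul_apply, Equiv.Perm.mul_apply]
    exact ih _
  | pred m ih =>
    rw [zpow_sub_one, zpow_sub_one, Equiv.Perm.mul_apply, Equiv.Perm.mul_apply]
    exact ih _

variable {S}

theorem Idx.snd_eq_zero {i : S.Idx} (h : ¬ S.Fixed i.1.1) : i.1.2 = 0 := i.2.resolve_left h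

theorem Idx.ext' {i j : S.Idx} (h1 : i.1.1 = j.1.1) (h2 : i.1.2 = j.1.2) : i = j :=
  Subtype.ext (Prod.ext h1 h2)

theorem ρ_of_fixed {i : S.Idx} (h : S.Fixed i.1.1) : S.ρ i = i := Idx.ext' h rfl

namespace Representatives

variable (E : S.Representatives)

theorem vertRep_sameCycle (v : V) : S.σ.SameCycle v (E.vertRep v) :=
  (E.existsUnique v).choose_spec.1.2

theorem vertRep_eq {v w : V} (hw : w ∈ E.carrier) (h : S.σ.SameCycle v w) : E.vertRep v = w :=
  ((E.existsUnique v).choose_spec.2 w ⟨hw, h⟩).symm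

theorem vertRep_of_mem {v : V} (hv : v ∈ E.carrier) : E.vertRep v = v :=
  E.vertRep_eq hv (Equiv.Perm.SameCycle.refl _ _)

theorem vertRep_zpow (r : ℤ) (v : V) : E.vertRep ((S.σ ^ r) v) = E.vertRep v :=
  E.vertRep_eq (E.vertRep_mem v)
    ((Equiv.Perm.sameCycle_zpow_left (n := r)).2 (E.vertRep_sameCycle v))

theorem vertRep_σ (v : V) : E.vertRep (S.σ v) = E.vertRep v := E.vertRep_zpow 1 v

theorem exists_zpow_vertRep (v : V) : ∃ r : ℤ, (S.σ ^ r) (E.vertRep v) = v :=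
  (E.vertRep_sameCycle v).symm

theorem fixed_vertRep_iff (v : V) : S.Fixed (E.vertRep v) ↔ S.Fixed v := by
  obtain ⟨r, hr⟩ := E.exists_zpow_vertRep v
  conv_rhs => rw [← hr, S.fixed_zpow_iff]

theorem mem_of_fixed {v : V} (hv : S.Fixed v) : v ∈ E.carrier := by
  obtain ⟨r, hr⟩ := E.exists_zpow_vertRep v
  rw [((E.fixed_vertRep_iff v).2 hv).zpow_apply] at hr
  rw [← hr]
  exact E.vertRep_mem v

/-- For a vertex `v` which is not fixed, the element `d ∈ ℤ/n` with `v = g^d * ε`, `ε ∈ 𝓔`. -/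
def deg (v : V) : ZMod S.n :=
  if S.Fixed v then 0 else ((E.exists_zpow_vertRep v).choose : ZMod S.n)

theorem deg_of_fixed {v : V} (hv : S.Fixed v) : E.deg v = 0 := if_pos hv

theorem deg_eq {v : V} (hv : ¬ S.Fixed v) {r : ℤ} (h : (S.σ ^ r) (E.vertRep v) = v) :
    E.deg v = r := by
  rw [deg, if_neg hv, ← S.zpow_apply_eq_zpow_apply_iff (mt (E.fixed_vertRep_iff v).1 hv), h]
  exact (E.exists_zpow_vertRep v).choose_spec

theorem deg_zpow {v : V} (hv : ¬ S.Fixed v) (r : ℤ) : E.deg ((S.σ ^ r) v) = E.deg v + r := by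
  obtain ⟨s, hs⟩ := E.exists_zpow_vertRep v
  rw [E.deg_eq hv hs, ← Int.cast_add]
  refine E.deg_eq (mt (S.fixed_zpow_iff r v).1 hv) ?_
  rw [E.vertRep_zpow, add_comm, zpow_add, Equiv.Perm.mul_apply, hs]

theorem deg_σ {v : V} (hv : ¬ S.Fixed v) : E.deg (S.σ v) = E.deg v + 1 := by
  simpa using E.deg_zpow hv 1

theorem deg_of_mem {v : V} (hv : v ∈ E.carrier) : E.deg v = 0 := by
  by_cases h : S.Fixed v
  · exact E.deg_of_fixed h
  · simpa using E.deg_eq h (r := 0) (by simpa using E.vertRep_of_mem hv)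

/-- If an end is not fixed, both arrows have such an end in `𝓔`; comparing degrees gives `r = 0` in
`ℤ/n`. If both ends are fixed, `τ` fixes the arrow. Hence `arrowRep` does not depend on the choice
made in `shift`. -/
theorem typed_unique {a : A} {r : ℤ} (h1 : E.IsTyped a) (h2 : E.IsTyped ((S.τ ^ r) a)) :
    (S.τ ^ r) a = a := by
  have key : ∀ v, v ∈ E.carrier → (S.σ ^ r) v ∈ E.carrier → ¬ S.Fixed v → (S.τ ^ r) a = a := by
    intro v hv hr hf
    have h := E.deg_zpow hf r
    rw [E.deg_of_mem hv, E.deg_of_mem hr, zero_add] at h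
    have := S.τ_zpow_of_eq (r := r) (s := 0) (by rw [← h, Int.cast_zero])
    rw [this]; rfl
  by_cases ht : S.Fixed (S.Q.tgt a)
  · by_cases hs : S.Fixed (S.Q.src a)
    · exact Equiv.Perm.zpow_apply_eq_self_of_apply_eq_self (S.τ_apply_of_fixed hs ht) r
    · refine key _ (h1.2 ht) ?_ hs
      rw [← S.src_τ_zpow]
      exact h2.2 (by rwa [S.tgt_τ_zpow, S.fixed_zpow_iff])
  · exact key _ h1.1 (by rw [← S.tgt_τ_zpow]; exact h2.1) ht

theorem τ_zpow_shift (a : A) : (S.τ ^ E.shift a) (E.arrowRep a) = a := by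
  rw [arrowRep, ← Equiv.Perm.mul_apply, ← zpow_add]; simp

theorem arrowRep_zpow (r : ℤ) (a : A) : E.arrowRep ((S.τ ^ r) a) = E.arrowRep a := by
  have h : E.arrowRep ((S.τ ^ r) a) =
      (S.τ ^ (-E.shift ((S.τ ^ r) a) + r + E.shift a)) (E.arrowRep a) := by
    rw [zpow_add, zpow_add, Equiv.Perm.mul_apply, Equiv.Perm.mul_apply, τ_zpow_shift]; rfl
  rw [h]
  exact E.typed_unique (E.arrowRep_isTyped a) (h ▸ E.arrowRep_isTyped _)

theorem arrowRep_of_typed {a : A} (h : E.IsTyped a) : E.arrowRep a = a :=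
  E.typed_unique h (E.arrowRep_isTyped a)

theorem tilde_eq_of_arrowRep_eq {a a' : A} (h : E.arrowRep a = E.arrowRep a') (μ : ZMod S.n) :
    E.tilde a μ = E.tilde a' μ := by
  unfold tilde
  simp only [h]

theorem tilde_zpow (r : ℤ) (a : A) (μ : ZMod S.n) : E.tilde ((S.τ ^ r) a) μ = E.tilde a μ :=
  E.tilde_eq_of_arrowRep_eq (E.arrowRep_zpow r a) μ

theorem tilde_τ (a : A) (μ : ZMod S.n) : E.tilde (S.τ a) μ = E.tilde a μ := E.tilde_zpow 1 a μ

theorem fixed_src_arrowRep_iff (a : A) : S.Fixed (S.Q.src (E.arrowRep a)) ↔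
    S.Fixed (S.Q.src a) := by
  rw [arrowRep, S.src_τ_zpow, S.fixed_zpow_iff]

theorem fixed_tgt_arrowRep_iff (a : A) : S.Fixed (S.Q.tgt (E.arrowRep a)) ↔
    S.Fixed (S.Q.tgt a) := by
  rw [arrowRep, S.tgt_τ_zpow, S.fixed_zpow_iff]

theorem isTypeOne_arrowRep_iff (a : A) : E.IsTypeOne (E.arrowRep a) ↔
    ¬ S.Fixed (S.Q.src a) ∧ ¬ S.Fixed (S.Q.tgt a) := by
  rw [IsTypeOne, fixed_src_arrowRep_iff, fixed_tgt_arrowRep_iff,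
    and_iff_right (E.arrowRep_isTyped a)]

/-- The coefficient of the entry `(i, j)` of the matrix representing the arrow `a`. -/
def scal (a : A) (i j : S.Idx) : k :=
  if i.1.1 = S.Q.tgt a ∧ j.1.1 = S.Q.src a ∧
    (S.Fixed (S.Q.src a) → S.Fixed (S.Q.tgt a) → i.1.2 = j.1.2 - S.b a) then
    S.χ (j.1.2 * E.deg (S.Q.tgt a) - i.1.2 * E.deg (S.Q.src a)) else 0

/-- The arrow of `Q_G` occurring in the entry `(i, j)` of the matrix representing the
arrow `a`. -/
def letter (a : A) (i j : S.Idx) : E.ArrowG :=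
  E.tilde a (if S.Fixed (S.Q.src a) then j.1.2 else i.1.2)

theorem letter_τ (a : A) (i j : S.Idx) : E.letter (S.τ a) (S.ρ i) (S.ρ j) = E.letter a i j := by
  rw [letter, tilde_τ, letter, S.src_τ]
  simp only [S.fixed_σ_iff]
  rfl

/-- The exponents in `scal` are designed for this equivariance. Applying `g` raises the degree of a
non-fixed end by one, which produces the character value of the index at the other end; between
fixed ends the same factor is `coef a = ζ^{b(a)}`. -/
theorem scal_τ (a : A) (i j : S.Idx) : S.coef a * E.scal (S.τ a) (S.ρ i) (S.ρ j) =
    S.χ (j.1.2 - i.1.2) * E.scal a i j := by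
  unfold scal
  simp only [S.src_τ, S.tgt_τ, S.fixed_σ_iff, ρ_fst, ρ_snd, S.b_τ,
    (Equiv.injective S.σ).eq_iff]
  split_ifs with h
  · obtain ⟨h1, h2, h3⟩ := h
    rw [S.coef_eq_χ, ← AddChar.map_add_eq_mul, ← AddChar.map_add_eq_mul]
    congr 1
    by_cases hs : S.Fixed (S.Q.src a) <;> by_cases ht : S.Fixed (S.Q.tgt a)
    · rw [h3 hs ht, E.deg_of_fixed hs, E.deg_of_fixed ht,
        E.deg_of_fixed ((S.fixed_σ_iff _).2 hs), E.deg_of_fixed ((S.fixed_σ_iff _).2 ht)]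
      ring
    · rw [S.b_of_not_fixed (by tauto), E.deg_of_fixed hs,
        E.deg_of_fixed ((S.fixed_σ_iff _).2 hs), E.deg_σ ht, Idx.snd_eq_zero (i := i) (h1 ▸ ht)]
      ring
    · rw [S.b_of_not_fixed (by tauto), E.deg_of_fixed ht,
        E.deg_of_fixed ((S.fixed_σ_iff _).2 ht), E.deg_σ hs, Idx.snd_eq_zero (i := j) (h2 ▸ hs)]
      ring
    · rw [S.b_of_not_fixed (by tauto), Idx.snd_eq_zero (i := i) (h1 ▸ ht),
        Idx.snd_eq_zero (i := j) (h2 ▸ hs)]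
      ring
  · simp

/-- The vertex of `Q_G` given by an index. -/
def η (i : S.Idx) : E.VertG := E.vertG i.1.1 i.1.2

theorem vertG_congr {v w : V} (h : E.vertRep v = E.vertRep w) (μ : ZMod S.n) :
    E.vertG v μ = E.vertG w μ := by
  unfold vertG
  simp only [h]

theorem vertG_of_not_fixed {v : V} (h : ¬ S.Fixed v) (μ ν : ZMod S.n) :
    E.vertG v μ = E.vertG v ν := by
  rw [vertG, dif_neg (mt (E.fixed_vertRep_iff v).1 h), vertG,
    dif_neg (mt (E.fixed_vertRep_iff v).1 h)]

theorem vertRep_src_arrowRep (a : A) :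
    E.vertRep (S.Q.src (E.arrowRep a)) = E.vertRep (S.Q.src a) := by
  rw [arrowRep, S.src_τ_zpow, vertRep_zpow]

theorem vertRep_tgt_arrowRep (a : A) :
    E.vertRep (S.Q.tgt (E.arrowRep a)) = E.vertRep (S.Q.tgt a) := by
  rw [arrowRep, S.tgt_τ_zpow, vertRep_zpow]

theorem src_tilde (a : A) (μ : ZMod S.n) : E.quiverG.src (E.tilde a μ) =
    E.vertG (S.Q.src a) μ := by
  unfold tilde
  split_ifs with h
  · exact (E.vertG_congr (E.vertRep_src_arrowRep a) 0).trans
      (E.vertG_of_not_fixed ((E.isTypeOne_arrowRep_iff a).1 h).1 _ _)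
  · exact E.vertG_congr (E.vertRep_src_arrowRep a) μ

theorem tgt_tilde (a : A) (μ : ZMod S.n) : E.quiverG.tgt (E.tilde a μ) =
    E.vertG (S.Q.tgt a) (μ - S.b a) := by
  unfold tilde
  split_ifs with h
  · exact (E.vertG_congr (E.vertRep_tgt_arrowRep a) 0).trans
      (E.vertG_of_not_fixed ((E.isTypeOne_arrowRep_iff a).1 h).2 _ _)
  · rw [← S.b_τ_zpow (-E.shift a) a]
    exact E.vertG_congr (E.vertRep_tgt_arrowRep a) _

theorem src_letter {a : A} {i j : S.Idx} (h : E.scal a i j ≠ 0) :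
    E.quiverG.src (E.letter a i j) = E.η j := by
  have h' := (ite_ne_right_iff.1 h).1
  rw [letter, src_tilde, η, h'.2.1]
  split_ifs with hs
  · rfl
  · exact E.vertG_of_not_fixed hs _ _

theorem tgt_letter {a : A} {i j : S.Idx} (h : E.scal a i j ≠ 0) :
    E.quiverG.tgt (E.letter a i j) = E.η i := by
  have h' := (ite_ne_right_iff.1 h).1
  rw [letter, tgt_tilde, η, h'.1]
  by_cases ht : S.Fixed (S.Q.tgt a)
  · split_ifs with hs
    · rw [h'.2.2 hs ht]
    · rw [S.b_of_not_fixed (by tauto), sub_zero]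
  · exact E.vertG_of_not_fixed ht _ _

/-- A letter remembers the orbit of the arrow and the index at a fixed end; at a non-fixed end the
index is zero, and between fixed ends one index determines the other. So the nonzero entries with a
given letter form a single `G`-orbit. -/
theorem exists_zpow_of_letter_eq {a a' : A} {i i' j j' : S.Idx} (h : E.scal a i j ≠ 0)
    (h' : E.scal a' i' j' ≠ 0) (hl : E.letter a i j = E.letter a' i' j') :
    ∃ r : ℤ, a' = (S.τ ^ r) a ∧ i' = (S.ρ ^ r) i ∧ j' = (S.ρ ^ r) j := by
  have h := (ite_ne_right_iff.1 h).1
  have h' := (ite_ne_right_iff.1 h').1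
  have hrep : E.arrowRep a = E.arrowRep a' := by
    unfold letter tilde at hl
    split_ifs at hl <;> simp at hl <;> first | exact hl | exact hl.1
  have hμ : ¬ (¬ S.Fixed (S.Q.src a) ∧ ¬ S.Fixed (S.Q.tgt a)) →
      (if S.Fixed (S.Q.src a) then j.1.2 else i.1.2) =
      (if S.Fixed (S.Q.src a') then j'.1.2 else i'.1.2) := by
    intro hn
    have hn' := mt (E.isTypeOne_arrowRep_iff a).1 hn
    unfold letter tilde at hl
    rw [dif_neg hn', dif_neg (hrep ▸ hn')] at hl
    exact (Prod.ext_iff.1 (Sum.inr.inj hl)).2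
  have ha : a' = (S.τ ^ (E.shift a' - E.shift a)) a := by
    rw [zpow_sub, Equiv.Perm.mul_apply, ← zpow_neg]
    change a' = (S.τ ^ E.shift a') (E.arrowRep a)
    rw [hrep, τ_zpow_shift]
  generalize E.shift a' - E.shift a = r at ha
  have hs : S.Fixed (S.Q.src a') ↔ S.Fixed (S.Q.src a) := by
    rw [ha, S.src_τ_zpow, S.fixed_zpow_iff]
  have ht : S.Fixed (S.Q.tgt a') ↔ S.Fixed (S.Q.tgt a) := by
    rw [ha, S.tgt_τ_zpow, S.fixed_zpow_iff]
  have hb : S.b a' = S.b a := by rw [ha, S.b_τ_zpow]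
  simp only [hs, ht, hb] at hμ h'
  refine ⟨r, ha, Idx.ext' ?_ ?_, Idx.ext' ?_ ?_⟩
  · rw [(S.ρ_zpow r i).1, h'.1, h.1, ha, S.tgt_τ_zpow]
  · rw [(S.ρ_zpow r i).2]
    by_cases h1 : S.Fixed (S.Q.tgt a)
    · by_cases h2 : S.Fixed (S.Q.src a)
      · rw [h.2.2 h2 h1, h'.2.2 h2 h1]
        simpa [h2] using (hμ (by tauto)).symm
      · simpa [h2] using (hμ (by tauto)).symm
    · rw [Idx.snd_eq_zero (i := i) (h.1 ▸ h1), Idx.snd_eq_zero (i := i')]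
      rwa [h'.1, ht]
  · rw [(S.ρ_zpow r j).1, h'.2.1, h.2.1, ha, S.src_τ_zpow]
  · rw [(S.ρ_zpow r j).2]
    by_cases h2 : S.Fixed (S.Q.src a)
    · simpa [h2] using (hμ (by tauto)).symm
    · rw [Idx.snd_eq_zero (i := j) (h.2.1 ▸ h2), Idx.snd_eq_zero (i := j')]
      rwa [h'.2.1, hs]

end Representatives

end CyclicQP
end

/-! ### Equivariance of the cyclic derivatives of `W` at the letter matrices. -/

noncomputable section

section Cycles

variable {k A B R : Type*} [Field k] [Ring R] [Algebra k R]

theorem Cycle.map_comp {A B C : Type*} (f : B → C) (g : A → B) (c : Cycle A) :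
    c.map (f ∘ g) = (c.map g).map f := by
  induction c using Quotient.inductionOn' with
  | h l => exact congrArg ((↑) : List C → Cycle C) List.map_map.symm

theorem Cycle.map_id' (c : Cycle A) : c.map id = c := by
  induction c using Quotient.inductionOn' with
  | h l => exact congrArg ((↑) : List A → Cycle A) (List.map_id l)

theorem wordDerivative_comp (x : B → R) {f : A → B} (hf : Function.Injective f) (a : A)
    (l : List A) (z : R) :
    wordDerivative k (x ∘ f) a l z = wordDerivative k x (f a) (l.map f) z := by
  induction l generalizing z with
  | nil => rfl
  | cons b l ih =>
    rw [List.map_cons, wordDerivative_cons, wordDerivative_cons, ih, List.map_map]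
    simp only [hf.eq_iff, Function.comp]

/-- Each term on the left lacks the scalar of the removed letter `a`; the factor `u a` restores it,
so that all terms carry the full product. -/
theorem wordDerivative_smul (x : A → R) (u : A → k) (a : A) (l : List A) (z : R) :
    u a • wordDerivative k (fun b => u b • x b) a l z =
      (l.map u).prod • wordDerivative k x a l z := by
  have hprod : ∀ l : List A, (l.map fun b => u b • x b).prod = (l.map u).prod • (l.map x).prod := by
    intro l
    induction l with
    | nil => simp
    | cons b l ih => simp only [List.map_cons, List.prod_cons, ih, smul_mul_smul_comm]
  induction l generalizing z with
  | nil => simp [wordDerivative_nil]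
  | cons b l ih =>
    rw [wordDerivative_cons, wordDerivative_cons, List.map_cons, List.prod_cons, mul_smul_comm,
      map_smul, smul_add, smul_add, smul_comm (u a) (u b), ih, mul_smul, mul_smul]
    congr 1
    split_ifs with h
    · rw [h, hprod, smul_mul_assoc]
    · simp

theorem cycleDerivative_comp (k : Type*) {A B R : Type*} [Field k] [Ring R] [Algebra k R]
    (x : B → R) {f : A → B} (hf : Function.Injective f) (a : A)
    (c : Cycle A) : cycleDerivative (x ∘ f) a c = cycleDerivative x (f a) (c.map f) := by
  induction c using Quotient.inductionOn' with
  | h l =>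
    change cycleDerivative (x ∘ f) a (l : Cycle A) = cycleDerivative x (f a) (l.map f : List B)
    rw [cycleDerivative_coe (k := k), cycleDerivative_coe (k := k), wordDerivative_comp x hf]

theorem cycleDerivative_smul (x : A → R) (u : A → k) (a : A) (c : Cycle A) :
    u a • cycleDerivative (fun b => u b • x b) a c =
      (c.toMultiset.map u).prod • cycleDerivative x a c := by
  induction c using Quotient.inductionOn' with
  | h l =>
    change u a • cycleDerivative (fun b => u b • x b) a (l : Cycle A) =
      ((l : Multiset A).map u).prod • cycleDerivative x a (l : Cycle A)
    rw [cycleDerivative_coe (k := k), cycleDerivative_coe (k := k), wordDerivative_smul]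
    simp

end Cycles

namespace CyclicQP

variable {k V A : Type*} [Field k] {S : CyclicQP k V A}

theorem two_le_length {c : Cycle A} (hc : c ∈ S.W.support) : 2 ≤ c.length := by
  have := (S.isPotential c hc).2
  omega

/-- The product of the coefficients of `g` on the arrows of a cycle. -/
def coefProd (S : CyclicQP k V A) (c : Cycle A) : k := (c.toMultiset.map S.coef).prod

theorem coefProd_ne_zero (c : Cycle A) : S.coefProd c ≠ 0 := by
  rw [coefProd, Ne, Multiset.prod_eq_zero_iff, Multiset.mem_map]
  rintro ⟨a, -, ha⟩
  exact S.coef_ne_zero a ha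

theorem map_τ_injective : Function.Injective (Cycle.map S.τ) := by
  intro c d h
  have h2 := congrArg (Cycle.map S.τ.symm) h
  rwa [← Cycle.map_comp, ← Cycle.map_comp, Equiv.symm_comp_self, Cycle.map_id',
    Cycle.map_id'] at h2

/-- Comparison of one coefficient in `g(W) = W`; a single term survives because `τ` is injective on
cycles. -/
theorem W_map_τ (c : Cycle A) : S.W (c.map S.τ) = S.W c * S.coefProd c := by
  have h := congrArg (fun f : Cycle A →₀ k => f (c.map S.τ)) S.g_potential
  simp only [Finsupp.sum, Finsupp.finsetSum_apply, Finsupp.single_apply,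
    map_τ_injective.eq_iff] at h
  rw [← h, Finset.sum_ite_eq']
  split_ifs with hc
  · rfl
  · rw [Finsupp.notMem_support_iff.1 hc, zero_mul]

theorem map_τ_mem_support_iff (c : Cycle A) : c.map S.τ ∈ S.W.support ↔ c ∈ S.W.support := by
  rw [Finsupp.mem_support_iff, Finsupp.mem_support_iff, W_map_τ, mul_ne_zero_iff,
    and_iff_left (coefProd_ne_zero c)]

theorem map_τ_zpow_mem_support_iff (r : ℤ) (c : Cycle A) :
    c.map (S.τ ^ r) ∈ S.W.support ↔ c ∈ S.W.support := by
  induction r generalizing c with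
  | zero => rw [zpow_zero, Equiv.Perm.coe_one, Cycle.map_id']
  | succ i ih =>
    rw [zpow_add_one, Equiv.Perm.coe_mul, Cycle.map_comp, ih, map_τ_mem_support_iff]
  | pred i ih =>
    rw [zpow_sub_one, Equiv.Perm.coe_mul, Cycle.map_comp, ih]
    conv_rhs => rw [← Cycle.map_id' c, ← Equiv.self_comp_symm S.τ, Cycle.map_comp,
      map_τ_mem_support_iff]
    rfl

section Gauge

variable {R : Type*} [Ring R] [Algebra k R] [Fintype V]

/-- Conjugation by the action of `g` on matrices indexed by `Idx`. -/
def gauge (S : CyclicQP k V A) (R : Type*) [Ring R] [Algebra k R] :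
    Matrix S.Idx S.Idx R →ₙₐ[k] Matrix S.Idx S.Idx R where
  toFun M := Matrix.of fun i j => S.χ (i.1.2 - j.1.2) • M (S.ρ i) (S.ρ j)
  map_smul' c M := by ext i j; exact smul_comm _ c _
  map_zero' := by ext i j; simp
  map_add' M N := by ext i j; simp
  map_mul' M N := by
    ext i j
    simp only [Matrix.of_apply, Matrix.mul_apply, smul_mul_smul_comm, ← AddChar.map_add_eq_mul,
      sub_add_sub_cancel, Finset.smul_sum]
    exact (Equiv.sum_comp S.ρ fun m => S.χ (i.1.2 - j.1.2) • (M (S.ρ i) m * N m (S.ρ j))).symm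

theorem gauge_apply (M : Matrix S.Idx S.Idx R) (i j : S.Idx) :
    S.gauge R M i j = S.χ (i.1.2 - j.1.2) • M (S.ρ i) (S.ρ j) := rfl

variable (E : S.Representatives)

/-- The matrix over `R` representing the arrow `a` of `Q`, for elements `y β` of `R` representing
the arrows of `Q_G`. -/
abbrev Representatives.mat (y : E.ArrowG → R) (a : A) : Matrix S.Idx S.Idx R :=
  letterMatrix E.scal E.letter y a

theorem mat_apply (y : E.ArrowG → R) (a : A) (i j : S.Idx) :
    E.mat y a i j = E.scal a i j • y (E.letter a i j) := rfl

/-- The phase of `gauge` cancels the one in `scal_τ`, while the letters are invariant: the letter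
matrices form a `G`-equivariant family. -/
theorem gauge_mat (y : E.ArrowG → R) (a : A) :
    S.coef a • S.gauge R (E.mat y (S.τ a)) = E.mat y a := by
  ext i j
  rw [Matrix.smul_apply, gauge_apply, mat_apply, mat_apply, E.letter_τ,
    smul_smul, smul_smul, mul_comm (S.coef a), mul_assoc, E.scal_τ,
    ← mul_assoc, ← AddChar.map_add_eq_mul]
  simp

theorem gauge_cycleDerivative (y : E.ArrowG → R) (a : A) {c : Cycle A} (hc : 2 ≤ c.length) :
    S.coef a • cycleDerivative (E.mat y) a c =
      S.coefProd c • S.gauge R (cycleDerivative (E.mat y) (S.τ a) (c.map S.τ)) := by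
  have h1 : E.mat y = fun b => S.coef b • (S.gauge R ∘ E.mat y ∘ S.τ) b :=
    funext fun b => (gauge_mat E y b).symm
  conv_lhs => rw [h1, cycleDerivative_smul]
  rw [← cycleDerivative_comp k (E.mat y) S.τ.injective, map_cycleDerivative (S.gauge R) _ _ hc]
  rfl

theorem gauge_cyclicDerivative (y : E.ArrowG → R) (a : A) :
    S.coef a • cyclicDerivative (E.mat y) a S.W =
      S.gauge R (cyclicDerivative (E.mat y) (S.τ a) S.W) := by
  rw [cyclicDerivative_eq, cyclicDerivative_eq, Finset.smul_sum, map_sum]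
  refine Finset.sum_bij' (fun c _ => c.map S.τ) (fun c _ => c.map S.τ.symm)
    (fun c hc => (map_τ_mem_support_iff c).2 hc) (fun c hc => ?_) (fun c _ => ?_)
    (fun c _ => ?_) (fun c hc => ?_)
  · rwa [← map_τ_mem_support_iff, ← Cycle.map_comp, Equiv.self_comp_symm, Cycle.map_id']
  · rw [← Cycle.map_comp, Equiv.symm_comp_self, Cycle.map_id']
  · rw [← Cycle.map_comp, Equiv.self_comp_symm, Cycle.map_id']
  · rw [smul_comm, gauge_cycleDerivative E y a (two_le_length hc), map_smul, W_map_τ, mul_smul]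

variable [Fintype A]

/-- The derivative with respect to `β` of the trace of a cycle. -/
def Representatives.traceDerivative (y : E.ArrowG → R) (β : E.ArrowG) (c : Cycle A) : R :=
  ∑ a, ∑ i, ∑ j, (if E.letter a i j = β then E.scal a i j else 0) •
    (cycleDerivative (E.mat y) a c) j i

/-- The factor `coefProd c` gained by the coefficient of `W` cancels the change of the derivative
under `gauge`. All cycles in an orbit therefore contribute equally, and one representative weighted
by the size of the orbit suffices. -/
theorem W_smul_traceDerivative (y : E.ArrowG → R) (β : E.ArrowG) {c : Cycle A}
    (hc : c ∈ S.W.support) :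
    S.W (c.map S.τ) • E.traceDerivative y β (c.map S.τ) = S.W c • E.traceDerivative y β c := by
  unfold Representatives.traceDerivative
  rw [Finset.smul_sum, Finset.smul_sum]
  refine Eq.trans (Equiv.sum_comp S.τ _).symm (Finset.sum_congr rfl fun a _ => ?_)
  rw [Finset.smul_sum, Finset.smul_sum]
  refine Eq.trans (Equiv.sum_comp S.ρ _).symm (Finset.sum_congr rfl fun i _ => ?_)
  rw [Finset.smul_sum, Finset.smul_sum]
  refine Eq.trans (Equiv.sum_comp S.ρ _).symm (Finset.sum_congr rfl fun j _ => ?_)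
  rw [E.letter_τ]
  split_ifs with h
  · have h1 := congrFun (congrFun (gauge_cycleDerivative E y a (two_le_length hc)) j) i
    rw [Matrix.smul_apply, Matrix.smul_apply, gauge_apply] at h1
    have h2 := E.scal_τ a i j
    apply smul_right_injective R (S.coef_ne_zero a)
    change S.coef a • S.W _ • _ = S.coef a • S.W c • _
    rw [smul_comm (S.coef a) (S.W c), smul_comm (S.coef a) (E.scal a i j), h1, W_map_τ]
    simp only [smul_smul]
    congr 1
    calc S.coef a * (S.W c * S.coefProd c * E.scal (S.τ a) (S.ρ i) (S.ρ j))
        = S.W c * S.coefProd c * (S.coef a * E.scal (S.τ a) (S.ρ i) (S.ρ j)) := by ring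
      _ = _ := by rw [h2]; ring
  · simp

theorem W_smul_traceDerivative_zpow (y : E.ArrowG → R) (β : E.ArrowG) {c : Cycle A}
    (hc : c ∈ S.W.support) (r : ℤ) :
    S.W (c.map (S.τ ^ r)) • E.traceDerivative y β (c.map (S.τ ^ r)) =
      S.W c • E.traceDerivative y β c := by
  induction r generalizing c with
  | zero => rw [zpow_zero, Equiv.Perm.coe_one, Cycle.map_id']
  | succ i ih =>
    rw [zpow_add_one, Equiv.Perm.coe_mul, Cycle.map_comp,
      ih ((map_τ_mem_support_iff c).2 hc), W_smul_traceDerivative E y β hc]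
  | pred i ih =>
    have hc' : c.map S.τ.symm ∈ S.W.support := by
      rwa [← map_τ_mem_support_iff, ← Cycle.map_comp, Equiv.self_comp_symm, Cycle.map_id']
    rw [zpow_sub_one, Equiv.Perm.coe_mul, Cycle.map_comp]
    refine (ih hc').trans ?_
    rw [← W_smul_traceDerivative E y β hc', ← Cycle.map_comp, Equiv.self_comp_symm,
      Cycle.map_id']

end Gauge

end CyclicQP
end

/-! ### Traces of the letter matrices along the four types of cycles. -/

noncomputable section

namespace CyclicQP

variable {k V A : Type*} [Field k] {S : CyclicQP k V A}

/-- The word `l` is a path in `Q` from `v` to `w`. -/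
def IsWalk (Q : ArrowQuiver V A) : List A → V → V → Prop
  | [], w, v => w = v
  | a :: l, w, v => w = Q.tgt a ∧ IsWalk Q l (Q.src a) v

theorem isWalk_of_isChain (Q : ArrowQuiver V A) (a c : A) (l : List A)
    (h : List.IsChain (fun a b => Q.src a = Q.tgt b) (a :: (l ++ [c]))) :
    IsWalk Q (a :: l) (Q.tgt a) (Q.tgt c) := by
  induction l generalizing a with
  | nil => exact ⟨rfl, (List.isChain_cons_cons.1 h).1⟩
  | cons b l ih =>
    obtain ⟨h1, h2⟩ := List.isChain_cons_cons.1 h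
    refine ⟨rfl, ?_⟩
    rw [h1]
    exact ih b h2

theorem IsWalk.forall_src {Q : ArrowQuiver V A} {P : V → Prop} {l : List A} {w v : V}
    (h : IsWalk Q l w v) (hv : P v) (hl : ∀ a ∈ l, P (Q.tgt a)) : ∀ a ∈ l, P (Q.src a) := by
  induction l generalizing w with
  | nil => simp
  | cons a l ih =>
    intro c hc
    rcases List.mem_cons.1 hc with rfl | hc
    · cases l with
      | nil => rw [show Q.src c = v from h.2]; exact hv
      | cons d l => rw [h.2.1]; exact hl d (by simp)
    · exact ih h.2 (fun x hx => hl x (List.mem_cons_of_mem _ hx)) c hc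

section Sums

variable [Fintype V] {M : Type*} [AddCommMonoid M]

theorem sum_idx_of_not_fixed {v : V} (hv : ¬ S.Fixed v) (f : S.Idx → M)
    (hf : ∀ m : S.Idx, m.1.1 ≠ v → f m = 0) : ∑ m, f m = f ⟨(v, 0), Or.inr rfl⟩ := by
  refine Finset.sum_eq_single _ (fun m _ hm => hf m fun h => hm (Idx.ext' h ?_)) (by simp)
  exact Idx.snd_eq_zero (h ▸ hv)

theorem sum_idx_of_fixed {v : V} (hv : S.Fixed v) (f : S.Idx → M)
    (hf : ∀ m : S.Idx, m.1.1 ≠ v → f m = 0) : ∑ m, f m = ∑ μ, f ⟨(v, μ), Or.inl hv⟩ := by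
  symm
  refine Finset.sum_of_injOn (fun μ => ⟨(v, μ), Or.inl hv⟩) (fun μ _ ν _ h => ?_) (by simp)
    (fun m _ hm => hf m fun h => hm ⟨m.1.2, by simp, Idx.ext' h.symm rfl⟩) (fun _ _ => rfl)
  exact congrArg (fun m : S.Idx => m.1.2) h

end Sums

namespace Representatives

theorem sum_b_of_not_fixed {l : List A} (h : ∀ a ∈ l, ¬ S.Fixed (S.Q.tgt a)) :
    (l.map S.b).sum = 0 := by
  refine List.sum_eq_zero fun x hx => ?_
  obtain ⟨a, ha, rfl⟩ := List.mem_map.1 hx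
  exact S.b_of_not_fixed fun hh => h a ha hh.2

variable (E : S.Representatives)

theorem scal_eq_zero_of_ne_tgt {a : A} {i j : S.Idx} (h : i.1.1 ≠ S.Q.tgt a) :
    E.scal a i j = 0 := if_neg fun hh => h hh.1

theorem scal_eq_zero_of_ne_src {a : A} {i j : S.Idx} (h : j.1.1 ≠ S.Q.src a) :
    E.scal a i j = 0 := if_neg fun hh => h hh.2.1

/-- Phases arise only where a fixed and a non-fixed vertex meet: the degree is zero at fixed
vertices and the index is zero at the others. -/
theorem scal_of_iff {a : A} (ha : S.Fixed (S.Q.src a) ↔ S.Fixed (S.Q.tgt a)) (i j : S.Idx) :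
    E.scal a i j = if i.1.1 = S.Q.tgt a ∧ j.1.1 = S.Q.src a ∧ i.1.2 = j.1.2 - S.b a
      then 1 else 0 := by
  unfold scal
  by_cases h : S.Fixed (S.Q.src a)
  · simp [h, ha.1 h, E.deg_of_fixed]
  · have h' := mt ha.2 h
    by_cases h1 : i.1.1 = S.Q.tgt a
    · by_cases h2 : j.1.1 = S.Q.src a
      · have hi := Idx.snd_eq_zero (i := i) (h1 ▸ h')
        have hj := Idx.snd_eq_zero (i := j) (h2 ▸ h)
        simp [h, h1, h2, hi, hj, S.b_of_not_fixed (a := a) (by tauto)]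
      · simp [h2]
    · simp [h1]

theorem liftWord_of_not_fixed {l : List A}
    (hs : ∀ a ∈ l, ¬ S.Fixed (S.Q.src a)) (ht : ∀ a ∈ l, ¬ S.Fixed (S.Q.tgt a))
    (μ ν : ZMod S.n) : E.liftWord μ l = E.liftWord ν l := by
  induction l with
  | nil => rfl
  | cons a l ih =>
    rw [liftWord, liftWord, ih (fun c hc => hs c (List.mem_cons_of_mem _ hc))
      fun c hc => ht c (List.mem_cons_of_mem _ hc)]
    congr 1
    have h := (E.isTypeOne_arrowRep_iff a).2 ⟨hs a (by simp), ht a (by simp)⟩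
    rw [tilde, tilde, dif_pos h, dif_pos h]

/-- The typed representative of such an arrow starts in `𝓔`. This identifies the phase in `scal`
with the exponent `p` of type (ii). -/
theorem deg_src_eq_shift {a : A} (hs : ¬ S.Fixed (S.Q.src a)) (ht : S.Fixed (S.Q.tgt a)) :
    E.deg (S.Q.src a) = E.shift a := by
  refine E.deg_eq hs ?_
  have hmem := (E.arrowRep_isTyped a).2 ((E.fixed_tgt_arrowRep_iff a).2 ht)
  rw [← E.vertRep_src_arrowRep, E.vertRep_of_mem hmem, ← S.src_τ_zpow, E.τ_zpow_shift]

variable [Fintype V]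

/-- The lift of a path all of whose arrows either have two fixed ends or none. -/
theorem wordLift_of_iff {l : List A}
    (hl : ∀ a ∈ l, (S.Fixed (S.Q.src a) ↔ S.Fixed (S.Q.tgt a))) (i j : S.Idx) :
    wordLift E.scal E.letter l i j =
      if IsWalk S.Q l i.1.1 j.1.1 ∧ i.1.2 = j.1.2 - (l.map S.b).sum then
        Finsupp.single (E.liftWord j.1.2 l) 1 else 0 := by
  induction l generalizing i with
  | nil =>
    simp only [wordLift, IsWalk, List.map_nil, List.sum_nil, sub_zero, liftWord]
    congr 1
    exact propext ⟨fun h => by subst h; exact ⟨rfl, rfl⟩, fun h => Idx.ext' h.1 h.2⟩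
  | cons a l ih =>
    have ha := hl a (by simp)
    simp only [wordLift, ih fun c hc => hl c (List.mem_cons_of_mem _ hc), E.scal_of_iff ha]
    simp only [IsWalk, List.map_cons, List.sum_cons]
    split_ifs with h
    · obtain ⟨⟨h1, h2⟩, h3⟩ := h
      -- Only one intermediate index contributes: its vertex must be the source of `a`, and its
      -- second coordinate is forced by the condition in `scal`.
      have hm : S.Fixed (S.Q.src a) ∨ i.1.2 + S.b a = 0 := by
        by_cases hs : S.Fixed (S.Q.src a)
        · exact Or.inl hs
        · right
          rw [S.b_of_not_fixed (by tauto), add_zero, Idx.snd_eq_zero]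
          rw [h1]
          exact mt ha.2 hs
      rw [Finset.sum_eq_single (⟨(S.Q.src a, i.1.2 + S.b a), hm⟩ : S.Idx)]
      · have h4 : i.1.2 + S.b a = j.1.2 - (l.map S.b).sum := by rw [h3]; ring
        rw [if_pos ⟨h1, rfl, by simp⟩, one_smul, if_pos ⟨h2, h4⟩, Finsupp.mapDomain_single]
        congr 1
        rw [liftWord, letter, ← h4]
        congr 1
        by_cases hs : S.Fixed (S.Q.src a)
        · rw [if_pos hs]
        · rw [if_neg hs, S.b_of_not_fixed (by tauto), add_zero]
      · intro m _ hm
        rw [if_neg, zero_smul]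
        rintro ⟨-, h5, h6⟩
        exact hm (Idx.ext' h5 (eq_add_of_sub_eq h6.symm))
      · simp
    · refine Finset.sum_eq_zero fun m _ => ?_
      split_ifs with h1 h2
      · refine absurd ⟨⟨h1.1, ?_⟩, ?_⟩ h
        · rw [← h1.2.1]; exact h2.1
        · rw [h1.2.2, h2.2]; ring
      · simp
      · simp
      · simp

/-- The trace in type (i). -/
theorem traceLift_type_one {a : A} {l : List A} (hw : IsWalk S.Q (a :: l) (S.Q.tgt a) (S.Q.tgt a))
    (ht : ∀ c ∈ a :: l, ¬ S.Fixed (S.Q.tgt c)) :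
    traceLift E.scal E.letter (a :: l) =
      Finsupp.single (E.liftWord 0 (a :: l) : Cycle E.ArrowG) 1 := by
  have hs := hw.forall_src (P := fun v => ¬ S.Fixed v) (ht a (by simp)) ht
  unfold traceLift
  rw [sum_idx_of_not_fixed (ht a (by simp))]
  · rw [E.wordLift_of_iff fun c hc => iff_of_false (hs c hc) (ht c hc),
      if_pos ⟨hw, ((congrArg _ (sum_b_of_not_fixed ht)).trans (sub_zero _)).symm⟩,
      Finsupp.mapDomain_single]
  · intro m hm
    rw [E.wordLift_of_iff fun c hc => iff_of_false (hs c hc) (ht c hc),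
      if_neg fun h => hm h.1.1, Finsupp.mapDomain_zero]

/-- The trace in type (iv). -/
theorem traceLift_type_four {a : A} {l : List A}
    (hw : IsWalk S.Q (a :: l) (S.Q.tgt a) (S.Q.tgt a))
    (ht : ∀ c ∈ a :: l, S.Fixed (S.Q.tgt c)) (hb : ((a :: l).map S.b).sum = 0) :
    traceLift E.scal E.letter (a :: l) =
      ∑ μ, Finsupp.single (E.liftWord μ (a :: l) : Cycle E.ArrowG) 1 := by
  have hs := hw.forall_src (P := fun v => S.Fixed v) (ht a (by simp)) ht
  unfold traceLift
  rw [sum_idx_of_fixed (ht a (by simp))]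
  · refine Finset.sum_congr rfl fun μ _ => ?_
    rw [E.wordLift_of_iff fun c hc => iff_of_true (hs c hc) (ht c hc),
      if_pos ⟨hw, ((congrArg _ hb).trans (sub_zero _)).symm⟩,
      Finsupp.mapDomain_single]
  · intro m hm
    rw [E.wordLift_of_iff fun c hc => iff_of_true (hs c hc) (ht c hc),
      if_neg fun h => hm h.1.1, Finsupp.mapDomain_zero]

/-- The trace in type (ii). -/
theorem traceLift_type_two {a c : A} {l : List A}
    (hw : IsWalk S.Q (a :: c :: l) (S.Q.tgt a) (S.Q.tgt a))
    (ha : S.Fixed (S.Q.src a)) (hat : ¬ S.Fixed (S.Q.tgt a)) (haE : S.Q.tgt a ∈ E.carrier)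
    (hl : ∀ x ∈ l, ¬ S.Fixed (S.Q.tgt x)) (hl0 : l ≠ []) :
    traceLift E.scal E.letter (a :: c :: l) =
      ∑ μ, Finsupp.single (E.liftWord μ (a :: c :: l) : Cycle E.ArrowG)
        (S.χ (-(E.p (a :: c :: l) * μ))) := by
  obtain ⟨-, hac, hwl⟩ := hw
  have hs := hwl.forall_src (P := fun v => ¬ S.Fixed v) hat hl
  have hcs : ¬ S.Fixed (S.Q.src c) := by
    obtain ⟨d, l, rfl⟩ := List.exists_cons_of_ne_nil hl0
    rw [hwl.1]
    exact hl d (by simp)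
  have hct : S.Fixed (S.Q.tgt c) := hac ▸ ha
  have hbl := sum_b_of_not_fixed hl
  have hbc : S.b c = 0 := S.b_of_not_fixed (by tauto)
  unfold traceLift
  rw [sum_idx_of_not_fixed hat]
  swap
  · intro m hm
    rw [wordLift, Finset.sum_eq_zero, Finsupp.mapDomain_zero]
    intro m' _
    rw [E.scal_eq_zero_of_ne_tgt hm, zero_smul]
  rw [wordLift, sum_idx_of_fixed ha, ← Finsupp.mapDomain.addMonoidHom_apply, map_sum]
  swap
  · intro m hm
    rw [E.scal_eq_zero_of_ne_src hm, zero_smul]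
  refine Finset.sum_congr rfl fun μ _ => ?_
  rw [wordLift, sum_idx_of_not_fixed hcs]
  swap
  · intro m hm
    rw [E.scal_eq_zero_of_ne_src hm, zero_smul]
  rw [E.wordLift_of_iff fun x hx => iff_of_false (hs x hx) (hl x hx), if_pos ⟨hwl, by simp [hbl]⟩]
  have h1 : E.scal a ⟨(S.Q.tgt a, 0), Or.inr rfl⟩ ⟨(S.Q.src a, μ), Or.inl ha⟩ = 1 := by
    unfold scal
    rw [if_pos ⟨rfl, rfl, fun _ h => absurd h hat⟩, E.deg_of_mem haE]
    simp
  -- The only nontrivial phase of the cycle: `c` enters the fixed vertex at index `μ` from a vertex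
  -- of degree `p`, which gives `ζ^{-pμ}`.
  have h2 : E.scal c ⟨(S.Q.src a, μ), Or.inl ha⟩ ⟨(S.Q.src c, 0), Or.inr rfl⟩ =
      S.χ (-(E.p (a :: c :: l) * μ)) := by
    unfold scal
    rw [if_pos ⟨hac, rfl, fun h => absurd h hcs⟩, E.deg_src_eq_shift hcs hct, p]
    congr 1
    simp only [zero_mul, zero_sub, neg_inj]
    exact mul_comm _ _
  simp only [h1, h2, one_smul, Finsupp.mapDomain_single,
    Finsupp.mapDomain.addMonoidHom_apply, Finsupp.smul_single, smul_eq_mul, mul_one]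
  congr 2
  simp only [liftWord, letter, if_pos ha, if_neg hcs, List.map_cons, List.sum_cons, hbl, hbc,
    add_zero, sub_zero, E.liftWord_of_not_fixed hs hl 0 μ]

/-- The trace in type (iii). -/
theorem traceLift_type_three {a c : A} {l : List A}
    (hw : IsWalk S.Q (a :: c :: l) (S.Q.tgt a) (S.Q.tgt a))
    (ha : ¬ S.Fixed (S.Q.src a)) (hat : S.Fixed (S.Q.tgt a)) (haE : S.Q.src a ∈ E.carrier)
    (hl : ∀ x ∈ l, S.Fixed (S.Q.tgt x)) (hl0 : l ≠ []) :
    traceLift E.scal E.letter (a :: c :: l) =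
      ∑ μ, Finsupp.single (E.liftWordThree μ (a :: c :: l) : Cycle E.ArrowG) 1 := by
  obtain ⟨-, hac, hwl⟩ := hw
  have hs := hwl.forall_src (P := fun v => S.Fixed v) hat hl
  have hcs : S.Fixed (S.Q.src c) := by
    obtain ⟨d, l, rfl⟩ := List.exists_cons_of_ne_nil hl0
    rw [hwl.1]
    exact hl d (by simp)
  have hct : ¬ S.Fixed (S.Q.tgt c) := hac ▸ ha
  have hiff := fun x hx => iff_of_true (hs x hx) (hl x hx)
  unfold traceLift
  rw [sum_idx_of_fixed hat]
  swap
  · intro m hm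
    rw [wordLift, Finset.sum_eq_zero, Finsupp.mapDomain_zero]
    intro m' _
    rw [E.scal_eq_zero_of_ne_tgt hm, zero_smul]
  refine Finset.sum_congr rfl fun μ _ => ?_
  rw [wordLift, sum_idx_of_not_fixed ha]
  swap
  · intro m hm
    rw [E.scal_eq_zero_of_ne_src hm, zero_smul]
  -- The stretch `l` between fixed vertices lowers the index by the sum of its `b`, so the starting
  -- index `μ` determines the index at the source of `c`.
  rw [wordLift, Finset.sum_eq_single
    (⟨(S.Q.src c, μ - (l.map S.b).sum), Or.inl hcs⟩ : S.Idx) _ (by simp)]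
  swap
  · intro m _ hm
    rw [E.wordLift_of_iff hiff]
    by_cases h : m.1.1 = S.Q.src c
    · rw [if_neg fun hh => hm (Idx.ext' h hh.2), Finsupp.mapDomain_zero, smul_zero]
    · rw [E.scal_eq_zero_of_ne_src h, zero_smul]
  rw [E.wordLift_of_iff hiff, if_pos ⟨hwl, rfl⟩]
  have h1 : E.scal a ⟨(S.Q.tgt a, μ), Or.inl hat⟩ ⟨(S.Q.src a, 0), Or.inr rfl⟩ = 1 := by
    unfold scal
    rw [if_pos ⟨rfl, rfl, fun h => absurd h ha⟩, E.deg_of_mem haE]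
    simp
  have h2 : E.scal c ⟨(S.Q.src a, 0), Or.inr rfl⟩
      ⟨(S.Q.src c, μ - (l.map S.b).sum), Or.inl hcs⟩ = 1 := by
    unfold scal
    rw [if_pos ⟨hac, rfl, fun _ h => absurd h hct⟩, ← hac, E.deg_of_mem haE]
    simp
  simp only [h1, h2, one_smul, Finsupp.mapDomain_single]
  simp only [liftWord, liftWordThree, letter, if_neg ha, if_pos hcs]

end Representatives

end CyclicQP
end

/-! ### The potential `W_G` as an averaged trace of `W`, and its cyclic derivatives. -/

noncomputable section

namespace CyclicQP

variable {k V A : Type*} [Field k] {S : CyclicQP k V A}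

theorem exists_isWalk {l : List A} (h : (l : Cycle A) ∈ S.W.support) :
    ∃ a c d r, l = a :: c :: d :: r ∧ IsWalk S.Q l (S.Q.tgt a) (S.Q.tgt a) := by
  obtain ⟨⟨-, hchain⟩, hlen⟩ := S.isPotential _ h
  match l, hlen with
  | a :: c :: d :: r, _ =>
    exact ⟨a, c, d, r, rfl, isWalk_of_isChain _ _ _ _ ((Cycle.chain_coe_cons _ _ _).1 hchain)⟩

theorem zpow_apply_arrow_eq_self {a : A} (ha : ¬ (S.Fixed (S.Q.src a) ∧ S.Fixed (S.Q.tgt a)))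
    {r : ℤ} (h : (S.τ ^ r) a = a) : (S.n : ℤ) ∣ r := by
  rcases not_and_or.1 ha with hs | ht
  · rw [← S.zpow_apply_eq_self_iff hs, ← S.src_τ_zpow, h]
  · rw [← S.zpow_apply_eq_self_iff ht, ← S.tgt_τ_zpow, h]

theorem map_zpow_eq_iff (c : Cycle A) (r s : ℤ) :
    c.map (S.τ ^ r) = c.map (S.τ ^ s) ↔ c.map (S.τ ^ (r - s)) = c := by
  have h1 : c.map (S.τ ^ (r - s)) = (c.map (S.τ ^ r)).map (S.τ ^ (-s)) := by
    rw [← Cycle.map_comp, ← Equiv.Perm.coe_mul, ← zpow_add]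
    congr 3
    ring
  have h2 : (c.map (S.τ ^ s)).map (S.τ ^ (-s)) = c := by
    rw [← Cycle.map_comp, ← Equiv.Perm.coe_mul, ← zpow_add, neg_add_cancel, zpow_zero,
      Equiv.Perm.coe_one, Cycle.map_id']
  have h3 : (c.map (S.τ ^ (r - s))).map (S.τ ^ s) = c.map (S.τ ^ r) := by
    rw [← Cycle.map_comp, ← Equiv.Perm.coe_mul, ← zpow_add]
    congr 3
    ring
  constructor
  · intro h
    rw [h1, h, h2]
  · intro h
    rw [← h3, h]

/-- The orbit of a cycle has `n` elements if the cycle contains a unique arrow with a property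
invariant under `g`, and this arrow has an end which is not fixed. -/
theorem orbitCard_eq_n {c : Cycle A} {x : A} (P : A → Prop)
    (hP : ∀ (r : ℤ) y, P ((S.τ ^ r) y) ↔ P y) (hx : x ∈ c) (hPx : P x)
    (huniq : ∀ y ∈ c, P y → y = x) (hnf : ¬ (S.Fixed (S.Q.src x) ∧ S.Fixed (S.Q.tgt x))) :
    S.orbitCard c = S.n := by
  have hstab : ∀ r : ℤ, c.map (S.τ ^ r) = c → (S.n : ℤ) ∣ r := by
    intro r hr
    refine zpow_apply_arrow_eq_self hnf (huniq _ ?_ ((hP r x).2 hPx))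
    rw [← hr]
    exact Cycle.mem_map.2 ⟨x, hx, rfl⟩
  have hset : {d | ∃ r : ℤ, d = c.map (S.τ ^ r)} =
      (fun z : ZMod S.n => c.map (S.τ ^ (z.val : ℤ))) '' Set.univ := by
    ext d
    constructor
    · rintro ⟨r, rfl⟩
      refine ⟨(r : ZMod S.n), trivial, ?_⟩
      change Cycle.map _ c = _
      rw [S.τ_zpow_of_eq (r := (((r : ZMod S.n)).val : ℤ)) (s := r) (by simp)]
    · rintro ⟨z, -, rfl⟩
      exact ⟨_, rfl⟩
  rw [orbitCard, hset, Set.ncard_image_of_injective, Set.ncard_univ, Nat.card_zmod]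
  intro z w hzw
  have h := hstab _ ((map_zpow_eq_iff c _ _).1 hzw)
  rw [← ZMod.intCast_zmod_eq_zero_iff_dvd] at h
  simpa [sub_eq_zero] using h

theorem coefProd_coe (l : List A) : S.coefProd (l : Cycle A) = S.χ (l.map S.b).sum := by
  change ((l : Multiset A).map S.coef).prod = _
  rw [Multiset.map_coe, Multiset.prod_coe]
  induction l with
  | nil => simp
  | cons a l ih => simp [ih, S.coef_eq_χ, AddChar.map_add_eq_mul]

theorem Cycle.map_eq_self_of_forall {f : A → A} {l : List A} (h : ∀ a ∈ l, f a = a) :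
    (l : Cycle A).map f = l := by
  rw [Cycle.map_coe, (List.map_congr_left h : l.map f = l.map id), List.map_id]

theorem map_zpow_of_fixed {l : List A} (hs : ∀ a ∈ l, S.Fixed (S.Q.src a))
    (ht : ∀ a ∈ l, S.Fixed (S.Q.tgt a)) (r : ℤ) : (l : Cycle A).map (S.τ ^ r) = l :=
  Cycle.map_eq_self_of_forall fun a ha => Equiv.Perm.zpow_apply_eq_self_of_apply_eq_self
    (S.τ_apply_of_fixed (hs a ha) (ht a ha)) r

theorem orbitCard_of_fixed {l : List A} (hs : ∀ a ∈ l, S.Fixed (S.Q.src a))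
    (ht : ∀ a ∈ l, S.Fixed (S.Q.tgt a)) : S.orbitCard (l : Cycle A) = 1 := by
  rw [orbitCard, Set.ncard_eq_one]
  refine ⟨l, ?_⟩
  ext d
  simp [map_zpow_of_fixed hs ht]

/-- The cycle is invariant under `τ` and has a nonzero coefficient in `W`, so invariance of `W`
forces `ζ` to the power of this sum to be `1`. This makes the lifted words close up in type (iv). -/
theorem sum_b_eq_zero_of_fixed {l : List A} (hs : ∀ a ∈ l, S.Fixed (S.Q.src a))
    (ht : ∀ a ∈ l, S.Fixed (S.Q.tgt a)) (hW : (l : Cycle A) ∈ S.W.support) :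
    (l.map S.b).sum = 0 := by
  have h := W_map_τ (S := S) (l : Cycle A)
  have h2 : (l : Cycle A).map S.τ = l := by simpa using map_zpow_of_fixed hs ht 1
  rw [h2, coefProd_coe, eq_comm, mul_eq_left₀ (Finsupp.mem_support_iff.1 hW)] at h
  exact (S.χ_eq_one_iff _).1 h

variable {E : S.Representatives}

/-- The contribution of the word `ĉ` to `W_G` is a multiple of its trace. -/
theorem CrossSection.smul_cycleG [Fintype V] (C : CrossSection E) {l : List A}
    (hl : l ∈ C.words) : E.cycleG l =
      ((S.orbitCard (l : Cycle A) : k) / (S.n : k)) • traceLift E.scal E.letter l := by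
  have hW := C.mem_support l hl
  have hn := S.n_ne_zero
  obtain ⟨a, c, d, r, rfl, hw⟩ := exists_isWalk hW
  have hac : S.Q.src a = S.Q.tgt c := hw.2.1
  have hcd : S.Q.src c = S.Q.tgt d := hw.2.2.1
  have hPt : ∀ (r : ℤ) (y : A), S.Fixed (S.Q.tgt ((S.τ ^ r) y)) ↔ S.Fixed (S.Q.tgt y) :=
    fun r y => by rw [S.tgt_τ_zpow, S.fixed_zpow_iff]
  have htype : S.fixedCount (a :: c :: d :: r) = 0 ∨ S.fixedCount (a :: c :: d :: r) = 1 ∨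
      S.fixedCount (a :: c :: d :: r) + 1 = (a :: c :: d :: r).length ∨
      S.fixedCount (a :: c :: d :: r) = (a :: c :: d :: r).length := by
    have h := S.cycle_type _ hW
    rw [Cycle.coe_toMultiset, Multiset.coe_countP] at h
    have hc : S.fixedCount (a :: c :: d :: r) =
        List.countP (fun b => decide (S.σ (S.Q.tgt b) = S.Q.tgt b)) (a :: c :: d :: r) :=
      List.countP_congr fun x _ =>
        decide_eq_true_iff.trans decide_eq_true_iff.symm
    rw [hc]
    exact h
  have hcount : S.fixedCount (a :: c :: d :: r) = (if S.Fixed (S.Q.tgt a) then 1 else 0) +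
      ((if S.Fixed (S.Q.tgt c) then 1 else 0) + S.fixedCount (d :: r)) := by
    unfold fixedCount
    rw [List.countP_cons, List.countP_cons]
    simp only [decide_eq_true_eq]
    ring
  have hle : S.fixedCount (d :: r) ≤ (d :: r).length := List.countP_le_length
  have hzero : ∀ l : List A, S.fixedCount l = 0 ↔ ∀ x ∈ l, ¬ S.Fixed (S.Q.tgt x) := by
    intro l; simp [fixedCount, List.countP_eq_zero]
  have hall : ∀ l : List A, S.fixedCount l = l.length ↔ ∀ x ∈ l, S.Fixed (S.Q.tgt x) := by
    intro l; simp [fixedCount, List.countP_eq_length]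
  unfold Representatives.cycleG
  split_ifs with h0 h1 h3
  · rw [E.traceLift_type_one hw ((hzero _).1 h0), Finsupp.smul_single, smul_eq_mul, mul_one]
  · obtain ⟨ha, haE⟩ := C.type_two _ hl h1 a rfl
    rw [if_pos (c := S.Fixed (S.Q.tgt c)) (hac ▸ ha), h1] at hcount
    have hat : ¬ S.Fixed (S.Q.tgt a) := fun h => by rw [if_pos h] at hcount; omega
    rw [if_neg hat] at hcount
    have hr := (hzero _).1 (show S.fixedCount (d :: r) = 0 by omega)
    -- In type (ii), `c` is the only arrow ending in a fixed vertex, and its source is not fixed;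
    -- hence the orbit is free and the weight is `1`.
    have horb : S.orbitCard ((a :: c :: d :: r : List A) : Cycle A) = S.n := by
      refine orbitCard_eq_n (x := c) (fun y => S.Fixed (S.Q.tgt y)) hPt (by simp)
        (hac ▸ ha) ?_ fun h => hr d (by simp) (hcd ▸ h.1)
      intro y hy hyt
      rw [Cycle.mem_coe_iff] at hy
      rcases List.mem_cons.1 hy with rfl | hy
      · exact absurd hyt hat
      rcases List.mem_cons.1 hy with rfl | hy
      · rfl
      · exact absurd hyt (hr y hy)
    rw [horb, div_self hn, one_smul, E.traceLift_type_two hw ha hat haE hr (by simp)]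
    rfl
  · obtain ⟨ha, haE⟩ := C.type_three _ hl h3 a rfl
    rw [if_neg (c := S.Fixed (S.Q.tgt c)) (hac ▸ ha)] at hcount
    simp only [List.length_cons] at h3 hle
    have hat : S.Fixed (S.Q.tgt a) := by
      by_contra h
      rw [if_neg h] at hcount
      omega
    rw [if_pos hat] at hcount
    have hr := (hall (d :: r)).1 (by simp only [List.length_cons]; omega)
    -- In type (iii), `c` is the only arrow ending in a non-fixed vertex; again the orbit is free.
    have horb : S.orbitCard ((a :: c :: d :: r : List A) : Cycle A) = S.n := by
      refine orbitCard_eq_n (x := c) (fun y => ¬ S.Fixed (S.Q.tgt y))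
        (fun r y => not_congr (hPt r y)) (by simp) (hac ▸ ha) ?_ fun h => ha (hac ▸ h.2)
      intro y hy hyt
      rw [Cycle.mem_coe_iff] at hy
      rcases List.mem_cons.1 hy with rfl | hy
      · exact absurd hat hyt
      rcases List.mem_cons.1 hy with rfl | hy
      · rfl
      · exact absurd (hr y hy) hyt
    rw [horb, div_self hn, one_smul, E.traceLift_type_three hw ha hat haE hr (by simp)]
  -- In type (iv) the orbit is a point, which accounts for the coefficient `1 / n`.
  · have ht := (hall _).1 (show S.fixedCount (a :: c :: d :: r) = _ by tauto)
    have hs := hw.forall_src (P := fun v => S.Fixed v) (ht a (by simp)) ht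
    rw [orbitCard_of_fixed hs ht, E.traceLift_type_four hw ht (sum_b_eq_zero_of_fixed hs ht hW),
      Finset.smul_sum]
    refine Finset.sum_congr rfl fun μ _ => ?_
    rw [Finsupp.smul_single, smul_eq_mul, mul_one, Nat.cast_one]

/-- The cyclic derivatives of `W_G` in terms of those of `W`. -/
theorem CrossSection.cyclicDerivative_potentialG [Fintype V] [Fintype A] {R : Type*} [Ring R]
    [Algebra k R] (C : CrossSection E) (y : E.ArrowG → R) (β : E.ArrowG) :
    (S.n : k) • cyclicDerivative y β C.potentialG =
      ∑ a, ∑ i, ∑ j, (if E.letter a i j = β then E.scal a i j else 0) •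
        (cyclicDerivative (E.mat y) a S.W) j i := by
  have hlin : ∀ U : Cycle E.ArrowG →₀ k, cyclicDerivative y β U =
      Finsupp.linearCombination k (cycleDerivative y β) U := fun _ => rfl
  have hLHS : (S.n : k) • cyclicDerivative y β C.potentialG =
      ∑ l ∈ C.words, (S.orbitCard (l : Cycle A) : k) • (S.W (l : Cycle A) •
        E.traceDerivative y β (l : Cycle A)) := by
    rw [potentialG, hlin, map_sum, Finset.smul_sum]
    refine Finset.sum_congr rfl fun l hl => ?_
    rw [C.smul_cycleG hl, map_smul, map_smul, ← hlin, cyclicDerivative_traceLift, smul_smul,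
      smul_smul, smul_smul]
    congr 1
    · field_simp [S.n_ne_zero]
    · unfold Representatives.traceDerivative
      congr!
  have hRHS : ∑ a, ∑ i, ∑ j, (if E.letter a i j = β then E.scal a i j else 0) •
      (cyclicDerivative (E.mat y) a S.W) j i =
      ∑ c ∈ S.W.support, S.W c • E.traceDerivative y β c := by
    simp only [cyclicDerivative_eq, Matrix.sum_apply, Matrix.smul_apply, Finset.smul_sum,
      Representatives.traceDerivative]
    symm
    rw [Finset.sum_comm]
    refine Finset.sum_congr rfl fun a _ => ?_
    rw [Finset.sum_comm]
    refine Finset.sum_congr rfl fun i _ => ?_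
    rw [Finset.sum_comm]
    exact Finset.sum_congr rfl fun j _ => Finset.sum_congr rfl fun c _ => smul_comm _ _ _
  rw [hLHS, hRHS]
  -- `f` sends a cycle of `W` to the chosen word of its orbit. The terms are constant on the fibres
  -- of `f`, and the fibres are the orbits.
  choose! f hf using fun c hc => (C.existsUnique c hc).exists
  rw [← Finset.sum_fiberwise_of_maps_to (t := C.words) (g := f) fun c hc => (hf c hc).1]
  refine Finset.sum_congr rfl fun l hl => ?_
  have hfilter : ∀ c ∈ S.W.support.filter (fun c => f c = l), S.W c • E.traceDerivative y β c =
      S.W (l : Cycle A) • E.traceDerivative y β (l : Cycle A) := by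
    intro c hc
    obtain ⟨hc', rfl⟩ := Finset.mem_filter.1 hc
    obtain ⟨r, hr⟩ := (hf c hc').2
    rw [← W_smul_traceDerivative_zpow E y β (C.mem_support _ (hf c hc').1) r, ← hr]
  rw [Finset.sum_congr rfl hfilter, Finset.sum_const, ← Nat.cast_smul_eq_nsmul k]
  congr 2
  rw [orbitCard, ← Set.ncard_coe_finset]
  congr 1
  ext c
  simp only [Set.mem_ofPred_eq, Finset.coe_filter]
  constructor
  · rintro ⟨r, rfl⟩
    have hc := (map_τ_zpow_mem_support_iff (S := S) r (l : Cycle A)).2 (C.mem_support l hl)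
    exact ⟨hc, (C.existsUnique _ hc).unique (hf _ hc) ⟨hl, r, rfl⟩⟩
  · rintro ⟨hc, rfl⟩
    exact (hf c hc).2

end CyclicQP
end

/-! ### From representations of `Q_G` to matrix representations of `Q`. -/

noncomputable section

/-- Since `n` is nonzero in `k`, so is the size of such an orbit. -/
theorem Equiv.Perm.ncard_zpow_orbit_dvd {X : Type*} [Finite X] (π : Equiv.Perm X) {n : ℕ}
    (hn : π ^ n = 1) (x : X) : {w | ∃ r : ℤ, w = (π ^ r) x}.ncard ∣ n := by
  have h2 : {w | ∃ r : ℤ, w = (π ^ r) x} = MulAction.orbit (Subgroup.zpowers π) x := by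
    ext w
    constructor
    · rintro ⟨i, rfl⟩
      exact ⟨⟨π ^ i, i, rfl⟩, rfl⟩
    · rintro ⟨⟨_, i, rfl⟩, rfl⟩
      exact ⟨i, rfl⟩
  have hfin : (MulAction.orbit (Subgroup.zpowers π) x).Finite := Set.toFinite _
  have := hfin.fintype
  rw [h2, ← Nat.card_coe_set_eq, Nat.card_eq_fintype_card,
    ← MulAction.minimalPeriod_eq_card (a := π) (b := x)]
  refine Function.IsPeriodicPt.minimalPeriod_dvd ?_
  change (π • ·)^[n] x = x
  rw [smul_iterate, hn]
  exact one_smul _ _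

namespace CyclicQP

variable {k V A R : Type*} [Field k] {S : CyclicQP k V A} {E : S.Representatives}
  [Ring R] [Algebra k R]

theorem ρ_pow_n : S.ρ ^ S.n = 1 := by
  ext i : 1
  have h := S.ρ_zpow S.n i
  rw [zpow_natCast, zpow_natCast, S.σ_pow_n] at h
  exact Idx.ext' h.1 h.2

/-- The action of `g` on the triples consisting of an arrow and two indices. -/
def tripleAct (S : CyclicQP k V A) : Equiv.Perm (A × S.Idx × S.Idx) :=
  S.τ.prodCongr (S.ρ.prodCongr S.ρ)

theorem tripleAct_zpow (r : ℤ) (x : A × S.Idx × S.Idx) :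
    (S.tripleAct ^ r) x = ((S.τ ^ r) x.1, (S.ρ ^ r) x.2.1, (S.ρ ^ r) x.2.2) := by
  have hinv : ∀ x, S.tripleAct⁻¹ x = (S.τ⁻¹ x.1, S.ρ⁻¹ x.2.1, S.ρ⁻¹ x.2.2) := fun _ => rfl
  have hone : ∀ x, S.tripleAct x = (S.τ x.1, S.ρ x.2.1, S.ρ x.2.2) := fun _ => rfl
  induction r generalizing x with
  | zero => rfl
  | succ i ih => simp only [zpow_add_one, Equiv.Perm.mul_apply, ih, hone]
  | pred i ih => simp only [zpow_sub_one, Equiv.Perm.mul_apply, ih, hinv]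

theorem tripleAct_pow_n : S.tripleAct ^ S.n = 1 := by
  ext x : 1
  have h := tripleAct_zpow (S := S) S.n x
  rw [zpow_natCast, zpow_natCast, zpow_natCast, S.τ_pow_n, ρ_pow_n] at h
  exact h

theorem scal_ne_zero_iff_τ (a : A) (i j : S.Idx) :
    E.scal (S.τ a) (S.ρ i) (S.ρ j) ≠ 0 ↔ E.scal a i j ≠ 0 := by
  have h := E.scal_τ a i j
  have h1 := S.coef_ne_zero a
  have h2 := S.χ_ne_zero (j.1.2 - i.1.2)
  constructor
  · intro h3 h4
    rw [h4, mul_zero] at h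
    exact (mul_ne_zero h1 h3) h
  · intro h3 h4
    rw [h4, mul_zero] at h
    exact (mul_ne_zero h2 h3) h.symm

theorem scal_letter_zpow {β : E.ArrowG} {a : A} {i j : S.Idx}
    (h : E.letter a i j = β ∧ E.scal a i j ≠ 0) (r : ℤ) :
    E.letter ((S.τ ^ r) a) ((S.ρ ^ r) i) ((S.ρ ^ r) j) = β ∧
      E.scal ((S.τ ^ r) a) ((S.ρ ^ r) i) ((S.ρ ^ r) j) ≠ 0 := by
  induction r generalizing a i j with
  | zero => exact h
  | succ m ih =>
    simp only [zpow_add_one, Equiv.Perm.mul_apply]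
    exact ih ⟨by rw [E.letter_τ, h.1], (scal_ne_zero_iff_τ a i j).2 h.2⟩
  | pred m ih =>
    simp only [zpow_sub_one, Equiv.Perm.mul_apply]
    refine ih ⟨?_, ?_⟩
    · rw [← E.letter_τ]; simpa using h.1
    · rw [← scal_ne_zero_iff_τ]; simpa using h.2

variable [Fintype V]

theorem prod_mat_of_isWalk {y : E.ArrowG → R} {l : List A} (hl : l ≠ []) {w v : V}
    (h : IsWalk S.Q l w v) {i j : S.Idx} (hij : ¬ (i.1.1 = w ∧ j.1.1 = v)) :
    (l.map (E.mat y)).prod i j = 0 := by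
  induction l generalizing w i with
  | nil => exact absurd rfl hl
  | cons a l ih =>
    rw [List.map_cons, List.prod_cons, Matrix.mul_apply]
    refine Finset.sum_eq_zero fun m _ => ?_
    by_cases h1 : i.1.1 = S.Q.tgt a
    · by_cases h2 : m.1.1 = S.Q.src a
      · by_cases hl' : l = []
        · subst hl'
          have h3 : S.Q.src a = v := h.2
          have h4 : m ≠ j := by
            rintro rfl
            exact hij ⟨h1.trans h.1.symm, h2.trans h3⟩
          simp [Matrix.one_apply_ne h4]
        · rw [ih hl' h.2 fun hh => hij ⟨h1.trans h.1.symm, hh.2⟩, mul_zero]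
      · rw [mat_apply, E.scal_eq_zero_of_ne_src h2, zero_smul, zero_mul]
    · rw [mat_apply, E.scal_eq_zero_of_ne_tgt h1, zero_smul, zero_mul]

theorem cyclicDerivative_mat_apply_eq_zero (y : E.ArrowG → R) {a : A} {i j : S.Idx}
    (hij : ¬ (i.1.1 = S.Q.src a ∧ j.1.1 = S.Q.tgt a)) :
    cyclicDerivative (E.mat y) a S.W i j = 0 := by
  rw [cyclicDerivative_eq, Matrix.sum_apply]
  refine Finset.sum_eq_zero fun c hc => ?_
  rw [Matrix.smul_apply]
  suffices h : cycleDerivative (E.mat y) a c i j = 0 by rw [h, smul_zero]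
  refine Multiset.sum_induction (fun M : Matrix S.Idx S.Idx R => M i j = 0) _
    (fun M N hM hN => by simp [hM, hN]) rfl fun M hM => ?_
  obtain ⟨l, hl, rfl⟩ := Multiset.mem_map.1 hM
  split_ifs with hhead
  · obtain rfl := Cycle.mem_lists_iff_coe_eq.1 hl
    obtain ⟨a', c, d, r, rfl, hw⟩ := exists_isWalk hc
    obtain rfl : a' = a := by simpa using hhead
    exact prod_mat_of_isWalk (by simp) hw.2 hij
  · rfl

/-- The phases of `scal_τ` and `gauge` are mutually inverse, so the summands of
`cyclicDerivative_potentialG` are constant along `G`-orbits of triples. -/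
theorem scal_smul_cyclicDerivative (y : E.ArrowG → R) (a : A) (i j : S.Idx) :
    E.scal (S.τ a) (S.ρ i) (S.ρ j) • cyclicDerivative (E.mat y) (S.τ a) S.W (S.ρ j) (S.ρ i) =
      E.scal a i j • cyclicDerivative (E.mat y) a S.W j i := by
  have h1 := congrFun (congrFun (gauge_cyclicDerivative E y a) j) i
  rw [Matrix.smul_apply, gauge_apply] at h1
  apply smul_right_injective R (S.coef_ne_zero a)
  change S.coef a • (_ • _) = S.coef a • (_ • _)
  rw [smul_comm (S.coef a) (E.scal a i j), h1, smul_smul, E.scal_τ, smul_smul, mul_comm]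

theorem scal_smul_cyclicDerivative_zpow (y : E.ArrowG → R) (a : A) (i j : S.Idx) (r : ℤ) :
    E.scal ((S.τ ^ r) a) ((S.ρ ^ r) i) ((S.ρ ^ r) j) •
      cyclicDerivative (E.mat y) ((S.τ ^ r) a) S.W ((S.ρ ^ r) j) ((S.ρ ^ r) i) =
      E.scal a i j • cyclicDerivative (E.mat y) a S.W j i := by
  induction r generalizing a i j with
  | zero => rfl
  | succ m ih =>
    simp only [zpow_add_one, Equiv.Perm.mul_apply, ih]
    exact scal_smul_cyclicDerivative y a i j
  | pred m ih =>
    simp only [zpow_sub_one, Equiv.Perm.mul_apply, ih]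
    rw [← scal_smul_cyclicDerivative]
    simp

variable [Fintype A]

/-- If the cyclic derivatives of `W_G` vanish on `y`, then the cyclic derivatives of `W` vanish on
the matrices built from `y`. -/
theorem CrossSection.cyclicDerivative_mat_eq_zero (C : CrossSection E) {y : E.ArrowG → R}
    (hy : ∀ β, cyclicDerivative y β C.potentialG = 0) (a : A) :
    cyclicDerivative (E.mat y) a S.W = 0 := by
  ext j i
  rw [Matrix.zero_apply]
  by_cases h1 : j.1.1 = S.Q.src a ∧ i.1.1 = S.Q.tgt a
  swap
  · exact cyclicDerivative_mat_apply_eq_zero y h1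
  by_cases h2 : E.scal a i j = 0
  -- The remaining entries with `scal` zero lie between fixed vertices with incompatible indices.
  -- Such an entry is seen by no derivative of `W_G`, but equivariance multiplies it by two
  -- different values of `χ`, so it vanishes.
  · have h3 : ¬ (S.Fixed (S.Q.src a) → S.Fixed (S.Q.tgt a) → i.1.2 = j.1.2 - S.b a) := by
      intro h4
      unfold Representatives.scal at h2
      rw [if_pos ⟨h1.2, h1.1, h4⟩] at h2
      exact S.χ_ne_zero _ h2
    push Not at h3
    obtain ⟨hs, ht, hne⟩ := h3
    have h4 := congrFun (congrFun (gauge_cyclicDerivative E y a) j) i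
    rw [Matrix.smul_apply, gauge_apply, S.τ_apply_of_fixed hs ht, ρ_of_fixed (h1.1 ▸ hs),
      ρ_of_fixed (h1.2 ▸ ht), S.coef_eq_χ, ← sub_eq_zero, ← sub_smul] at h4
    refine (smul_eq_zero.1 h4).resolve_left fun h5 => hne ?_
    have h6 : S.χ (S.b a - (j.1.2 - i.1.2)) = 1 := by
      rw [sub_eq_zero] at h5
      rw [sub_eq_add_neg, AddChar.map_add_eq_mul, h5, ← AddChar.map_add_eq_mul]
      simp
    have h7 := (S.χ_eq_one_iff _).1 h6
    rw [sub_eq_zero] at h7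
    rw [h7]; ring
  · have h3 := C.cyclicDerivative_potentialG y (E.letter a i j)
    rw [hy, smul_zero] at h3
    -- The entries with the letter of `(a, i, j)` form one orbit of `tripleAct`; the vanishing sum
    -- over it is its size times a single summand.
    set F : Finset (A × S.Idx × S.Idx) := Finset.univ.filter fun x =>
      E.letter x.1 x.2.1 x.2.2 = E.letter a i j ∧ E.scal x.1 x.2.1 x.2.2 ≠ 0 with hF
    have h4 : ∑ x ∈ F, E.scal x.1 x.2.1 x.2.2 •
        cyclicDerivative (E.mat y) x.1 S.W x.2.2 x.2.1 = 0 := by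
      rw [h3, hF, Finset.sum_filter, Fintype.sum_prod_type]
      refine Finset.sum_congr rfl fun a' _ => ?_
      rw [Fintype.sum_prod_type]
      refine Finset.sum_congr rfl fun i' _ => Finset.sum_congr rfl fun j' _ => ?_
      by_cases h : E.letter a' i' j' = E.letter a i j
      · by_cases h' : E.scal a' i' j' = 0 <;> simp [h, h']
      · simp [h]
    have hmem : ∀ x ∈ F, ∃ r : ℤ, x = (S.tripleAct ^ r) (a, i, j) := by
      rintro ⟨a', i', j'⟩ hx
      obtain ⟨-, hx1, hx2⟩ := Finset.mem_filter.1 hx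
      obtain ⟨r, h5, h6, h7⟩ := E.exists_zpow_of_letter_eq h2 hx2 hx1.symm
      exact ⟨r, by rw [tripleAct_zpow, ← h5, ← h6, ← h7]⟩
    have h5 : ∀ x ∈ F, E.scal x.1 x.2.1 x.2.2 •
        cyclicDerivative (E.mat y) x.1 S.W x.2.2 x.2.1 =
        E.scal a i j • cyclicDerivative (E.mat y) a S.W j i := by
      intro x hx
      obtain ⟨r, rfl⟩ := hmem x hx
      rw [tripleAct_zpow]
      exact scal_smul_cyclicDerivative_zpow y a i j r
    have hcard : (F.card : k) ≠ 0 := by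
      have hset : (F : Set (A × S.Idx × S.Idx)) = {w | ∃ r : ℤ, w = (S.tripleAct ^ r) (a, i, j)} := by
        ext x
        refine ⟨hmem x, ?_⟩
        rintro ⟨r, rfl⟩
        rw [tripleAct_zpow]
        exact Finset.mem_filter.2 ⟨Finset.mem_univ _, scal_letter_zpow ⟨rfl, h2⟩ r⟩
      obtain ⟨m, hm⟩ := Equiv.Perm.ncard_zpow_orbit_dvd S.tripleAct tripleAct_pow_n (a, i, j)
      rw [← hset, Set.ncard_coe_finset] at hm
      intro h0
      apply S.n_ne_zero
      rw [hm, Nat.cast_mul, h0, zero_mul]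
    rw [Finset.sum_congr rfl h5, Finset.sum_const, ← Nat.cast_smul_eq_nsmul k, smul_smul] at h4
    exact (smul_eq_zero.1 h4).resolve_left (mul_ne_zero hcard h2)

/-- The representation of `Q` by matrices over `R` given by a representation of `Q_G` in `R`. -/
def matRep (M : E.quiverG.Rep R) : S.Q.Rep (Matrix S.Idx S.Idx R) where
  E v := Matrix.diagonal fun i => if i.1.1 = v then M.E (E.η i) else 0
  X := E.mat M.X
  E_mul v w := by
    rw [Matrix.diagonal_mul_diagonal]
    split_ifs with h
    · subst h
      congr 1
      funext i
      split_ifs <;> simp [M.E_mul]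
    · rw [Matrix.diagonal_eq_zero]
      funext i
      by_cases h1 : i.1.1 = v
      · have h2 : i.1.1 ≠ w := fun h2 => h (h1.symm.trans h2)
        simp [h2]
      · simp [h1]
  E_tgt a := by
    ext i j
    rw [Matrix.diagonal_mul, mat_apply]
    by_cases h : E.scal a i j = 0
    · rw [h, zero_smul, mul_zero]
    · rw [if_pos (ite_ne_right_iff.1 h).1.1, mul_smul_comm, ← E.tgt_letter h, M.E_tgt]
  E_src a := by
    ext i j
    rw [Matrix.mul_diagonal, mat_apply]
    by_cases h : E.scal a i j = 0
    · rw [h, zero_smul, zero_mul]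
    · rw [if_pos (ite_ne_right_iff.1 h).1.2.1, smul_mul_assoc, ← E.src_letter h, M.E_src]

end CyclicQP
end

/-! ### From equivariant representations of `Q` to representations of `Q_G`. -/

noncomputable section

namespace CyclicQP

/-- A representation of `Q` together with invertible elements `U r`, `r ∈ ℤ/n`, implementing the
action of `G`: for instance, the representation of `Q` in the skew group algebra of `Λ`. -/
structure EquivRep {k V A : Type*} [Field k] [Fintype V] (S : CyclicQP k V A) (R : Type*) [Ring R]
    [Algebra k R] extends S.Q.Rep R where
  U : ZMod S.n → R
  U_zero : U 0 = 1
  U_add : ∀ r s, U (r + s) = U r * U s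
  U_E : ∀ v, U 1 * E v = E (S.σ v) * U 1
  U_X : ∀ a, U 1 * X a = S.coef a • (X (S.τ a) * U 1)
  sum_E : ∑ v, E v = 1

variable {k V A R : Type*} [Field k] {S : CyclicQP k V A} (E : S.Representatives)
  [Ring R] [Algebra k R] [Fintype V]

namespace EquivRep

variable (N : S.EquivRep R)

theorem U_natCast_E (m : ℕ) (v : V) :
    N.U (m : ZMod S.n) * N.E v = N.E ((S.σ ^ m) v) * N.U (m : ZMod S.n) := by
  induction m generalizing v with
  | zero => simp [N.U_zero]
  | succ m ih =>
    rw [Nat.cast_succ, N.U_add, mul_assoc, N.U_E, ← mul_assoc, ih, mul_assoc, pow_succ]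
    rfl

theorem U_intCast_E (r : ℤ) (v : V) :
    N.U (r : ZMod S.n) * N.E v = N.E ((S.σ ^ r) v) * N.U (r : ZMod S.n) := by
  have h : ((((r : ZMod S.n).val : ℕ) : ℤ) : ZMod S.n) = r := by simp
  rw [← S.σ_zpow_of_eq h, zpow_natCast]
  have h2 := N.U_natCast_E (r : ZMod S.n).val v
  rwa [ZMod.natCast_zmod_val] at h2

theorem U_E_of_fixed {v : V} (hv : S.Fixed v) (r : ZMod S.n) : N.U r * N.E v = N.E v * N.U r := by
  have h := N.U_intCast_E (r.val : ℤ) v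
  rw [hv.zpow_apply] at h
  simpa using h

theorem U_X_exists (r : ZMod S.n) (a : A) :
    ∃ (c : k) (a' : A), N.U r * N.X a = c • (N.X a' * N.U r) := by
  suffices h : ∀ (m : ℕ) (a : A), ∃ (c : k) (a' : A),
      N.U (m : ZMod S.n) * N.X a = c • (N.X a' * N.U (m : ZMod S.n)) by
    simpa using h r.val a
  intro m
  induction m with
  | zero => exact fun a => ⟨1, a, by simp [N.U_zero]⟩
  | succ m ih =>
    intro a
    obtain ⟨c, a', h⟩ := ih (S.τ a)
    refine ⟨S.coef a * c, a', ?_⟩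
    rw [Nat.cast_succ, N.U_add, mul_assoc, N.U_X, mul_smul_comm, ← mul_assoc, h, smul_mul_assoc,
      smul_smul, mul_assoc]

theorem U_X_of_fixed {a : A} (hs : S.Fixed (S.Q.src a)) (ht : S.Fixed (S.Q.tgt a))
    (r : ZMod S.n) : N.U r * N.X a = S.χ (r * S.b a) • (N.X a * N.U r) := by
  suffices h : ∀ m : ℕ, N.U (m : ZMod S.n) * N.X a =
      S.χ (m * S.b a) • (N.X a * N.U (m : ZMod S.n)) by
    simpa using h r.val
  intro m
  induction m with
  | zero => simp [N.U_zero]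
  | succ m ih =>
    rw [Nat.cast_succ, N.U_add, mul_assoc, N.U_X, S.τ_apply_of_fixed hs ht, mul_smul_comm,
      ← mul_assoc, ih, smul_mul_assoc, smul_smul, mul_assoc, S.coef_eq_χ,
      ← AddChar.map_add_eq_mul]
    congr 2
    ring

/-- The idempotent `(1 / n) ∑ ζ^{r μ} g^r`. -/
def e (μ : ZMod S.n) : R := (S.n : k)⁻¹ • ∑ r, S.χ (r * μ) • N.U r

theorem U_mul_e (s μ : ZMod S.n) : N.U s * N.e μ = S.χ (-(s * μ)) • N.e μ := by
  have h : N.U s * ∑ r, S.χ (r * μ) • N.U r =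
      S.χ (-(s * μ)) • ∑ r, S.χ (r * μ) • N.U r := by
    rw [Finset.mul_sum, Finset.smul_sum,
      ← Equiv.sum_comp (Equiv.addLeft s) fun r => S.χ (-(s * μ)) • S.χ (r * μ) • N.U r]
    refine Finset.sum_congr rfl fun r _ => ?_
    rw [Equiv.coe_addLeft, mul_smul_comm, N.U_add, smul_smul, ← AddChar.map_add_eq_mul]
    congr 2
    ring
  rw [e, mul_smul_comm, h, smul_comm]

theorem e_mul_U (s μ : ZMod S.n) : N.e μ * N.U s = S.χ (-(s * μ)) • N.e μ := by
  rw [← U_mul_e, e, mul_smul_comm, smul_mul_assoc, Finset.mul_sum, Finset.sum_mul]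
  congr 1
  refine Finset.sum_congr rfl fun r _ => ?_
  rw [mul_smul_comm, smul_mul_assoc, ← N.U_add, ← N.U_add, add_comm]

theorem e_mul_e (μ ν : ZMod S.n) : N.e μ * N.e ν = if μ = ν then N.e μ else 0 := by
  have h : N.e μ * N.e ν = (S.n : k)⁻¹ • (∑ r, S.χ (r * (μ - ν))) • N.e ν := by
    conv_lhs => rw [e]
    rw [smul_mul_assoc, Finset.sum_mul, Finset.sum_smul]
    congr 1
    refine Finset.sum_congr rfl fun r _ => ?_
    rw [smul_mul_assoc, N.U_mul_e, smul_smul, ← AddChar.map_add_eq_mul]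
    congr 2
    ring
  rw [h, S.sum_χ_mul]
  simp only [sub_eq_zero]
  split_ifs with hμ
  · rw [hμ, smul_smul, inv_mul_cancel₀ S.n_ne_zero, one_smul]
  · rw [zero_smul, smul_zero]

theorem sum_e : ∑ μ, N.e μ = 1 := by
  have h : ∑ μ, N.e μ = (S.n : k)⁻¹ • ∑ r, (∑ μ, S.χ (μ * r)) • N.U r := by
    simp only [e]
    rw [← Finset.smul_sum, Finset.sum_comm]
    congr 1
    refine Finset.sum_congr rfl fun r _ => ?_
    rw [Finset.sum_smul]
    exact Finset.sum_congr rfl fun μ _ => by rw [mul_comm]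
  rw [h]
  simp only [S.sum_χ_mul, ite_smul, zero_smul, Finset.sum_ite_eq', Finset.mem_univ, if_true,
    N.U_zero]
  rw [smul_smul, inv_mul_cancel₀ S.n_ne_zero, one_smul]

theorem e_mul_E {v : V} (hv : S.Fixed v) (μ : ZMod S.n) : N.e μ * N.E v = N.E v * N.e μ := by
  rw [e, smul_mul_assoc, mul_smul_comm, Finset.sum_mul, Finset.mul_sum]
  congr 1
  refine Finset.sum_congr rfl fun r _ => ?_
  rw [smul_mul_assoc, mul_smul_comm, N.U_E_of_fixed hv]

/-- Moving `g^r` past `a` costs `ζ^{r b(a)}`, which changes the character. This is why `α̃^μ` leads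
from the index `μ` to `μ - b(α)`. -/
theorem e_mul_X {a : A} (hs : S.Fixed (S.Q.src a)) (ht : S.Fixed (S.Q.tgt a)) (μ : ZMod S.n) :
    N.e μ * N.X a = N.X a * N.e (μ + S.b a) := by
  rw [e, e, smul_mul_assoc, mul_smul_comm, Finset.sum_mul, Finset.mul_sum]
  congr 1
  refine Finset.sum_congr rfl fun r _ => ?_
  rw [smul_mul_assoc, mul_smul_comm, N.U_X_of_fixed hs ht, smul_smul, ← AddChar.map_add_eq_mul]
  congr 2
  ring

/-- The map from the summand with index `i` to the corresponding vertex of `Q_G`. -/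
def proj (i : S.Idx) : R :=
  if S.Fixed i.1.1 then N.E i.1.1 * N.e i.1.2 else N.U (-E.deg i.1.1) * N.E i.1.1

/-- The map to the summand with index `i` from the corresponding vertex of `Q_G`. -/
def incl (i : S.Idx) : R :=
  if S.Fixed i.1.1 then N.E i.1.1 * N.e i.1.2 else N.E i.1.1 * N.U (E.deg i.1.1)

theorem proj_mul_E (i : S.Idx) (v : V) :
    N.proj E i * N.E v = if i.1.1 = v then N.proj E i else 0 := by
  unfold proj
  split_ifs with h1 h2 h2
  · rw [mul_assoc, N.e_mul_E (h2 ▸ h1), ← mul_assoc, N.E_mul, if_pos h2]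
  · by_cases hv : S.Fixed v
    · rw [mul_assoc, N.e_mul_E hv, ← mul_assoc, N.E_mul, if_neg h2, zero_mul]
    · rw [← N.e_mul_E h1, mul_assoc, N.E_mul, if_neg h2, mul_zero]
  · rw [mul_assoc, N.E_mul, if_pos h2]
  · rw [mul_assoc, N.E_mul, if_neg h2, mul_zero]

theorem E_mul_incl (i : S.Idx) (v : V) :
    N.E v * N.incl E i = if i.1.1 = v then N.incl E i else 0 := by
  unfold incl
  split_ifs with h1 h2 h2
  · rw [← mul_assoc, N.E_mul, if_pos h2.symm, h2]
  · rw [← mul_assoc, N.E_mul, if_neg (Ne.symm h2), zero_mul]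
  · rw [← mul_assoc, N.E_mul, if_pos h2.symm, h2]
  · rw [← mul_assoc, N.E_mul, if_neg (Ne.symm h2), zero_mul]

theorem proj_ρ_mul_U (i : S.Idx) :
    N.proj E (S.ρ i) * N.U 1 = S.χ (-i.1.2) • N.proj E i := by
  unfold proj
  simp only [ρ_fst, ρ_snd, S.fixed_σ_iff]
  split_ifs with h
  · rw [mul_assoc, N.e_mul_U, mul_smul_comm, one_mul, h]
  · rw [Idx.snd_eq_zero h, neg_zero, AddChar.map_zero_eq_one, one_smul, mul_assoc, ← N.U_E,
      ← mul_assoc, ← N.U_add, E.deg_σ h]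
    congr 2
    ring

theorem U_mul_incl (i : S.Idx) :
    N.U 1 * N.incl E i = S.χ (-i.1.2) • N.incl E (S.ρ i) := by
  unfold incl
  simp only [ρ_fst, ρ_snd, S.fixed_σ_iff]
  split_ifs with h
  · rw [← mul_assoc, N.U_E_of_fixed h, mul_assoc, N.U_mul_e, mul_smul_comm, one_mul, h]
  · rw [Idx.snd_eq_zero h, neg_zero, AddChar.map_zero_eq_one, one_smul, ← mul_assoc, N.U_E,
      mul_assoc, ← N.U_add, E.deg_σ h, add_comm]

/-- A fixed vertex is split by the idempotents `e μ`, and a non-fixed one is transported to its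
representative and back. Together with `proj_mul_incl` this shows that the corner at the vertices of
`Q_G` is full, and it makes `toMat` multiplicative. -/
theorem sum_incl_mul_proj : ∑ i, N.incl E i * N.proj E i = 1 := by
  have h : ∀ v, ∑ i, N.incl E i * N.proj E i * N.E v = N.E v := by
    intro v
    have h0 : ∀ m : S.Idx, m.1.1 ≠ v → N.incl E m * N.proj E m * N.E v = 0 := fun m hm => by
      rw [mul_assoc, N.proj_mul_E, if_neg hm, mul_zero]
    by_cases hv : S.Fixed v
    · rw [sum_idx_of_fixed hv _ h0]
      simp only [incl, proj, if_pos hv]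
      have h1 : ∀ μ, N.E v * N.e μ * (N.E v * N.e μ) * N.E v = N.E v * N.e μ := by
        intro μ
        have hE : N.E v * N.E v = N.E v := by rw [N.E_mul, if_pos rfl]
        have he : N.e μ * N.e μ = N.e μ := by rw [N.e_mul_e, if_pos rfl]
        rw [← N.e_mul_E hv, mul_assoc (N.e μ * N.E v), mul_assoc (N.e μ) (N.E v) (N.E v), hE,
          N.e_mul_E hv, mul_assoc, ← mul_assoc (N.e μ), N.e_mul_E hv, mul_assoc, he, ← mul_assoc,
          hE]
      rw [Finset.sum_congr rfl fun μ _ => h1 μ, ← Finset.mul_sum, N.sum_e, mul_one]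
    · rw [sum_idx_of_not_fixed hv _ h0]
      simp only [incl, proj, if_neg hv]
      rw [mul_assoc, mul_assoc, mul_assoc, N.E_mul, if_pos rfl, ← mul_assoc (N.U _), ← N.U_add,
        add_neg_cancel, N.U_zero, one_mul, N.E_mul, if_pos rfl]
  rw [← mul_one (∑ i, _), ← N.sum_E, Finset.mul_sum]
  refine Finset.sum_congr rfl fun v _ => ?_
  rw [Finset.sum_mul, h]

/-- The idempotent corresponding to a vertex of `Q_G`. -/
def idemG : E.VertG → R :=
  Sum.elim (fun v => N.E v.1) fun p => N.E p.1.1 * N.e p.2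

theorem proj_mul_incl (i j : S.Idx) :
    N.proj E i * N.incl E j = if i = j then N.idemG E (E.η i) else 0 := by
  by_cases h : i.1.1 = j.1.1
  · by_cases hi : S.Fixed i.1.1
    · have hj : S.Fixed j.1.1 := h ▸ hi
      have hrep : E.vertRep i.1.1 = i.1.1 := E.vertRep_of_mem (E.mem_of_fixed hi)
      have hη : N.idemG E (E.η i) = N.E i.1.1 * N.e i.1.2 := by
        unfold Representatives.η Representatives.vertG
        rw [dif_pos (hrep.symm ▸ hi)]
        change N.E (E.vertRep i.1.1) * N.e i.1.2 = _
        rw [hrep]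
      rw [proj, incl, if_pos hi, if_pos hj, ← h, mul_assoc, ← mul_assoc (N.e _), N.e_mul_E hi,
        mul_assoc, N.e_mul_e, ← mul_assoc, N.E_mul, if_pos rfl, hη]
      by_cases h2 : i.1.2 = j.1.2
      · rw [if_pos h2, if_pos (Idx.ext' h h2)]
      · rw [if_neg h2, if_neg fun hh => h2 (congrArg (fun m : S.Idx => m.1.2) hh), mul_zero]
    · have hj : ¬ S.Fixed j.1.1 := h ▸ hi
      have hij : i = j := Idx.ext' h (by rw [Idx.snd_eq_zero hi, Idx.snd_eq_zero hj])
      subst hij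
      have hη : N.idemG E (E.η i) = N.E (E.vertRep i.1.1) := by
        unfold Representatives.η Representatives.vertG
        rw [dif_neg (mt (E.fixed_vertRep_iff _).1 hi)]
        rfl
      obtain ⟨r, hr⟩ := E.exists_zpow_vertRep i.1.1
      rw [if_pos rfl, hη, proj, incl, if_neg hi, if_neg hi, mul_assoc, ← mul_assoc (N.E _),
        N.E_mul, if_pos rfl, E.deg_eq hi hr]
      conv_lhs => rw [← hr]
      rw [← N.U_intCast_E, ← mul_assoc, ← N.U_add, neg_add_cancel, N.U_zero, one_mul]
  · rw [if_neg fun hh => h (congrArg (fun m : S.Idx => m.1.1) hh)]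
    have h1 := N.proj_mul_E E i i.1.1
    have h2 := N.E_mul_incl E j i.1.1
    rw [if_pos rfl] at h1
    rw [if_neg (Ne.symm h)] at h2
    rw [← h1, mul_assoc, h2, mul_zero]

theorem idemG_mul_proj (i : S.Idx) : N.idemG E (E.η i) * N.proj E i = N.proj E i := by
  have h := N.sum_incl_mul_proj E
  have h2 := congrArg (N.proj E i * ·) h
  simp only [Finset.mul_sum, mul_one, ← mul_assoc, N.proj_mul_incl, ite_mul, zero_mul,
    Finset.sum_ite_eq, Finset.mem_univ, if_true] at h2
  exact h2

theorem incl_mul_idemG (i : S.Idx) : N.incl E i * N.idemG E (E.η i) = N.incl E i := by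
  have h := N.sum_incl_mul_proj E
  have h2 := congrArg (· * N.incl E i) h
  simp only [Finset.sum_mul, one_mul, mul_assoc, N.proj_mul_incl, mul_ite, mul_zero,
    Finset.sum_ite_eq', Finset.mem_univ, if_true] at h2
  exact h2

end EquivRep

namespace Representatives

/-- The index of a vertex of `Q_G`. -/
def idx : E.VertG → S.Idx :=
  Sum.elim (fun v => ⟨(v.1, 0), Or.inr rfl⟩) fun p => ⟨(p.1.1, p.2), Or.inl p.1.2.2⟩

/-- The arrow of `Q` from which an arrow of `Q_G` is constructed. -/
def under : E.ArrowG → A := Sum.elim (fun a => a.1) fun p => p.1.1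

/-- The index of the source of the arrow `under β`. -/
def srcIdx (β : E.ArrowG) : S.Idx :=
  if h : S.Fixed (S.Q.src (E.under β)) then
    ⟨(S.Q.src (E.under β), Sum.elim (fun _ => 0) (fun p => p.2) β), Or.inl h⟩
  else ⟨(S.Q.src (E.under β), 0), Or.inr rfl⟩

/-- The index of the target of the arrow `under β`. -/
def tgtIdx (β : E.ArrowG) : S.Idx :=
  if h : S.Fixed (S.Q.tgt (E.under β)) then
    ⟨(S.Q.tgt (E.under β), Sum.elim (fun _ => 0) (fun p => p.2) β - S.b (E.under β)), Or.inl h⟩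
  else ⟨(S.Q.tgt (E.under β), 0), Or.inr rfl⟩

theorem under_typed (β : E.ArrowG) : E.IsTyped (E.under β) := by
  rcases β with β | β
  · exact β.2.1
  · exact β.1.2.1

theorem tilde_under (β : E.ArrowG) :
    E.tilde (E.under β) (Sum.elim (fun _ => 0) (fun p => p.2) β) = β := by
  have h := E.arrowRep_of_typed (E.under_typed β)
  unfold tilde
  simp only [h]
  rcases β with β | β
  · rw [dif_pos (show E.IsTypeOne (E.under (Sum.inl β)) from β.2)]; rfl
  · rw [dif_neg (show ¬ E.IsTypeOne (E.under (Sum.inr β)) from β.1.2.2)]; rfl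

theorem srcIdx_fst (β : E.ArrowG) : (E.srcIdx β).1.1 = S.Q.src (E.under β) := by
  unfold srcIdx; split_ifs <;> rfl

theorem tgtIdx_fst (β : E.ArrowG) : (E.tgtIdx β).1.1 = S.Q.tgt (E.under β) := by
  unfold tgtIdx; split_ifs <;> rfl

theorem letter_under (β : E.ArrowG) : E.letter (E.under β) (E.tgtIdx β) (E.srcIdx β) = β := by
  conv_rhs => rw [← E.tilde_under β]
  unfold letter
  by_cases hs : S.Fixed (S.Q.src (E.under β))
  · rw [if_pos hs, srcIdx, dif_pos hs]
  · rw [if_neg hs]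
    by_cases ht : S.Fixed (S.Q.tgt (E.under β))
    · have hb := S.b_of_not_fixed (a := E.under β) (by tauto)
      rw [tgtIdx, dif_pos ht]
      change E.tilde _ (_ - S.b (E.under β)) = _
      rw [hb, sub_zero]
    · have h : E.IsTypeOne (E.under β) := ⟨E.under_typed β, hs, ht⟩
      have h2 : E.IsTypeOne (E.arrowRep (E.under β)) := by
        rwa [E.arrowRep_of_typed (E.under_typed β)]
      rw [tilde, dif_pos h2, tilde, dif_pos h2]

/-- A typed arrow ends in `𝓔`, in degree zero. Its source has degree zero too if the target is
fixed; otherwise the source degree is multiplied by the zero index of the target. -/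
theorem scal_under (β : E.ArrowG) : E.scal (E.under β) (E.tgtIdx β) (E.srcIdx β) = 1 := by
  unfold scal
  have htyped := E.under_typed β
  have h3 : S.Fixed (S.Q.src (E.under β)) → S.Fixed (S.Q.tgt (E.under β)) →
      (E.tgtIdx β).1.2 = (E.srcIdx β).1.2 - S.b (E.under β) := fun hs ht => by
    rw [tgtIdx, dif_pos ht, srcIdx, dif_pos hs]
  rw [if_pos ⟨E.tgtIdx_fst β, E.srcIdx_fst β, h3⟩, E.deg_of_mem htyped.1]
  by_cases ht : S.Fixed (S.Q.tgt (E.under β))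
  · rw [E.deg_of_mem (htyped.2 ht)]; simp
  · rw [tgtIdx, dif_neg ht]; simp

theorem under_letter {a : A} (ha : E.IsTyped a) {i j : S.Idx} (h : E.scal a i j ≠ 0) :
    E.under (E.letter a i j) = a ∧ E.tgtIdx (E.letter a i j) = i ∧
      E.srcIdx (E.letter a i j) = j := by
  have hu : E.under (E.letter a i j) = a := by
    have := E.arrowRep_of_typed ha
    unfold letter tilde
    split_ifs <;> exact this
  have h1 : E.scal (E.under (E.letter a i j)) (E.tgtIdx (E.letter a i j))
      (E.srcIdx (E.letter a i j)) ≠ 0 := by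
    rw [E.scal_under]; exact one_ne_zero
  obtain ⟨r, hr, hi, hj⟩ := E.exists_zpow_of_letter_eq h h1 (E.letter_under _).symm
  refine ⟨hu, ?_, ?_⟩
  · have hfst := E.tgtIdx_fst (E.letter a i j)
    rw [hu] at hfst
    refine Idx.ext' (hfst.trans (ite_ne_right_iff.1 h).1.1.symm) ?_
    rw [hi, (S.ρ_zpow r i).2]
  · have hfst := E.srcIdx_fst (E.letter a i j)
    rw [hu] at hfst
    refine Idx.ext' (hfst.trans (ite_ne_right_iff.1 h).1.2.1.symm) ?_
    rw [hj, (S.ρ_zpow r j).2]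

theorem scal_eq_one_of_typed {a : A} (ha : E.IsTyped a) {i j : S.Idx} (h : E.scal a i j ≠ 0) :
    E.scal a i j = 1 := by
  obtain ⟨h1, h2, h3⟩ := E.under_letter ha h
  have h4 := E.scal_under (E.letter a i j)
  rwa [h1, h2, h3] at h4

end Representatives

namespace EquivRep

variable (N : S.EquivRep R)

/-- The element corresponding to an arrow of `Q_G`. -/
def arrG (β : E.ArrowG) : R :=
  N.proj E (E.tgtIdx β) * N.X (E.under β) * N.incl E (E.srcIdx β)

theorem proj_mul_X_mul_incl_τ (a : A) (i j : S.Idx) :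
    S.coef a • (N.proj E (S.ρ i) * N.X (S.τ a) * N.incl E (S.ρ j)) =
      S.χ (j.1.2 - i.1.2) • (N.proj E i * N.X a * N.incl E j) := by
  have h1 : N.incl E (S.ρ j) = S.χ j.1.2 • (N.U 1 * N.incl E j) := by
    rw [N.U_mul_incl, smul_smul, ← AddChar.map_add_eq_mul]; simp
  have h2 : S.coef a • (N.proj E (S.ρ i) * N.X (S.τ a) * (N.U 1 * N.incl E j)) =
      N.proj E (S.ρ i) * (S.coef a • (N.X (S.τ a) * N.U 1)) * N.incl E j := by
    simp only [mul_smul_comm, smul_mul_assoc, mul_assoc]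
  rw [h1, mul_smul_comm, smul_comm, h2, ← N.U_X, ← mul_assoc, N.proj_ρ_mul_U, smul_mul_assoc,
    smul_mul_assoc, smul_smul, ← AddChar.map_add_eq_mul, sub_eq_add_neg]

/-- Both sides obey the same transformation rule along `τ`-orbits (`scal_τ` and
`proj_mul_X_mul_incl_τ`), which reduces the claim to typed arrows. There `scal` is zero or one, and
the nonzero entries are the definition of `arrG`. -/
theorem mat_arrG (a : A) (i j : S.Idx) :
    E.mat (N.arrG E) a i j = N.proj E i * N.X a * N.incl E j := by
  have hτ : ∀ a, (∀ i j, E.mat (N.arrG E) a i j = N.proj E i * N.X a * N.incl E j) ↔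
      ∀ i j, E.mat (N.arrG E) (S.τ a) i j = N.proj E i * N.X (S.τ a) * N.incl E j := by
    intro a
    have key : ∀ i j, S.coef a • E.mat (N.arrG E) (S.τ a) (S.ρ i) (S.ρ j) =
        S.χ (j.1.2 - i.1.2) • E.mat (N.arrG E) a i j := by
      intro i j
      rw [mat_apply, mat_apply, E.letter_τ, smul_smul, smul_smul, E.scal_τ]
    constructor
    · intro h i j
      obtain ⟨i, rfl⟩ := S.ρ.surjective i
      obtain ⟨j, rfl⟩ := S.ρ.surjective j
      apply smul_right_injective R (S.coef_ne_zero a)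
      change S.coef a • _ = S.coef a • _
      rw [key, h, N.proj_mul_X_mul_incl_τ]
    · intro h i j
      apply smul_right_injective R (S.χ_ne_zero (j.1.2 - i.1.2))
      change S.χ (j.1.2 - i.1.2) • _ = S.χ (j.1.2 - i.1.2) • _
      rw [← key, h, N.proj_mul_X_mul_incl_τ]
  have hzpow : ∀ (r : ℤ) a,
      (∀ i j, E.mat (N.arrG E) a i j = N.proj E i * N.X a * N.incl E j) ↔
      ∀ i j, E.mat (N.arrG E) ((S.τ ^ r) a) i j =
        N.proj E i * N.X ((S.τ ^ r) a) * N.incl E j := by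
    intro r
    induction r with
    | zero => exact fun a => Iff.rfl
    | succ m ih => exact fun a => by simp only [zpow_add_one, Equiv.Perm.mul_apply, ← ih, ← hτ]
    | pred m ih =>
      intro a
      simp only [zpow_sub_one, Equiv.Perm.mul_apply, ← ih]
      rw [hτ (S.τ⁻¹ a)]
      simp
  rw [← E.τ_zpow_shift a]
  refine (hzpow (E.shift a) (E.arrowRep a)).1 (fun i j => ?_) i j
  have hrep := E.arrowRep_isTyped a
  generalize E.arrowRep a = α at hrep
  rw [mat_apply]
  by_cases h : E.scal α i j = 0
  · rw [h, zero_smul]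
    by_cases hi : i.1.1 = S.Q.tgt α
    · by_cases hj : j.1.1 = S.Q.src α
      · have h3 : ¬ (S.Fixed (S.Q.src α) → S.Fixed (S.Q.tgt α) → i.1.2 = j.1.2 - S.b α) := by
          intro h4
          unfold Representatives.scal at h
          rw [if_pos ⟨hi, hj, h4⟩] at h
          exact S.χ_ne_zero _ h
        push Not at h3
        obtain ⟨hs, ht, hne⟩ := h3
        -- For incompatible indices the product contains two orthogonal character idempotents.
        rw [proj, incl, if_pos (hi ▸ ht), if_pos (hj ▸ hs), mul_assoc (N.E _), N.e_mul_X hs ht,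
          ← N.e_mul_E (hj ▸ hs), mul_assoc, mul_assoc, ← mul_assoc (N.e _), N.e_mul_e,
          if_neg fun hh => hne (by rw [← hh]; ring), zero_mul, mul_zero, mul_zero]
      · rw [← N.E_src, mul_assoc, mul_assoc, N.E_mul_incl, if_neg hj, mul_zero, mul_zero]
    · rw [← N.E_tgt, ← mul_assoc, N.proj_mul_E, if_neg hi, zero_mul, zero_mul]
  · obtain ⟨h1, h2, h3⟩ := E.under_letter hrep h
    rw [E.scal_eq_one_of_typed hrep h, one_smul, arrG, h1, h2, h3]

/-- The representation of `Q_G` obtained from an equivariant representation of `Q`. -/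
def repG : E.quiverG.Rep R where
  E := N.idemG E
  X := N.arrG E
  E_mul v w := by
    rcases v with v | ⟨v, μ⟩ <;> rcases w with w | ⟨w, ν⟩
    · change N.E v.1 * N.E w.1 = _
      rw [N.E_mul]
      by_cases h : v = w
      · rw [if_pos (congrArg Subtype.val h), if_pos (congrArg Sum.inl h)]; rfl
      · rw [if_neg fun hh => h (Subtype.ext hh), if_neg fun hh => h (Sum.inl_injective hh)]
    · change N.E v.1 * (N.E w.1 * N.e ν) = _
      have h : v.1 ≠ w.1 := fun h => v.2.2 (h ▸ w.2.2)
      rw [if_neg Sum.inl_ne_inr, ← mul_assoc, N.E_mul, if_neg h, zero_mul]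
    · change N.E v.1 * N.e μ * N.E w.1 = _
      have h : v.1 ≠ w.1 := fun h => w.2.2 (h ▸ v.2.2)
      rw [if_neg Sum.inr_ne_inl, ← N.e_mul_E v.2.2, mul_assoc, N.E_mul, if_neg h, mul_zero]
    · change N.E v.1 * N.e μ * (N.E w.1 * N.e ν) = _
      rw [mul_assoc, ← mul_assoc (N.e μ), N.e_mul_E w.2.2, mul_assoc, N.e_mul_e, ← mul_assoc,
        N.E_mul]
      by_cases h : (v, μ) = (w, ν)
      · obtain ⟨rfl, rfl⟩ := Prod.mk.inj h
        rw [if_pos rfl, if_pos rfl, if_pos rfl]; rfl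
      · rw [if_neg fun hh => h (Sum.inr_injective hh)]
        by_cases h1 : v.1 = w.1
        · rw [if_neg fun hh => h (Prod.ext (Subtype.ext h1) hh), mul_zero]
        · rw [if_neg h1, zero_mul]
  E_tgt β := by
    have h := E.tgt_letter (a := E.under β) (i := E.tgtIdx β) (j := E.srcIdx β)
      (by rw [E.scal_under]; exact one_ne_zero)
    rw [E.letter_under] at h
    rw [h, arrG, ← mul_assoc, ← mul_assoc, N.idemG_mul_proj]
  E_src β := by
    have h := E.src_letter (a := E.under β) (i := E.tgtIdx β) (j := E.srcIdx β)
      (by rw [E.scal_under]; exact one_ne_zero)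
    rw [E.letter_under] at h
    rw [h, arrG, mul_assoc, N.incl_mul_idemG]

/-- Conjugation by the maps `proj` and `incl`. -/
def toMat : R →ₙₐ[k] Matrix S.Idx S.Idx R where
  toFun z := Matrix.of fun i j => N.proj E i * z * N.incl E j
  map_smul' c z := by
    ext i j
    change N.proj E i * (c • z) * N.incl E j = c • (N.proj E i * z * N.incl E j)
    rw [mul_smul_comm, smul_mul_assoc]
  map_zero' := by ext i j; simp
  map_add' z z' := by ext i j; simp [mul_add, add_mul]
  map_mul' z z' := by
    ext i j
    simp only [Matrix.of_apply, Matrix.mul_apply]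
    have h : ∀ m, N.proj E i * z * N.incl E m * (N.proj E m * z' * N.incl E j) =
        N.proj E i * z * (N.incl E m * N.proj E m) * (z' * N.incl E j) := fun m => by
      simp only [mul_assoc]
    rw [Finset.sum_congr rfl fun m _ => h m, ← Finset.sum_mul, ← Finset.mul_sum,
      N.sum_incl_mul_proj, mul_one]
    simp only [mul_assoc]

theorem toMat_apply (z : R) (i j : S.Idx) :
    N.toMat E z i j = N.proj E i * z * N.incl E j := rfl

theorem toMat_X (a : A) : N.toMat E (N.X a) = E.mat (N.arrG E) a := by
  ext i j
  rw [toMat_apply, mat_arrG]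

/-- `toMat` carries the relations of `W` to the letter matrices of `arrG`, and `n ∂_β W_G` is a
combination of entries of these relations. -/
theorem cyclicDerivative_repG [Fintype A] {E} (C : CrossSection E)
    (hN : ∀ a, cyclicDerivative N.X a S.W = 0) (β : E.ArrowG) :
    cyclicDerivative (N.repG E).X β C.potentialG = 0 := by
  have h := C.cyclicDerivative_potentialG (N.arrG E) β
  have h2 : ∀ a, cyclicDerivative (E.mat (N.arrG E)) a S.W = 0 := by
    intro a
    have h3 := map_cyclicDerivative (W := S.W) (N.toMat E) N.X a fun c hc => two_le_length (S := S) hc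
    rw [hN, map_zero] at h3
    rw [h3]
    congr 1
    exact funext fun b => (N.toMat_X E b).symm
  simp only [h2, Matrix.zero_apply, smul_zero, Finset.sum_const_zero] at h
  exact (smul_eq_zero.1 h).resolve_left S.n_ne_zero

theorem U_E_eq (r : ZMod S.n) (v : V) : N.U r * N.E v = N.E ((S.σ ^ r.val) v) * N.U r := by
  have h := N.U_natCast_E r.val v
  rwa [ZMod.natCast_zmod_val] at h

/-- The subalgebra generated by the images of the vertices and of the group. -/
def base : Subalgebra k R := Algebra.adjoin k (Set.range N.E ∪ Set.range N.U)

theorem E_mem_base (v : V) : N.E v ∈ N.base := Algebra.subset_adjoin (Or.inl ⟨v, rfl⟩)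

theorem U_mem_base (r : ZMod S.n) : N.U r ∈ N.base := Algebra.subset_adjoin (Or.inr ⟨r, rfl⟩)

theorem e_mem_base (μ : ZMod S.n) : N.e μ ∈ N.base :=
  Subalgebra.smul_mem _ (Subalgebra.sum_mem _ fun r _ =>
    Subalgebra.smul_mem _ (N.U_mem_base r) _) _

theorem proj_mem_base (i : S.Idx) : N.proj E i ∈ N.base := by
  unfold proj
  split_ifs
  · exact mul_mem (N.E_mem_base _) (N.e_mem_base _)
  · exact mul_mem (N.U_mem_base _) (N.E_mem_base _)

theorem incl_mem_base (i : S.Idx) : N.incl E i ∈ N.base := by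
  unfold incl
  split_ifs
  · exact mul_mem (N.E_mem_base _) (N.e_mem_base _)
  · exact mul_mem (N.E_mem_base _) (N.U_mem_base _)

/-- The span of the elements `X a * U r`. -/
def arrowSpan : Submodule k R := Submodule.span k {z | ∃ a r, z = N.X a * N.U r}

/-- Vertices and group elements can be moved past an arrow up to a scalar, so `arrowSpan` is a
bimodule over `base`; in particular it contains every `arrG`. -/
theorem base_mul_mem {z m : R} (hz : z ∈ N.base) (hm : m ∈ N.arrowSpan) :
    z * m ∈ N.arrowSpan ∧ m * z ∈ N.arrowSpan := by
  refine Algebra.adjoin_induction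
    (p := fun z _ => ∀ m ∈ N.arrowSpan, z * m ∈ N.arrowSpan ∧ m * z ∈ N.arrowSpan)
    ?_ ?_ ?_ ?_ hz m hm
  · intro z hz m hm
    induction hm using Submodule.span_induction with
    | zero => simp
    | add x y _ _ hx hy =>
      rw [mul_add, add_mul]
      exact ⟨add_mem hx.1 hy.1, add_mem hx.2 hy.2⟩
    | smul c x _ hx =>
      rw [mul_smul_comm, smul_mul_assoc]
      exact ⟨Submodule.smul_mem _ c hx.1, Submodule.smul_mem _ c hx.2⟩
    | mem m hm =>
      obtain ⟨a, r, rfl⟩ := hm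
      have hmem : ∀ a r, N.X a * N.U r ∈ N.arrowSpan := fun a r =>
        Submodule.subset_span ⟨a, r, rfl⟩
      rcases hz with ⟨v, rfl⟩ | ⟨s, rfl⟩
      · constructor
        · rw [← mul_assoc, N.E_mul_X]
          split_ifs
          · exact hmem a r
          · rw [zero_mul]; exact zero_mem _
        · rw [mul_assoc, N.U_E_eq, ← mul_assoc, N.X_mul_E]
          split_ifs
          · exact hmem a r
          · rw [zero_mul]; exact zero_mem _
      · constructor
        · obtain ⟨c, a', h⟩ := N.U_X_exists s a
          rw [← mul_assoc, h, smul_mul_assoc, mul_assoc, ← N.U_add]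
          exact Submodule.smul_mem _ _ (hmem _ _)
        · rw [mul_assoc, ← N.U_add]
          exact hmem _ _
  · intro c m hm
    rw [← Algebra.commutes, ← Algebra.smul_def]
    exact ⟨Submodule.smul_mem _ c hm, Submodule.smul_mem _ c hm⟩
  · intro x y _ _ hx hy m hm
    rw [mul_add, add_mul]
    exact ⟨add_mem (hx m hm).1 (hy m hm).1, add_mem (hx m hm).2 (hy m hm).2⟩
  · intro x y _ _ hx hy m hm
    rw [mul_assoc, ← mul_assoc m]
    exact ⟨(hx _ (hy m hm).1).1, (hy _ (hx m hm).2).2⟩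

theorem arrG_mem_arrowSpan (β : E.ArrowG) : N.arrG E β ∈ N.arrowSpan := by
  have h : N.X (E.under β) ∈ N.arrowSpan :=
    Submodule.subset_span ⟨E.under β, 0, by rw [N.U_zero, mul_one]⟩
  exact (N.base_mul_mem (N.incl_mem_base E _) (N.base_mul_mem (N.proj_mem_base E _) h).1).2

/-- Each `arrG` is a combination of elements `X a * U r`. Moving all group elements to the right in
a product of `m` of them leaves a product of `m` arrows of `Q`. -/
theorem prod_arrG_eq_zero {m : ℕ} (hm : ∀ l : List A, l.length = m → (l.map N.X).prod = 0)
    (w : List E.ArrowG) (hw : w.length = m) : (w.map (N.repG E).X).prod = 0 := by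
  -- `l` and `r` record the arrows of `Q` and the group element collected so far.
  have key : ∀ (w : List E.ArrowG) (l : List A) (r : ZMod S.n), l.length + w.length = m →
      (l.map N.X).prod * N.U r * (w.map (N.repG E).X).prod = 0 := by
    intro w
    induction w with
    | nil => intro l r hl; rw [hm l (by simpa using hl), zero_mul, zero_mul]
    | cons β w ih =>
      intro l r hl
      rw [List.map_cons, List.prod_cons]
      change _ * (N.arrG E β * _) = 0
      refine Submodule.span_induction (p := fun z _ =>
        (l.map N.X).prod * N.U r * (z * (w.map (N.repG E).X).prod) = 0) ?_ (by simp) ?_ ?_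
        (N.arrG_mem_arrowSpan E β)
      · rintro _ ⟨a, s, rfl⟩
        obtain ⟨c, a', h⟩ := N.U_X_exists r a
        have h2 := ih (l ++ [a']) (r + s) (by simp at hl ⊢; omega)
        rw [mul_assoc, ← mul_assoc (N.U r), ← mul_assoc (N.U r), h, smul_mul_assoc,
          smul_mul_assoc, mul_smul_comm, mul_assoc (N.X a'), ← N.U_add]
        simp only [List.map_append, List.prod_append, List.map_singleton,
          List.prod_singleton] at h2
        rw [← mul_assoc, ← mul_assoc, h2, smul_zero]
      · intro x y _ _ hx hy
        rw [add_mul, mul_add, hx, hy, add_zero]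
      · intro c x _ hx
        rw [smul_mul_assoc, mul_smul_comm, hx, smul_zero]
  have := key w [] 0 (by simpa using hw)
  simpa [N.U_zero] using this

end EquivRep

end CyclicQP
end

/-! ### The symmetrising form of a skew group algebra, and the action of `G` by shift matrices. -/

noncomputable section

namespace SkewMonoidAlgebra

variable {k Λ G : Type*} [Field k] [Ring Λ] [Algebra k Λ] [CommGroup G] [MulSemiringAction G Λ]
  [SMulCommClass G k Λ]

/-- The linear form on a skew group algebra given by a linear form applied to the coefficient of
the element `q` of the group. -/
def coeffForm (f : Λ →ₗ[k] k) (q : G) : SkewMonoidAlgebra Λ G →ₗ[k] k where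
  toFun z := f (z.coeff q)
  map_add' z w := by simp
  map_smul' c z := by simp

theorem coeffForm_apply (f : Λ →ₗ[k] k) (q : G) (z : SkewMonoidAlgebra Λ G) :
    coeffForm f q z = f (z.coeff q) := rfl

/-- For homogeneous elements `a g` and `b h` with `gh = q`, one has `f(a · g b) = f(g b · q a) =
f(g(b · h a)) = f(b · h a)`. If `gh ≠ q` both sides vanish, as `G` is commutative. -/
theorem coeffForm_mul_comm {f : Λ →ₗ[k] k} {q : G} (hf : ∀ (g : G) a, f (g • a) = f a)
    (hq : ∀ a b, f (a * b) = f (b * q • a)) (z w : SkewMonoidAlgebra Λ G) :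
    coeffForm f q (z * w) = coeffForm f q (w * z) := by
  induction z with
  | add z z' hz hz' => rw [add_mul, mul_add, map_add, map_add, hz, hz']
  | single g a =>
    induction w with
    | add w w' hw hw' => rw [add_mul, mul_add, map_add, map_add, hw, hw']
    | single h b =>
      rw [single_mul_single, single_mul_single, coeffForm_apply, coeffForm_apply,
        coeff_single_apply, coeff_single_apply, mul_comm h g]
      split_ifs with hgh
      · rw [hq, ← hgh, mul_smul, ← smul_mul', hf]
      · rfl

/-- Multiplication by the homogeneous element `(g⁻¹ b) (g⁻¹ q)` moves the coefficient of `g` to the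
position `q` and multiplies it by `b`, so nondegeneracy is inherited from `f` coefficient by
coefficient. -/
theorem eq_zero_of_coeffForm_mul {f : Λ →ₗ[k] k} {q : G}
    (hf : ∀ a, (∀ b, f (a * b) = 0) → a = 0) {z : SkewMonoidAlgebra Λ G}
    (hz : ∀ w, coeffForm f q (z * w) = 0) : z = 0 := by
  ext g
  refine hf _ fun b => ?_
  have h := hz (single (g⁻¹ * q) (g⁻¹ • b))
  rw [coeffForm_apply, coeff_mul_single] at h
  have h2 : q * (g⁻¹ * q)⁻¹ = g := by group
  rwa [h2, smul_inv_smul] at h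

end SkewMonoidAlgebra

namespace CyclicQP

section Skew

variable {k V A Λ : Type*} [Field k] {S : CyclicQP k V A} [Ring Λ] [Algebra k Λ]
  [MulSemiringAction (Multiplicative (ZMod S.n)) Λ]
  [SMulCommClass (Multiplicative (ZMod S.n)) k Λ] [Fintype V]

/-- The representation of `Q` in the skew group algebra given by an equivariant representation
of `Q`. -/
def skewRep (M : S.Q.Rep Λ)
    (hE : ∀ v, Multiplicative.ofAdd (1 : ZMod S.n) • M.E v = M.E (S.σ v))
    (hX : ∀ a, Multiplicative.ofAdd (1 : ZMod S.n) • M.X a = S.coef a • M.X (S.τ a))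
    (hsum : ∑ v, M.E v = 1) :
    S.EquivRep (SkewMonoidAlgebra Λ (Multiplicative (ZMod S.n))) where
  E v := SkewMonoidAlgebra.single 1 (M.E v)
  X a := SkewMonoidAlgebra.single 1 (M.X a)
  E_mul v w := by
    rw [SkewMonoidAlgebra.single_mul_single, one_mul, one_smul, M.E_mul]
    split_ifs
    · rfl
    · rw [SkewMonoidAlgebra.single_zero]
  E_tgt a := by rw [SkewMonoidAlgebra.single_mul_single, one_mul, one_smul, M.E_tgt]
  E_src a := by rw [SkewMonoidAlgebra.single_mul_single, one_mul, one_smul, M.E_src]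
  U r := SkewMonoidAlgebra.single (Multiplicative.ofAdd r) 1
  U_zero := rfl
  U_add r s := by rw [SkewMonoidAlgebra.single_mul_single, smul_one, mul_one, ofAdd_add]
  U_E v := by
    rw [SkewMonoidAlgebra.single_mul_single, SkewMonoidAlgebra.single_mul_single, one_mul, hE,
      one_smul, mul_one, mul_one, one_mul]
  U_X a := by
    rw [SkewMonoidAlgebra.single_mul_single, SkewMonoidAlgebra.single_mul_single, one_mul, hX,
      one_smul, mul_one, mul_one, one_mul, SkewMonoidAlgebra.smul_single]
  sum_E := by
    change ∑ v, SkewMonoidAlgebra.singleAddHom 1 (M.E v) = 1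
    rw [← map_sum, hsum]
    rfl

end Skew

section ShiftMatrix

variable {k V A : Type*} [Field k] (S : CyclicQP k V A) (R : Type*) [Ring R] [Algebra k R]

theorem ρ_zpow_of_eq {r s : ℤ} (h : (r : ZMod S.n) = s) : S.ρ ^ r = S.ρ ^ s := by
  ext i : 1
  have h1 := S.ρ_zpow r i
  have h2 := S.ρ_zpow s i
  rw [S.σ_zpow_of_eq h] at h1
  exact Idx.ext' (h1.1.trans h2.1.symm) (h1.2.trans h2.2.symm)

/-- The matrix by which the element `r` of the group acts. -/
def shiftMat (r : ZMod S.n) : Matrix S.Idx S.Idx R := Matrix.of fun i j =>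
  if i = (S.ρ ^ (r.val : ℤ)) j then algebraMap k R (S.χ (-(r * j.1.2))) else 0

variable {S R}

theorem shiftMat_apply (r : ZMod S.n) (i j : S.Idx) : S.shiftMat R r i j =
    if i = (S.ρ ^ (r.val : ℤ)) j then algebraMap k R (S.χ (-(r * j.1.2))) else 0 := rfl

theorem shiftMat_intCast (r : ℤ) (i j : S.Idx) : S.shiftMat R (r : ZMod S.n) i j =
    if i = (S.ρ ^ r) j then algebraMap k R (S.χ (-(r * j.1.2))) else 0 := by
  rw [shiftMat_apply, S.ρ_zpow_of_eq (r := ((r : ZMod S.n).val : ℤ)) (s := r) (by simp)]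

theorem shiftMat_zero : S.shiftMat R 0 = 1 := by
  ext i j
  rw [shiftMat_apply, ZMod.val_zero, Matrix.one_apply]
  simp

variable [Fintype V]

theorem shiftMat_add (r s : ZMod S.n) :
    S.shiftMat R (r + s) = S.shiftMat R r * S.shiftMat R s := by
  obtain ⟨r, rfl⟩ := ZMod.intCast_surjective r
  obtain ⟨s, rfl⟩ := ZMod.intCast_surjective s
  ext i j
  rw [← Int.cast_add, shiftMat_intCast, Matrix.mul_apply, Finset.sum_eq_single ((S.ρ ^ s) j)]
  · rw [shiftMat_intCast, shiftMat_intCast, if_pos rfl, (S.ρ_zpow s j).2, zpow_add,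
      Equiv.Perm.mul_apply, ite_mul, zero_mul, ← map_mul, ← AddChar.map_add_eq_mul]
    congr 3
    push_cast
    ring
  · intro m _ hm
    rw [shiftMat_intCast s, if_neg hm, mul_zero]
  · simp

theorem shiftMat_one_mul (M : Matrix S.Idx S.Idx R) (i j : S.Idx) :
    (S.shiftMat R 1 * M) (S.ρ i) j = S.χ (-i.1.2) • M i j := by
  have h := shiftMat_intCast (S := S) (R := R) 1
  simp only [Int.cast_one, zpow_one, one_mul] at h
  rw [Matrix.mul_apply, Finset.sum_eq_single i]
  · rw [h, if_pos rfl, Algebra.smul_def]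
  · intro m _ hm
    rw [h, if_neg fun hh => hm (S.ρ.injective hh).symm, zero_mul]
  · simp

theorem mul_shiftMat_one (M : Matrix S.Idx S.Idx R) (i j : S.Idx) :
    (M * S.shiftMat R 1) i j = S.χ (-j.1.2) • M i (S.ρ j) := by
  have h := shiftMat_intCast (S := S) (R := R) 1
  simp only [Int.cast_one, zpow_one, one_mul] at h
  rw [Matrix.mul_apply, Finset.sum_eq_single (S.ρ j)]
  · rw [h, if_pos rfl, Algebra.smul_def, Algebra.commutes]
  · intro m _ hm
    rw [h, if_neg hm, mul_zero]
  · simp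

variable {E : S.Representatives} (M : E.quiverG.Rep R)

theorem matRep_E_apply (v : V) (i j : S.Idx) : (matRep M).E v i j =
    if i = j ∧ i.1.1 = v then M.E (E.η i) else 0 := by
  change Matrix.diagonal _ i j = _
  rw [Matrix.diagonal_apply, ite_and]

theorem η_ρ (i : S.Idx) : E.η (S.ρ i) = E.η i := E.vertG_congr (E.vertRep_σ i.1.1) _

theorem shiftMat_one_mul_E (v : V) :
    S.shiftMat R 1 * (matRep M).E v = (matRep M).E (S.σ v) * S.shiftMat R 1 := by
  ext i j
  obtain ⟨i, rfl⟩ := S.ρ.surjective i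
  rw [shiftMat_one_mul, mul_shiftMat_one, matRep_E_apply, matRep_E_apply, η_ρ]
  simp only [S.ρ.apply_eq_iff_eq, ρ_fst, S.σ.apply_eq_iff_eq]
  split_ifs with h
  · rw [h.1]
  · rw [smul_zero, smul_zero]

theorem shiftMat_one_mul_X (a : A) : S.shiftMat R 1 * (matRep M).X a =
    S.coef a • ((matRep M).X (S.τ a) * S.shiftMat R 1) := by
  ext i j
  obtain ⟨i, rfl⟩ := S.ρ.surjective i
  rw [shiftMat_one_mul, Matrix.smul_apply, mul_shiftMat_one]
  change S.χ _ • E.mat M.X a i j = S.coef a • S.χ _ • E.mat M.X (S.τ a) (S.ρ i) (S.ρ j)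
  rw [mat_apply, mat_apply, E.letter_τ, smul_smul, smul_smul, smul_smul, mul_right_comm, E.scal_τ,
    mul_right_comm, ← AddChar.map_add_eq_mul]
  congr 3
  ring

end ShiftMatrix

end CyclicQP
end

/-! ### The homomorphism from the skew group algebra to matrices. -/

noncomputable section

namespace CyclicQP

variable {k V A Λ R : Type*} [Field k] {S : CyclicQP k V A} [Ring Λ] [Algebra k Λ]
  [MulSemiringAction (Multiplicative (ZMod S.n)) Λ]
  [SMulCommClass (Multiplicative (ZMod S.n)) k Λ] [Fintype V] [Ring R] [Algebra k R]
  {E : S.Representatives}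

/-- An equivariant representation of `Q` in an algebra which it spans. -/
structure IsEquivariant (M : S.Q.Rep Λ) : Prop where
  smul_E : ∀ v, Multiplicative.ofAdd (1 : ZMod S.n) • M.E v = M.E (S.σ v)
  smul_X : ∀ a, Multiplicative.ofAdd (1 : ZMod S.n) • M.X a = S.coef a • M.X (S.τ a)
  sum_E : ∑ v, M.E v = 1
  span : Submodule.span k {x | ∃ (l : List A) (v : V), x = (l.map M.X).prod * M.E v} = ⊤

/-- A homomorphism to matrices compatible with the representation `matRep`. -/
structure IsMatHom (M : S.Q.Rep Λ) (M' : E.quiverG.Rep R)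
    (Ψ : Λ →ₙₐ[k] Matrix S.Idx S.Idx R) : Prop where
  map_E : ∀ v, Ψ (M.E v) = (matRep M').E v
  map_X : ∀ a, Ψ (M.X a) = (matRep M').X a

variable {M : S.Q.Rep Λ} {M' : E.quiverG.Rep R} {Ψ : Λ →ₙₐ[k] Matrix S.Idx S.Idx R}

/-- The covariance relation that makes the extension to the skew group algebra multiplicative. Paths
span `Λ`, so it follows from the relations for vertices and arrows. -/
theorem shiftMat_one_mul_map (hM : IsEquivariant M) (hΨ : IsMatHom M M' Ψ) (x : Λ) :
    S.shiftMat R 1 * Ψ x =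
      Ψ (Multiplicative.ofAdd (1 : ZMod S.n) • x) * S.shiftMat R 1 := by
  have hx : x ∈ Submodule.span k
      {x | ∃ (l : List A) (v : V), x = (l.map M.X).prod * M.E v} := by
    rw [hM.span]; exact Submodule.mem_top
  induction hx using Submodule.span_induction with
  | zero => simp
  | add x y _ _ hx hy => rw [smul_add, map_add, map_add, mul_add, add_mul, hx, hy]
  | smul c x _ hx =>
    rw [smul_comm, map_smul, map_smul, mul_smul_comm, smul_mul_assoc, hx]
  | mem x hx =>
    obtain ⟨l, v, rfl⟩ := hx
    induction l with
    | nil =>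
      rw [List.map_nil, List.prod_nil, one_mul, hM.smul_E, hΨ.map_E, hΨ.map_E,
        shiftMat_one_mul_E]
    | cons a l ih =>
      rw [List.map_cons, List.prod_cons, mul_assoc, map_mul, ← mul_assoc, hΨ.map_X,
        shiftMat_one_mul_X, smul_mul_assoc, mul_assoc, ih, smul_mul' _ (M.X a), map_mul, hM.smul_X,
        map_smul Ψ (S.coef a),
        hΨ.map_X, smul_mul_assoc, smul_mul_assoc, mul_assoc]

theorem shiftMat_mul_map (hM : IsEquivariant M) (hΨ : IsMatHom M M' Ψ) (r : ZMod S.n) (x : Λ) :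
    S.shiftMat R r * Ψ x = Ψ (Multiplicative.ofAdd r • x) * S.shiftMat R r := by
  suffices h : ∀ (m : ℕ) (x : Λ), S.shiftMat R (m : ZMod S.n) * Ψ x =
      Ψ (Multiplicative.ofAdd (m : ZMod S.n) • x) * S.shiftMat R (m : ZMod S.n) by
    simpa using h r.val x
  intro m
  induction m with
  | zero => intro x; simp [shiftMat_zero]
  | succ m ih =>
    intro x
    rw [Nat.cast_succ, shiftMat_add, mul_assoc, shiftMat_one_mul_map hM hΨ, ← mul_assoc, ih,
      ofAdd_add, mul_smul, mul_assoc]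

/-- The extension of a homomorphism to the skew group algebra. -/
def skewHom (hM : IsEquivariant M) (hΨ : IsMatHom M M' Ψ) :
    SkewMonoidAlgebra Λ (Multiplicative (ZMod S.n)) →ₙₐ[k] Matrix S.Idx S.Idx R where
  toFun := SkewMonoidAlgebra.liftNC (Ψ : Λ →+ Matrix S.Idx S.Idx R)
    fun r => S.shiftMat R r.toAdd
  map_smul' c z := by
    induction z with
    | add z w hz hw =>
      rw [smul_add, map_add, map_add, smul_add, hz, hw]
    | single g a =>
      rw [SkewMonoidAlgebra.smul_single, SkewMonoidAlgebra.liftNC_single,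
        SkewMonoidAlgebra.liftNC_single]
      change Ψ (c • a) * _ = c • (Ψ a * _)
      rw [map_smul, smul_mul_assoc]
  map_zero' := map_zero _
  map_add' := map_add _
  map_mul' z w := by
    induction z with
    | add z z' hz hz' => rw [add_mul, map_add, map_add, add_mul, hz, hz']
    | single g a =>
      induction w with
      | add w w' hw hw' => rw [mul_add, map_add, map_add, mul_add, hw, hw']
      | single h b =>
        rw [SkewMonoidAlgebra.single_mul_single, SkewMonoidAlgebra.liftNC_single,
          SkewMonoidAlgebra.liftNC_single, SkewMonoidAlgebra.liftNC_single]
        change Ψ (a * g • b) * S.shiftMat R (g.toAdd + h.toAdd) =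
          Ψ a * S.shiftMat R g.toAdd * (Ψ b * S.shiftMat R h.toAdd)
        rw [mul_assoc (Ψ a), ← mul_assoc (S.shiftMat R g.toAdd), shiftMat_mul_map hM hΨ, map_mul,
          shiftMat_add, ofAdd_toAdd]
        simp only [mul_assoc]

variable (hM : IsEquivariant M) (hΨ : IsMatHom M M' Ψ)

theorem skewHom_single (r : ZMod S.n) (x : Λ) :
    skewHom hM hΨ (SkewMonoidAlgebra.single (Multiplicative.ofAdd r) x) =
      Ψ x * S.shiftMat R r :=
  SkewMonoidAlgebra.liftNC_single _ _ _ _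

/-- The representation of `Q` in the skew group algebra. -/
def IsEquivariant.rep (hM : IsEquivariant M) :
    S.EquivRep (SkewMonoidAlgebra Λ (Multiplicative (ZMod S.n))) :=
  skewRep M hM.smul_E hM.smul_X hM.sum_E

theorem skewHom_E_mul_U (v : V) (r : ZMod S.n) :
    skewHom hM hΨ (hM.rep.E v * hM.rep.U r) = (matRep M').E v * S.shiftMat R r := by
  rw [← hΨ.map_E, ← skewHom_single hM hΨ]
  congr 1
  refine (SkewMonoidAlgebra.single_mul_single).trans ?_
  rw [one_mul, one_smul, mul_one]

theorem skewHom_E (v : V) : skewHom hM hΨ (hM.rep.E v) = (matRep M').E v := by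
  rw [← mul_one (hM.rep.E v), ← hM.rep.U_zero, skewHom_E_mul_U, shiftMat_zero, mul_one]

theorem skewHom_X (a : A) : skewHom hM hΨ (hM.rep.X a) = (matRep M').X a := by
  rw [← mul_one ((matRep M').X a), ← shiftMat_zero, ← hΨ.map_X]
  exact skewHom_single hM hΨ 0 (M.X a)

/-- Over a fixed vertex `shiftMat r` is diagonal with entries `χ(-rν)`, and orthogonality of
characters isolates `ν = μ`. -/
theorem skewHom_E_mul_e {v : V} (hv : S.Fixed v) (μ : ZMod S.n) :
    skewHom hM hΨ (hM.rep.E v * hM.rep.e μ) =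
      Matrix.single ⟨(v, μ), Or.inl hv⟩ ⟨(v, μ), Or.inl hv⟩ (M'.E (E.vertG v μ)) := by
  have h : skewHom hM hΨ (hM.rep.E v * hM.rep.e μ) = (S.n : k)⁻¹ •
      ∑ r, S.χ (r * μ) • ((matRep M').E v * S.shiftMat R r) := by
    rw [EquivRep.e, mul_smul_comm, map_smul, Finset.mul_sum, map_sum]
    congr 1
    refine Finset.sum_congr rfl fun r _ => ?_
    rw [mul_smul_comm, map_smul, skewHom_E_mul_U]
  rw [h]
  ext i j
  rw [Matrix.smul_apply, Matrix.sum_apply, Matrix.single_apply]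
  have h2 : ∀ r, (S.χ (r * μ) • ((matRep M').E v * S.shiftMat R r)) i j =
      if i.1.1 = v ∧ i = j then S.χ (r * (μ - i.1.2)) • M'.E (E.η i) else 0 := by
    intro r
    change S.χ (r * μ) • (Matrix.diagonal _ * _ : Matrix S.Idx S.Idx R) i j = _
    rw [Matrix.diagonal_mul, shiftMat_apply]
    by_cases hi : i.1.1 = v
    · have h3 : (i = (S.ρ ^ (r.val : ℤ)) j) ↔ i = j := by
        have h4 : (S.ρ ^ (r.val : ℤ)) i = i :=
          Idx.ext' (by rw [(S.ρ_zpow _ i).1, Fixed.zpow_apply (hi ▸ hv)]) (S.ρ_zpow _ i).2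
        conv_lhs => lhs; rw [← h4]
        rw [(S.ρ ^ (r.val : ℤ)).apply_eq_iff_eq]
      simp only [hi, h3, true_and, if_true]
      split_ifs with hij
      · subst hij
        rw [← Algebra.commutes, ← Algebra.smul_def, smul_smul, ← AddChar.map_add_eq_mul]
        congr 2
        ring
      · rw [mul_zero, smul_zero]
    · rw [if_neg hi, zero_mul, smul_zero, if_neg fun hh => hi hh.1]
  rw [Finset.sum_congr rfl fun r _ => h2 r]
  by_cases hij : i.1.1 = v ∧ i = j
  · obtain ⟨rfl, rfl⟩ := hij
    simp only [true_and, if_true]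
    rw [← Finset.sum_smul, S.sum_χ_mul, smul_smul]
    by_cases hμ : μ = i.1.2
    · subst hμ
      rw [if_pos (sub_self _), inv_mul_cancel₀ S.n_ne_zero, one_smul, if_pos ⟨rfl, rfl⟩]
      rfl
    · rw [if_neg (sub_ne_zero.2 hμ), mul_zero, zero_smul, if_neg]
      rintro ⟨h3, -⟩
      exact hμ (congrArg (fun m : S.Idx => m.1.2) h3)
  · simp only [if_neg hij]
    rw [Finset.sum_const_zero, smul_zero, if_neg]
    rintro ⟨rfl, rfl⟩
    exact hij ⟨rfl, rfl⟩

theorem idx_η_fst (i : S.Idx) : (E.idx (E.η i)).1.1 = E.vertRep i.1.1 := by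
  unfold Representatives.η Representatives.vertG
  split_ifs <;> rfl

theorem idx_η_of_fixed {i : S.Idx} (hi : S.Fixed i.1.1) : E.idx (E.η i) = i := by
  refine Idx.ext' ?_ ?_
  · rw [idx_η_fst, E.vertRep_of_mem (E.mem_of_fixed hi)]
  · unfold Representatives.η Representatives.vertG
    rw [dif_pos ((E.fixed_vertRep_iff _).2 hi)]
    rfl

theorem idx_η_of_mem {i : S.Idx} (hi : i.1.1 ∈ E.carrier) : E.idx (E.η i) = i := by
  by_cases h : S.Fixed i.1.1
  · exact idx_η_of_fixed h
  · refine Idx.ext' ?_ ?_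
    · rw [idx_η_fst, E.vertRep_of_mem hi]
    · rw [Idx.snd_eq_zero h, Idx.snd_eq_zero]
      rwa [idx_η_fst, E.fixed_vertRep_iff]

theorem η_idx (v : E.VertG) : E.η (E.idx v) = v := by
  rcases v with v | ⟨v, μ⟩
  · have h : E.vertRep v.1 = v.1 := E.vertRep_of_mem v.2.1
    unfold Representatives.η Representatives.vertG
    rw [dif_neg (show ¬ S.Fixed (E.vertRep (E.idx (Sum.inl v)).1.1) by
      rw [E.fixed_vertRep_iff]; exact v.2.2)]
    exact congrArg Sum.inl (Subtype.ext h)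
  · have h : E.vertRep v.1 = v.1 := E.vertRep_of_mem v.2.1
    unfold Representatives.η Representatives.vertG
    rw [dif_pos (show S.Fixed (E.vertRep (E.idx (Sum.inr (v, μ))).1.1) by
      rw [E.fixed_vertRep_iff]; exact v.2.2)]
    exact congrArg Sum.inr (Prod.ext (Subtype.ext h) rfl)

theorem matRep_E_eq_single {i : S.Idx} (hi : ¬ S.Fixed i.1.1) :
    (matRep M').E i.1.1 = Matrix.single i i (M'.E (E.η i)) := by
  ext a b
  rw [matRep_E_apply, Matrix.single_apply]
  have h : (a = b ∧ a.1.1 = i.1.1) ↔ i = a ∧ i = b := by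
    constructor
    · rintro ⟨rfl, h⟩
      have h2 : i = a := Idx.ext' h.symm (by rw [Idx.snd_eq_zero hi, Idx.snd_eq_zero (h ▸ hi)])
      exact ⟨h2, h2⟩
    · rintro ⟨rfl, rfl⟩
      exact ⟨rfl, rfl⟩
  by_cases hab : i = a ∧ i = b
  · rw [if_pos (h.2 hab), if_pos hab, hab.1]
  · rw [if_neg (mt h.1 hab), if_neg hab]

theorem skewHom_proj {i : S.Idx} (hi : i.1.1 ∈ E.carrier) :
    skewHom hM hΨ (hM.rep.proj E i) = Matrix.single i i (M'.E (E.η i)) := by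
  unfold EquivRep.proj
  split_ifs with h
  · exact skewHom_E_mul_e hM hΨ h i.1.2
  · rw [E.deg_of_mem hi, neg_zero, EquivRep.U_zero, one_mul, skewHom_E, matRep_E_eq_single h]

theorem skewHom_incl (j : S.Idx) : skewHom hM hΨ (hM.rep.incl E j) =
    Matrix.single j (E.idx (E.η j)) (M'.E (E.η j)) := by
  unfold EquivRep.incl
  split_ifs with h
  · rw [idx_η_of_fixed h]
    exact skewHom_E_mul_e hM hΨ h j.1.2
  · obtain ⟨r, hr⟩ := E.exists_zpow_vertRep j.1.1
    rw [skewHom_E_mul_U, matRep_E_eq_single h, E.deg_eq h hr]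
    have h0 : (E.idx (E.η j)).1.2 = 0 := Idx.snd_eq_zero (by rwa [idx_η_fst, E.fixed_vertRep_iff])
    have h1 : (S.ρ ^ r) (E.idx (E.η j)) = j := by
      refine Idx.ext' ?_ ?_
      · rw [(S.ρ_zpow r _).1, idx_η_fst, hr]
      · rw [(S.ρ_zpow r _).2, h0, Idx.snd_eq_zero h]
    ext a b
    by_cases ha : a = j
    · subst ha
      rw [Matrix.single_mul_apply_same, shiftMat_intCast, Matrix.single_apply]
      by_cases hb : E.idx (E.η a) = b
      · rw [← hb, if_pos h1.symm, h0, mul_zero, neg_zero, AddChar.map_zero_eq_one, map_one,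
          mul_one, if_pos ⟨rfl, rfl⟩]
      · rw [if_neg fun hh => hb ((S.ρ ^ r).injective (h1.trans hh)), mul_zero,
          if_neg fun hh => hb hh.2]
    · rw [Matrix.single_mul_apply_of_ne _ _ _ _ _ ha, Matrix.single_apply,
        if_neg fun hh => ha hh.1.symm]

theorem skewHom_idemG (v : E.VertG) : skewHom hM hΨ (hM.rep.idemG E v) =
    Matrix.single (E.idx v) (E.idx v) (M'.E v) := by
  rcases v with v | ⟨v, μ⟩
  · have h := matRep_E_eq_single (M' := M') (i := E.idx (Sum.inl v)) v.2.2
    rw [η_idx] at h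
    exact (skewHom_E hM hΨ v.1).trans h
  · have h := skewHom_E_mul_e hM hΨ v.2.2 μ
    have h2 : E.vertG v.1 μ = Sum.inr (v, μ) := η_idx (E := E) (Sum.inr (v, μ))
    rw [h2] at h
    exact h

/-- The images of `proj` and `incl` are supported on one matrix position each, so they cut out a
single entry of the matrix of `under β`; by `scal_under` and `letter_under` that entry is `M'.X β`.
-/
theorem skewHom_arrG (β : E.ArrowG) : skewHom hM hΨ (hM.rep.arrG E β) =
    Matrix.single (E.idx (E.quiverG.tgt β)) (E.idx (E.quiverG.src β)) (M'.X β) := by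
  have hs := E.scal_under β
  have hne : E.scal (E.under β) (E.tgtIdx β) (E.srcIdx β) ≠ 0 := by rw [hs]; exact one_ne_zero
  have h1 := E.tgt_letter hne
  have h2 := E.src_letter hne
  have hmem : (E.tgtIdx β).1.1 ∈ E.carrier := by
    rw [E.tgtIdx_fst]; exact (E.under_typed β).1
  have hX : (matRep M').X (E.under β) (E.tgtIdx β) (E.srcIdx β) = M'.X β := by
    change E.mat M'.X _ _ _ = _
    rw [mat_apply, hs, one_smul, E.letter_under]
  rw [E.letter_under] at h1 h2
  rw [EquivRep.arrG, map_mul, map_mul, skewHom_proj hM hΨ hmem, skewHom_incl, skewHom_X,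
    Matrix.single_mul_mul_single, hX, ← h1, ← h2, M'.E_tgt, M'.E_src, h1, idx_η_of_mem hmem]

theorem idx_injective : Function.Injective E.idx :=
  Function.LeftInverse.injective η_idx

/-- The homomorphism `skewHom` recovers the representation of `Q_G`. -/
theorem skewHom_prod (l : List E.ArrowG) (u v w : E.VertG) :
    skewHom hM hΨ ((l.map (hM.rep.repG E).X).prod * (hM.rep.repG E).E u) (E.idx v) (E.idx w) =
      M'.E v * ((l.map M'.X).prod * M'.E u) * M'.E w := by
  induction l generalizing v with
  | nil =>
    rw [List.map_nil, List.prod_nil, one_mul, List.map_nil, List.prod_nil, one_mul, M'.E_mul]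
    refine (congrFun (congrFun (skewHom_idemG hM hΨ u) _) _).trans ?_
    rw [Matrix.single_apply]
    simp only [idx_injective.eq_iff]
    by_cases h1 : v = u
    · subst h1
      rw [if_pos rfl, M'.E_mul]
      by_cases h2 : v = w
      · rw [if_pos ⟨rfl, h2⟩, if_pos h2]
      · rw [if_neg fun hh => h2 hh.2, if_neg h2]
    · rw [if_neg fun hh => h1 hh.1.symm, if_neg h1, zero_mul]
  | cons β l ih =>
    rw [List.map_cons, List.prod_cons, mul_assoc, map_mul]
    have h : skewHom hM hΨ ((hM.rep.repG E).X β) = _ := skewHom_arrG hM hΨ β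
    rw [h, List.map_cons, List.prod_cons]
    by_cases h1 : v = E.quiverG.tgt β
    · rw [h1, Matrix.single_mul_apply_same, ih]
      simp only [← mul_assoc, M'.E_tgt, M'.E_src]
    · rw [Matrix.single_mul_apply_of_ne _ _ _ _ _ fun hh => h1 (idx_injective hh)]
      simp only [← mul_assoc, M'.E_mul_X, if_neg h1, zero_mul]

end CyclicQP
end

/-! ### The Jacobian algebra of `(Q_G, W_G)` as a corner of the skew group algebra. -/

noncomputable section

namespace CyclicQP

section Span

variable {k V A R : Type*} [Field k] {S : CyclicQP k V A} {E : S.Representatives} [Fintype V]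
  [Ring R] [Algebra k R] (N : S.EquivRep R)

theorem EquivRep.U_mul_incl_exists (r : ZMod S.n) (j : S.Idx) :
    ∃ (c : k) (j' : S.Idx), N.U r * N.incl E j = c • N.incl E j' := by
  suffices h : ∀ (m : ℕ) (j : S.Idx), ∃ (c : k) (j' : S.Idx),
      N.U (m : ZMod S.n) * N.incl E j = c • N.incl E j' by simpa using h r.val j
  intro m
  induction m with
  | zero => exact fun j => ⟨1, j, by simp [N.U_zero]⟩
  | succ m ih =>
    intro j
    obtain ⟨c, j', h⟩ := ih (S.ρ j)
    refine ⟨S.χ (-j.1.2) * c, j', ?_⟩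
    rw [Nat.cast_succ, N.U_add, mul_assoc, N.U_mul_incl, mul_smul_comm, h, smul_smul]

/-- Inserting `1 = ∑ incl m * proj m` between consecutive arrows produces products of entries, each
a multiple of some `arrG`. -/
theorem EquivRep.proj_mul_prod_mul_incl_mem {T : NonUnitalSubalgebra k R}
    (hE : ∀ u, N.idemG E u ∈ T) (hX : ∀ β, N.arrG E β ∈ T) (l : List A) (i j : S.Idx) :
    N.proj E i * (l.map N.X).prod * N.incl E j ∈ T := by
  induction l generalizing i with
  | nil =>
    rw [List.map_nil, List.prod_nil, mul_one, N.proj_mul_incl]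
    split_ifs
    · exact hE _
    · exact zero_mem _
  | cons a l ih =>
    have h : N.proj E i * ((a :: l).map N.X).prod * N.incl E j =
        ∑ m, E.mat (N.arrG E) a i m * (N.proj E m * (l.map N.X).prod * N.incl E j) := by
      simp only [N.mat_arrG]
      have h2 : ∀ m, N.proj E i * N.X a * N.incl E m *
          (N.proj E m * (l.map N.X).prod * N.incl E j) =
          N.proj E i * N.X a * (N.incl E m * N.proj E m) *
            ((l.map N.X).prod * N.incl E j) := fun m => by simp only [mul_assoc]
      rw [Finset.sum_congr rfl fun m _ => h2 m, ← Finset.sum_mul, ← Finset.mul_sum,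
        N.sum_incl_mul_proj, List.map_cons, List.prod_cons]
      simp only [mul_assoc, one_mul]
    rw [h]
    refine sum_mem fun m _ => mul_mem ?_ (ih m)
    rw [mat_apply]
    exact SMulMemClass.smul_mem _ (hX _)

theorem EquivRep.proj_mul_mul_incl_mem {T : NonUnitalSubalgebra k R}
    (hE : ∀ u, N.idemG E u ∈ T) (hX : ∀ β, N.arrG E β ∈ T)
    (hN : Submodule.span k {z | ∃ (l : List A) (v : V) (r : ZMod S.n),
      z = (l.map N.X).prod * N.E v * N.U r} = ⊤) (z : R) (i j : S.Idx) :
    N.proj E i * z * N.incl E j ∈ T := by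
  have hz : z ∈ Submodule.span k {z | ∃ (l : List A) (v : V) (r : ZMod S.n),
      z = (l.map N.X).prod * N.E v * N.U r} := by rw [hN]; exact Submodule.mem_top
  induction hz using Submodule.span_induction with
  | zero => rw [mul_zero, zero_mul]; exact zero_mem _
  | add x y _ _ hx hy => rw [mul_add, add_mul]; exact add_mem hx hy
  | smul c x _ hx => rw [mul_smul_comm, smul_mul_assoc]; exact SMulMemClass.smul_mem c hx
  | mem x hx =>
    obtain ⟨l, v, r, rfl⟩ := hx
    obtain ⟨c, j', h⟩ := N.U_mul_incl_exists (E := E) r j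
    rw [mul_assoc, mul_assoc _ (N.U r), h, mul_smul_comm, mul_smul_comm, mul_assoc, N.E_mul_incl]
    split_ifs
    · rw [← mul_assoc]
      exact SMulMemClass.smul_mem c (N.proj_mul_prod_mul_incl_mem hE hX l i j')
    · rw [mul_zero, mul_zero, smul_zero]; exact zero_mem _

/-- Vertices and arrows of `Q_G` generate every Peirce component of the corner. Applied to the image
of the Jacobian algebra, this provides enough elements there to test nondegeneracy. -/
theorem EquivRep.idemG_mul_mul_idemG_mem {T : NonUnitalSubalgebra k R}
    (hE : ∀ u, N.idemG E u ∈ T) (hX : ∀ β, N.arrG E β ∈ T)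
    (hN : Submodule.span k {z | ∃ (l : List A) (v : V) (r : ZMod S.n),
      z = (l.map N.X).prod * N.E v * N.U r} = ⊤) (z : R) (u w : E.VertG) :
    N.idemG E u * z * N.idemG E w ∈ T := by
  have h : ∀ u, N.idemG E u = N.proj E (E.idx u) * N.incl E (E.idx u) := fun u => by
    rw [N.proj_mul_incl, if_pos rfl, η_idx]
  have h2 := N.proj_mul_mul_incl_mem hE hX hN
    (N.incl E (E.idx u) * z * N.proj E (E.idx w)) (E.idx u) (E.idx w)
  rw [h u, h w]
  simpa only [mul_assoc] using h2

end Span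

section Length

variable {k V A : Type*} [Field k] {S : CyclicQP k V A} {E : S.Representatives}

theorem length_liftWord (μ : ZMod S.n) (l : List A) : (E.liftWord μ l).length = l.length := by
  induction l with
  | nil => rfl
  | cons a l ih => simp [Representatives.liftWord, ih]

theorem length_liftWordThree (μ : ZMod S.n) (l : List A) :
    (E.liftWordThree μ l).length = l.length := by
  cases l with
  | nil => rfl
  | cons a l => simp [Representatives.liftWordThree, length_liftWord]

theorem length_of_mem_support_cycleG {l : List A} {c : Cycle E.ArrowG}
    (hc : c ∈ (E.cycleG l).support) : c.length = l.length := by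
  by_contra hne
  rw [Finsupp.mem_support_iff] at hc
  apply hc
  have h1 : ∀ (w : List E.ArrowG) (r : k), w.length = l.length →
      Finsupp.single (w : Cycle E.ArrowG) r c = 0 := fun w r hw =>
    Finsupp.single_eq_of_ne (by rintro rfl; exact hne hw)
  unfold Representatives.cycleG
  split_ifs
  · exact h1 _ _ (length_liftWord _ _)
  · rw [Finsupp.finsetSum_apply]
    exact Finset.sum_eq_zero fun μ _ => h1 _ _ (length_liftWord _ _)
  · rw [Finsupp.finsetSum_apply]
    exact Finset.sum_eq_zero fun μ _ => h1 _ _ (length_liftWordThree _ _)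
  · rw [Finsupp.finsetSum_apply]
    exact Finset.sum_eq_zero fun μ _ => h1 _ _ (length_liftWord _ _)

theorem CrossSection.two_le_length (C : CrossSection E) {c : Cycle E.ArrowG}
    (hc : c ∈ C.potentialG.support) : 2 ≤ c.length := by
  obtain ⟨l, hl, h⟩ := Finset.mem_biUnion.1 (Finsupp.support_finsetSum hc)
  rw [length_of_mem_support_cycleG (Finsupp.support_smul h)]
  exact CyclicQP.two_le_length (C.mem_support l hl)

end Length

section Main

variable {k V A : Type*} [Field k] [Fintype V] [Fintype A] {S : CyclicQP k V A}
  [MulSemiringAction (Multiplicative (ZMod S.n)) (JacobianAlgebra S.Q S.W)]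
  [SMulCommClass (Multiplicative (ZMod S.n)) k (JacobianAlgebra S.Q S.W)]

theorem span_skew (hM : IsEquivariant (jacobianRep S.Q S.W)) :
    Submodule.span k {z | ∃ (l : List A) (v : V) (r : ZMod S.n),
      z = (l.map hM.rep.X).prod * hM.rep.E v * hM.rep.U r} = ⊤ := by
  rw [Submodule.eq_top_iff']
  intro z
  induction z with
  | add z w hz hw => exact add_mem hz hw
  | single g x =>
    have hx : x ∈ Submodule.span k {x | ∃ (l : List A) (v : V),
        x = (l.map (jacobianRep S.Q S.W).X).prod * (jacobianRep S.Q S.W).E v} := by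
      rw [hM.span]; exact Submodule.mem_top
    induction hx using Submodule.span_induction with
    | zero => rw [SkewMonoidAlgebra.single_zero]; exact zero_mem _
    | add x y _ _ hx hy => rw [SkewMonoidAlgebra.single_add]; exact add_mem hx hy
    | smul c x _ hx => rw [← SkewMonoidAlgebra.smul_single]; exact Submodule.smul_mem _ c hx
    | mem x hx =>
      obtain ⟨l, v, rfl⟩ := hx
      refine Submodule.subset_span ⟨l, v, g.toAdd, ?_⟩
      have h : (l.map hM.rep.X).prod = SkewMonoidAlgebra.singleOneRingHom
          ((l.map (jacobianRep S.Q S.W).X).prod) := by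
        rw [map_list_prod, List.map_map]; rfl
      rw [h]
      change _ = SkewMonoidAlgebra.single 1 _ * SkewMonoidAlgebra.single 1 _ *
        SkewMonoidAlgebra.single g 1
      rw [SkewMonoidAlgebra.single_mul_single, SkewMonoidAlgebra.single_mul_single, one_mul,
        one_mul, one_smul, smul_one, mul_one]

/-- The inclusion of an algebra in a skew group algebra. -/
def _root_.SkewMonoidAlgebra.inclusion (k : Type*) {Λ G : Type*} [Field k] [Ring Λ] [Algebra k Λ]
    [CommGroup G] [MulSemiringAction G Λ] [SMulCommClass G k Λ] :
    Λ →ₐ[k] SkewMonoidAlgebra Λ G :=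
  { SkewMonoidAlgebra.singleOneRingHom with commutes' := fun _ => rfl }

theorem cyclicDerivative_rep (hM : IsEquivariant (jacobianRep S.Q S.W)) (a : A) :
    cyclicDerivative hM.rep.X a S.W = 0 := by
  have h := map_cyclicDerivative (W := S.W)
    (SkewMonoidAlgebra.inclusion k (G := Multiplicative (ZMod S.n))) (jacobianRep S.Q S.W).X a
    fun c hc => two_le_length (S := S) hc
  rw [cyclicDerivative_jacobianRep, map_zero] at h
  exact h.symm

theorem prod_rep_eq_zero (hM : IsEquivariant (jacobianRep S.Q S.W)) {m : ℕ}
    (hm : ∀ l : List A, l.length = m → (l.map (jacobianRep S.Q S.W).X).prod = 0) (l : List A)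
    (hl : l.length = m) : (l.map hM.rep.X).prod = 0 := by
  have h : (l.map hM.rep.X).prod = SkewMonoidAlgebra.inclusion k
      ((l.map (jacobianRep S.Q S.W).X).prod) := by
    rw [map_list_prod, List.map_map]; rfl
  rw [h, hm l hl, map_zero]

theorem eq_sum_E_mul_mul_E {V A R : Type*} [Fintype V] [Ring R] {Q : ArrowQuiver V A}
    (M : Q.Rep R) (hM : ∑ v, M.E v = 1) (x : R) : x = ∑ v, ∑ w, M.E v * x * M.E w := by
  simp only [← Finset.mul_sum, hM, mul_one]
  rw [← Finset.sum_mul, hM, one_mul]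

theorem exists_prod_jacobianRep_eq_zero (S : CyclicQP k V A) :
    ∃ m, ∀ l : List A, l.length = m → (l.map (jacobianRep S.Q S.W).X).prod = 0 :=
  ArrowQuiver.Rep.exists_prod_eq_zero (fun _ hc => two_le_length hc) S.admissible
    cyclicDerivative_jacobianRep

/-- The nilpotency needed to evaluate series comes from the admissible ideal of `W` alone; nothing
is assumed about products of arrows of `Q_G`. -/
theorem exists_isMatHom {R : Type*} [Ring R] [Algebra k R] {E : S.Representatives}
    (C : CrossSection E) {M' : E.quiverG.Rep R}
    (hM' : ∀ β, cyclicDerivative M'.X β C.potentialG = 0) :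
    ∃ Ψ : JacobianAlgebra S.Q S.W →ₙₐ[k] Matrix S.Idx S.Idx R,
      IsMatHom (jacobianRep S.Q S.W) M' Ψ := by
  have h1 : ∀ a, cyclicDerivative (matRep M').X a S.W = 0 :=
    C.cyclicDerivative_mat_eq_zero hM'
  obtain ⟨m, hm⟩ := ArrowQuiver.Rep.exists_prod_eq_zero (M := matRep M')
    (fun _ hc => two_le_length hc) S.admissible h1
  exact ⟨ArrowQuiver.Rep.liftJacobian (fun _ hc => two_le_length hc) h1 hm,
    ⟨fun v => ArrowQuiver.Rep.liftJacobian_E _ _ _ v,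
      fun a => ArrowQuiver.Rep.liftJacobian_X _ _ _ a⟩⟩

/-- The Jacobian algebra of `(Q_G, W_G)` is finite-dimensional and embeds in the skew group
algebra. -/
theorem exists_injective (hM : IsEquivariant (jacobianRep S.Q S.W)) {E : S.Representatives}
    (C : CrossSection E) :
    Module.Finite k (JacobianAlgebra E.quiverG C.potentialG) ∧
    ∃ Φ : JacobianAlgebra E.quiverG C.potentialG →ₙₐ[k]
        SkewMonoidAlgebra (JacobianAlgebra S.Q S.W) (Multiplicative (ZMod S.n)),
      Function.Injective Φ ∧
      (∀ u, Φ ((jacobianRep E.quiverG C.potentialG).E u) = hM.rep.idemG E u) ∧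
      ∀ β, Φ ((jacobianRep E.quiverG C.potentialG).X β) = hM.rep.arrG E β := by
  set M' := jacobianRep E.quiverG C.potentialG with hM'
  have hsum : ∑ v, M'.E v = 1 := sum_jacobianRep_E
  obtain ⟨m, hm⟩ := exists_prod_jacobianRep_eq_zero S
  obtain ⟨Ψ, hΨ⟩ := exists_isMatHom C (M' := M') cyclicDerivative_jacobianRep
  have hN := hM.rep.prod_arrG_eq_zero (E := E) (prod_rep_eq_zero hM hm)
  -- Long products of arrows of `Q_G` vanish in the skew group algebra, and the entries of `skewHom`
  -- carry this back to the Peirce components in the Jacobian algebra.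
  have hP : ∀ w : List E.ArrowG, w.length = m → (w.map M'.X).prod = 0 := by
    intro w hw
    rw [eq_sum_E_mul_mul_E M' hsum (w.map M'.X).prod]
    refine Finset.sum_eq_zero fun u _ => Finset.sum_eq_zero fun v _ => ?_
    have h := skewHom_prod hM hΨ w v u v
    rw [hN w hw, zero_mul, map_zero, Matrix.zero_apply] at h
    simp only [mul_assoc, M'.E_mul, if_true] at h ⊢
    exact h.symm
  have hΦE := ArrowQuiver.Rep.liftJacobian_E (k := k) (M := hM.rep.repG E)
    (fun _ hc => C.two_le_length hc) (hM.rep.cyclicDerivative_repG C (cyclicDerivative_rep hM)) hN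
  have hΦX := ArrowQuiver.Rep.liftJacobian_X (k := k) (M := hM.rep.repG E)
    (fun _ hc => C.two_le_length hc) (hM.rep.cyclicDerivative_repG C (cyclicDerivative_rep hM)) hN
  set Φ := ArrowQuiver.Rep.liftJacobian (k := k) (M := hM.rep.repG E)
    (fun _ hc => C.two_le_length hc) (hM.rep.cyclicDerivative_repG C (cyclicDerivative_rep hM)) hN
  refine ⟨finite_jacobian hP, Φ, ?_, hΦE, hΦX⟩
  -- The matrix of `Φ x` contains all Peirce components of `x`, which add up to `x`; this gives
  -- injectivity.
  have key : ∀ x v w, skewHom hM hΨ (Φ x) (E.idx v) (E.idx w) = M'.E v * x * M'.E w := by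
    intro x v w
    have hx : x ∈ Submodule.span k {x | ∃ (l : List E.ArrowG) (v : E.VertG), l.length ≤ m ∧
        x = (l.map M'.X).prod * M'.E v} := by rw [span_jacobian hP]; exact Submodule.mem_top
    induction hx using Submodule.span_induction with
    | zero => simp
    | add x y _ _ hx hy =>
      rw [map_add, map_add, Matrix.add_apply, hx, hy, mul_add, add_mul]
    | smul c x _ hx =>
      rw [map_smul, map_smul, Matrix.smul_apply, hx, mul_smul_comm, smul_mul_assoc]
    | mem x hx =>
      obtain ⟨l, u, -, rfl⟩ := hx
      have h : Φ ((l.map M'.X).prod * M'.E u) =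
          (l.map (hM.rep.repG E).X).prod * (hM.rep.repG E).E u := by
        induction l with
        | nil => rw [List.map_nil, List.prod_nil, one_mul, hΦE, List.map_nil, List.prod_nil,
            one_mul]
        | cons β l ih =>
          rw [List.map_cons, List.prod_cons, mul_assoc, map_mul, ih, hΦX, List.map_cons,
            List.prod_cons, mul_assoc]
      rw [h, skewHom_prod]
  rw [injective_iff_map_eq_zero]
  intro x hx
  rw [eq_sum_E_mul_mul_E M' hsum x]
  refine Finset.sum_eq_zero fun u _ => Finset.sum_eq_zero fun v _ => ?_
  rw [← key, hx, map_zero, Matrix.zero_apply]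

/-- The form is the symmetrising trace of the skew group algebra pulled back along `Φ`. It stays
nondegenerate because the image of `Φ` contains the full corner. -/
theorem isSymmAlgebra_of_isEquivariant (hM : IsEquivariant (jacobianRep S.Q S.W))
    {E : S.Representatives} (C : CrossSection E) {f : JacobianAlgebra S.Q S.W →ₗ[k] k}
    {q : Multiplicative (ZMod S.n)}
    (hf : ∀ (g : Multiplicative (ZMod S.n)) a, f (g • a) = f a)
    (hq : ∀ a b, f (a * b) = f (b * q • a))
    (hnd : ∀ a, (∀ b, f (a * b) = 0) → a = 0) :
    IsSymmAlgebra k (JacobianAlgebra E.quiverG C.potentialG) := by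
  obtain ⟨hfin, Φ, hinj, hΦE, hΦX⟩ := exists_injective hM C
  refine ⟨hfin, ?_⟩
  set M' := jacobianRep E.quiverG C.potentialG with hM'
  have hsum : ∑ v, M'.E v = 1 := sum_jacobianRep_E
  set T : SkewMonoidAlgebra (JacobianAlgebra S.Q S.W) (Multiplicative (ZMod S.n)) →ₗ[k] k :=
    SkewMonoidAlgebra.coeffForm f q
  have hT : ∀ z w, T (z * w) = T (w * z) := SkewMonoidAlgebra.coeffForm_mul_comm hf hq
  let B : JacobianAlgebra E.quiverG C.potentialG →ₗ[k]
      JacobianAlgebra E.quiverG C.potentialG →ₗ[k] k :=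
    LinearMap.mk₂ k (fun x y => T (Φ (x * y)))
      (fun x y z => by rw [add_mul, map_add, map_add])
      (fun c x y => by rw [smul_mul_assoc, map_smul, map_smul])
      (fun x y z => by rw [mul_add, map_add, map_add])
      (fun c x y => by rw [mul_smul_comm, map_smul, map_smul])
  have hB : ∀ x y, B x y = T (Φ (x * y)) := fun x y => rfl
  have hsymm : ∀ x y, B x y = B y x := fun x y => by
    rw [hB, hB, map_mul Φ, map_mul Φ, hT]
  have hleft : ∀ x, (∀ y, B x y = 0) → x = 0 := by
    intro x hx
    apply hinj
    rw [map_zero]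
    refine SkewMonoidAlgebra.eq_zero_of_coeffForm_mul (q := q) hnd fun z => ?_
    have h1 : Φ x = ∑ u, ∑ w, hM.rep.idemG E u * Φ x * hM.rep.idemG E w := by
      conv_lhs => rw [eq_sum_E_mul_mul_E M' hsum x]
      simp only [map_sum, map_mul, hΦE]
    change T (Φ x * z) = 0
    rw [h1]
    simp only [Finset.sum_mul, map_sum]
    refine Finset.sum_eq_zero fun u _ => Finset.sum_eq_zero fun w _ => ?_
    -- By cyclicity of `T`, testing `e_u Φ(x) e_w` against `z` amounts to testing `Φ x` against `e_w
    -- z e_u`, which lies in the image of `Φ`.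
    have h2 := hM.rep.idemG_mul_mul_idemG_mem (E := E) (T := NonUnitalAlgHom.range Φ)
      (fun u => ⟨_, hΦE u⟩) (fun β => ⟨_, hΦX β⟩) (span_skew hM) z w u
    obtain ⟨y, hy⟩ := h2
    have h3 := hx y
    rw [hB, map_mul Φ] at h3
    change Φ y = _ at hy
    rw [mul_assoc (hM.rep.idemG E u * Φ x), mul_assoc (hM.rep.idemG E u), hT, ← h3, hy]
    simp only [mul_assoc]
  refine ⟨B, ⟨⟨hleft, fun y hy => hleft y fun x => ?_⟩, fun a b c => ?_⟩, hsymm⟩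
  · rw [hsymm]; exact hy x
  · rw [hB, hB, mul_assoc]

end Main

end CyclicQP

end

/-! ### The Nakayama automorphism as an element of the group. -/

open CyclicQP

theorem mainTheorem6 {k V A : Type*} [Field k] [Finite V] [Finite A]
    (S : CyclicQP k V A)
    (hself : IsSelfInjective (JacobianAlgebra S.Q S.W))
    (φ : JacobianAlgebra S.Q S.W ≃ₐ[k] JacobianAlgebra S.Q S.W)
    (hφ : IsNakayamaAutomorphism φ)
    (h : pathAlgebra k S.Q ≃ₐ[k] pathAlgebra k S.Q)
    (hh : Subgroup.zpowers h = Subgroup.zpowers S.g)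
    (hφh : ∀ f : pathAlgebra k S.Q, φ (toJacobian S.Q S.W f) = toJacobian S.Q S.W (h f))
    (E : S.Representatives) (C : CyclicQP.CrossSection E) :
    IsSymmAlgebra k (JacobianAlgebra E.quiverG C.potentialG) := by
  have := Fintype.ofFinite V
  have := Fintype.ofFinite A
  set J : pathAlgebra k S.Q →ₐ[k] JacobianAlgebra S.Q S.W :=
    (jacobianMk S.Q S.W).comp (pathAlgebra k S.Q).val with hJ
  have hφJ : ∀ f, φ (J f) = J (h f) := hφh
  have hJE : ∀ v, J (pathVert k S.Q v) = (jacobianRep S.Q S.W).E v := fun v => rfl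
  have hJX : ∀ a, J (pathArrow k S.Q a) = (jacobianRep S.Q S.W).X a := fun a => rfl
  obtain ⟨m, hm⟩ := exists_prod_jacobianRep_eq_zero S
  have hspan : Submodule.span k {x | ∃ (l : List A) (v : V),
      x = (l.map (jacobianRep S.Q S.W).X).prod * (jacobianRep S.Q S.W).E v} = ⊤ := by
    rw [eq_top_iff, ← span_jacobian hm]
    refine Submodule.span_mono ?_
    rintro _ ⟨l, v, -, rfl⟩
    exact ⟨l, v, rfl⟩
  -- By nilpotency finite combinations of paths already fill the Jacobian algebra, so identities
  -- between automorphisms may be checked on `pathAlgebra`.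
  have hsurj : Function.Surjective J := by
    rw [← AlgHom.coe_toLinearMap, ← LinearMap.range_eq_top, eq_top_iff, ← hspan,
      Submodule.span_le]
    rintro _ ⟨l, v, rfl⟩
    refine ⟨(l.map (pathArrow k S.Q)).prod * pathVert k S.Q v, ?_⟩
    rw [AlgHom.coe_toLinearMap, map_mul, map_list_prod, List.map_map]
    rfl
  have hzpow : ∀ (s : ℤ) f, (φ ^ s) (J f) = J ((h ^ s) f) := by
    have hinv : ∀ f, φ⁻¹ (J f) = J (h⁻¹ f) := fun f => by
      apply φ.injective
      rw [hφJ, ← AlgEquiv.mul_apply, ← AlgEquiv.mul_apply, mul_inv_cancel, mul_inv_cancel]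
      rfl
    intro s
    induction s with
    | zero => intro f; rfl
    | succ i ih =>
      intro f
      rw [zpow_add_one, zpow_add_one, AlgEquiv.mul_apply, AlgEquiv.mul_apply, hφJ, ih]
    | pred i ih =>
      intro f
      rw [zpow_sub_one, zpow_sub_one, AlgEquiv.mul_apply, AlgEquiv.mul_apply, hinv, ih]
  -- With `g = h ^ s` and `h = g ^ t`, the automorphism induced by `g` is `φ ^ s`, and `φ` is its
  -- `t`-th power.
  obtain ⟨s, hs⟩ : S.g ∈ Subgroup.zpowers h := by
    rw [hh]; exact Subgroup.mem_zpowers _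
  obtain ⟨t, ht⟩ : h ∈ Subgroup.zpowers S.g := by
    rw [← hh]; exact Subgroup.mem_zpowers _
  change h ^ s = S.g at hs
  change S.g ^ t = h at ht
  have hθJ : ∀ f, (φ ^ s) (J f) = J (S.g f) := fun f => by rw [hzpow, hs]
  have hθn : (φ ^ s) ^ S.n = 1 := by
    ext x
    obtain ⟨f, rfl⟩ := hsurj x
    rw [← zpow_natCast, ← zpow_mul, hzpow, zpow_mul, hs, zpow_natCast, ← S.orderOf_g,
      pow_orderOf_eq_one]
    rfl
  have hφθ : φ = (φ ^ s) ^ t := by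
    ext x
    obtain ⟨f, rfl⟩ := hsurj x
    rw [← zpow_mul, hzpow, zpow_mul, hs, ht, hφJ]
  -- `ℤ/n` acts through `φ ^ s`, whose `n`-th power is the identity; the representative `val` of an
  -- exponent is therefore harmless.
  let Θ : Multiplicative (ZMod S.n) →*
      (JacobianAlgebra S.Q S.W ≃ₐ[k] JacobianAlgebra S.Q S.W) :=
    { toFun := fun r => (φ ^ s) ^ r.toAdd.val
      map_one' := by rw [toAdd_one, ZMod.val_zero, pow_zero]
      map_mul' := fun r r' => by
        rw [toAdd_mul, ZMod.val_add, ← pow_eq_pow_mod _ hθn, pow_add] }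
  let _ : MulSemiringAction (Multiplicative (ZMod S.n)) (JacobianAlgebra S.Q S.W) :=
    MulSemiringAction.compHom _ Θ
  have hsmul : ∀ (g : Multiplicative (ZMod S.n)) (x : JacobianAlgebra S.Q S.W),
      g • x = Θ g x := fun g x => rfl
  have : SMulCommClass (Multiplicative (ZMod S.n)) k (JacobianAlgebra S.Q S.W) :=
    ⟨fun g c x => map_smul (Θ g) c x⟩
  have hΘ : ∀ r : ℤ, Θ (Multiplicative.ofAdd (r : ZMod S.n)) = (φ ^ s) ^ r := by
    intro r
    change (φ ^ s) ^ ((r : ZMod S.n).val) = (φ ^ s) ^ r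
    rw [← zpow_natCast, ZMod.val_intCast]
    conv_rhs => rw [← Int.emod_add_mul_ediv r S.n, zpow_add, zpow_mul (φ ^ s) (S.n : ℤ),
      zpow_natCast (φ ^ s) S.n, hθn, one_zpow, mul_one]
  have hone : ∀ f, Multiplicative.ofAdd (1 : ZMod S.n) • J f = J (S.g f) := fun f => by
    have h1 := hΘ 1
    rw [Int.cast_one, zpow_one] at h1
    rw [hsmul, h1, hθJ]
  have hM : IsEquivariant (jacobianRep S.Q S.W) :=
    { smul_E := fun v => by rw [← hJE, hone, S.g_vert, hJE]
      smul_X := fun a => by rw [← hJX, hone, S.g_arrow, map_smul, hJX]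
      sum_E := sum_jacobianRep_E
      span := hspan }
  obtain ⟨B, ⟨hB, hassoc⟩, hsymm⟩ := hφ
  have hB1 : ∀ a b, B a b = B 1 (a * b) := fun a b => by rw [hassoc, one_mul]
  -- From `(1, φ(a)) = (a, 1) = (1, a)`: the linear form of a Frobenius form is invariant under its
  -- Nakayama automorphism, hence under `G`.
  have hφB : ∀ a, B 1 (φ a) = B 1 a := fun a => by
    rw [← hsymm, hB1 a 1, mul_one]
  have hφzpow : ∀ (r : ℤ) a, B 1 ((φ ^ r) a) = B 1 a := by
    have hinv : ∀ a, B 1 (φ⁻¹ a) = B 1 a := fun a => by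
      rw [← hφB, ← AlgEquiv.mul_apply, mul_inv_cancel]
      rfl
    intro r
    induction r with
    | zero => intro a; rfl
    | succ i ih => intro a; rw [zpow_add_one, AlgEquiv.mul_apply, ih, hφB]
    | pred i ih => intro a; rw [zpow_sub_one, AlgEquiv.mul_apply, ih, hinv]
  -- The trace reads the coefficient at `q = t`, the group element acting as `φ`.
  refine isSymmAlgebra_of_isEquivariant hM C (f := B 1)
    (q := Multiplicative.ofAdd (t : ZMod S.n)) (fun g a => ?_) (fun a b => ?_) (fun a ha => ?_)
  · change B 1 (((φ ^ s) ^ g.toAdd.val) a) = _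
    rw [← zpow_natCast, ← zpow_mul, hφzpow]
  · rw [hsmul, hΘ, ← hφθ, ← hB1, ← hB1, hsymm]
  · exact hB.1 a fun b => by rw [hB1, ha]
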